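/- Let $n\ge 2$, write $\mathbf{R}^n=\mathbf{C}\times\mathbf{R}^{n-2}$ with points $p=(z,t)$, $z=re^{i\theta}$, and fix $\alpha\in(0,\tfrac12)$. Let $V$ be the flat real line bundle with holonomy $-1$ over $\mathbf{C}^*\times\mathbf{R}^{n-2}$; its sections are extended by $0$ over the singular set $\{0\}\times\mathbf{R}^{n-2}$ and are identified with functions on the branched double cover $(w,t)\mapsto(w^2,t)$ that are odd under $(w,t)\mapsto(-w,t)$. For a section $s$ over $U$, where $U$ is $\mathbf{R}^n$ or the open unit ball $B_1\subset\mathbf{R}^n$ centred at $0$, let $$\|s\|_{,\alpha}=\sup\frac{|s(p)-s(p')|}{|p-p'|^{\alpha}},$$ the supremum being over pairs $p=(z,t)$, $p'=(z',t')$ of distinct points of $U$ off the singular set with $|p-p'|\le\tfrac12\min(|z|,|z'|)$, where values are compared by parallel transport along the segment from $p$ to $p'$. Let $$\|s\|_{\mathcal{D}^{2,\alpha}}=\max_D\|Ds\|_{,\alpha},$$ where $D$ runs over all monomials of degree at most $2$ (including the identity) in the commuting vector fields $r\partial_r,\ \partial_\theta,\ \partial_{t_1},\dots,\partial_{t_{n-2}}$.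 Let $\mathcal{L}^2_1$ be the completion of the compactly supported smooth sections of $V$ in the norm $\|\nabla u\|_{L^2}$. For an $L^2$ section $\rho$ with compact support let $G(\rho)$ be the unique $u\in\mathcal{L}^2_1$ with $\Delta u=\rho$ weakly, i.e. $\int\langle\nabla u,\nabla\psi\rangle=-\int\rho\psi$ for all compactly supported smooth sections $\psi$. Then there is a constant $C$, depending only on $n$ and $\alpha$, such that for every section $\rho$ of $V$ over $\mathbf{R}^n$ with compact support in $B_1$ and $\|\rho\|_{,\alpha}<\infty$, the solution $G(\rho)$ exists and is unique (up to null sets), is represented by a section that is $C^2$ on $B_1$ away from the singular set, and satisfies $$\big\|G(\rho)|_{B_1}\big\|_{\mathcal{D}^{2,\alpha}}\le C\,\|\rho\|_{,\alpha}.$$ -/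

import Mathlib

/-!
Sections of the flat real line bundle `V` with holonomy `-1` over `ℂ* × ℝᵐ` (here `m = n - 2`)
are represented by functions on the branched double cover `(w, t) ↦ (w², t)` which are odd under
`(w, t) ↦ (-w, t)`. An odd function automatically vanishes on the singular set `w = 0`.
-/

noncomputable section

namespace BranchedModel

/-- The space `ℂ × ℝᵐ = ℝⁿ` with its Euclidean norm. -/
abbrev Base (m : ℕ) : Type := WithLp 2 (ℂ × EuclideanSpace ℝ (Fin m))

/-- The branched double cover of `Base m`, with coordinates `(w, t)`. -/
abbrev Cover (m : ℕ) : Type := ℂ × EuclideanSpace ℝ (Fin m)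

/-- The branched covering map `(w, t) ↦ (z, t) = (w², t)`. -/
def proj {m : ℕ} (p : Cover m) : Base m := WithLp.toLp 2 (p.1 ^ 2, p.2)

/-- Sections of `V`: functions on the double cover that are odd under the covering involution. -/
def IsSection {m : ℕ} (s : Cover m → ℝ) : Prop :=
  ∀ (w : ℂ) (t : EuclideanSpace ℝ (Fin m)), s (-w, t) = -s (w, t)

/-- Integration over `ℝⁿ` of functions that are invariant under the covering involution: half of
the pull-back of Lebesgue measure, the Jacobian of `w ↦ w²` being `4|w|²`. -/
def coverMeasure (m : ℕ) : MeasureTheory.Measure (Cover m) :=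
  MeasureTheory.volume.withDensity fun p => ENNReal.ofReal (2 * ‖p.1‖ ^ 2)

/-- The inverse of the derivative of `proj` at a point `p = (w, t)` with `w ≠ 0`. -/
def lift {m : ℕ} (p : Cover m) (v : Base m) : Cover m := (v.fst / (2 * p.1), v.snd)

/-- The derivative (for the flat structure of `V`) of the section `s` along a vector field `X`
on `ℝⁿ`. -/
def along {m : ℕ} (X : Base m → Base m) (s : Cover m → ℝ) : Cover m → ℝ :=
  fun p => fderiv ℝ s p (lift p (X (proj p)))

/-- The standard orthonormal frame `∂/∂x, ∂/∂y, ∂/∂tᵢ` of `ℝⁿ = ℂ × ℝᵐ`. -/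
def frame {m : ℕ} : Fin 2 ⊕ Fin m → Base m → Base m
  | Sum.inl 0 => fun _ => WithLp.toLp 2 (1, 0)
  | Sum.inl 1 => fun _ => WithLp.toLp 2 (Complex.I, 0)
  | Sum.inr i => fun _ => WithLp.toLp 2 (0, EuclideanSpace.single i 1)

/-- The `n` commuting tangential vector fields `r ∂/∂r`, `∂/∂θ`, `∂/∂tᵢ`, where `z = r e^{iθ}`. -/
def tangential {m : ℕ} : Fin 2 ⊕ Fin m → Base m → Base m
  | Sum.inl 0 => fun x => WithLp.toLp 2 (x.fst, 0)
  | Sum.inl 1 => fun x => WithLp.toLp 2 (Complex.I * x.fst, 0)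
  | Sum.inr i => fun _ => WithLp.toLp 2 (0, EuclideanSpace.single i 1)

/-- The monomial in the tangential vector fields with the given list of factors. -/
def monomial {m : ℕ} (l : List (Fin 2 ⊕ Fin m)) (s : Cover m → ℝ) : Cover m → ℝ :=
  l.foldr (fun a f => along (tangential a) f) s

/-- The Hölder norm `‖s‖_{,α}` over a region `U` of `ℝⁿ`: the supremum of
`|s(x) - s(x')| / |x - x'|^α` over the pairs `x = (z, t)`, `x' = (z', t')` in `U` with
`|x - x'| ≤ ½ min(|z|, |z'|)`, the values being compared by parallel transport along the segment
from `x` to `x'`. The lift of that segment starting at `w` ends at the square root `w'` of `z'`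
whose argument differs from that of `w` by less than `π/2`, that is `Re (w w̄') > 0`. -/
def holderNorm {m : ℕ} (α : ℝ) (U : Set (Base m)) (s : Cover m → ℝ) : ENNReal :=
  ⨆ (p : Cover m) (q : Cover m) (_ : proj p ∈ U) (_ : proj q ∈ U)
    (_ : dist (proj p) (proj q) ≤ 1 / 2 * min ‖p.1 ^ 2‖ ‖q.1 ^ 2‖)
    (_ : 0 < (p.1 * (starRingEnd ℂ) q.1).re),
    ENNReal.ofReal (|s p - s q| / dist (proj p) (proj q) ^ α)

/-- The `𝓓^{k,α}` norm over `U`: the maximum of the Hölder norms of `D s` over all monomials `D` of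
degree at most `k` in the tangential vector fields. -/
def dNorm {m : ℕ} (k : ℕ) (α : ℝ) (U : Set (Base m)) (s : Cover m → ℝ) : ENNReal :=
  ⨆ (l : List (Fin 2 ⊕ Fin m)) (_ : l.length ≤ k), holderNorm α U (monomial l s)

/-- Smooth sections of `V` with compact support in `ℂ* × ℝᵐ`. -/
structure IsTestSection {m : ℕ} (φ : Cover m → ℝ) : Prop where
  isSection : IsSection φ
  smooth : ContDiff ℝ ((⊤ : ℕ∞) : WithTop ℕ∞) φ
  compact : HasCompactSupport φ
  away : tsupport φ ⊆ {p | p.1 ≠ 0}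

/-- The section `u` belongs to `𝓛²₁`, the completion of the compactly supported sections in the norm
`‖∇u‖_{L²}`, and has gradient `g` (in components with respect to `frame`): there are compactly
supported smooth sections `φ k` with `∇ φ k → g` in `L²` and `φ k → u` in `L²_loc`. -/
structure IsL21 {m : ℕ} (u : Cover m → ℝ) (g : Fin 2 ⊕ Fin m → Cover m → ℝ) : Prop where
  isSection : IsSection u
  measurable : MeasureTheory.AEStronglyMeasurable u (coverMeasure m)
  measurable_grad : ∀ a, MeasureTheory.AEStronglyMeasurable (g a) (coverMeasure m)
  approx : ∃ φ : ℕ → Cover m → ℝ, (∀ k, IsTestSection (φ k)) ∧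
    (∀ a, Filter.Tendsto
      (fun k => MeasureTheory.eLpNorm (along (frame a) (φ k) - g a) 2 (coverMeasure m))
      Filter.atTop (nhds 0)) ∧
    (∀ K : Set (Cover m), IsCompact K → Filter.Tendsto
      (fun k => MeasureTheory.eLpNorm (φ k - u) 2 ((coverMeasure m).restrict K))
      Filter.atTop (nhds 0))

/-- `u = G(ρ)`: `u` lies in `𝓛²₁` and solves `Δ u = ρ` in the weak sense, that is
`∫ ⟨∇u, ∇ψ⟩ = - ∫ ρ ψ` for all compactly supported smooth sections `ψ`. -/
def IsGreen {m : ℕ} (ρ u : Cover m → ℝ) : Prop :=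
  ∃ g : Fin 2 ⊕ Fin m → Cover m → ℝ, IsL21 u g ∧
    ∀ ψ : Cover m → ℝ, IsTestSection ψ →
      ∫ p, ∑ a, g a p * along (frame a) ψ p ∂(coverMeasure m) =
        -∫ p, ρ p * ψ p ∂(coverMeasure m)

end BranchedModel

end

open MeasureTheory Set Filter Topology

noncomputable section

namespace BranchedModel

variable {m : ℕ}

/-! ### Distances in the base and Hölder bounds -/

/-! The solution is minus the time integral of the heat flow, G(ρ) = -∫₀^∞ e^{sΔ}ρ ds, and the proof
rests on an explicit heat kernel. Let w, v be square roots of the planar coordinates of two points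
x, y. Up to a constant, the kernel of V at time one is exp(-|x-y|²/4) erf(Re(w v̄)) (`ker`); the
other times follow by dilation. Two features of erf matter. It tends to ±1, so away from the
singular set the kernel is the Euclidean one with parallel transport; the error is controlled by
exp(-|x-y|²/4) exp(-Re(w v̄)²), which is exactly the Gaussian of the broken path from x to y through
the singular set (`gk_mul_exp`). It vanishes at 0, so the kernel vanishes like |w||v|. Both features
survive tangential differentiation (`exists_kerL_eq`, `exists_kerL_sub_gkL_le`,
`exists_kerL_le_mul`).

Derivatives of the Euclidean Gaussian have mean zero, so they see only the oscillation of a Hölder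
section (`exists_heat_le`). After scaling, a derivative of order k of the flow is O(s^{(α-k)/2}) for
bounded z and small s (`exists_flow_le`). First-order vanishing in w gives `exists_flow_le_norm`,
and compact support of ρ gives decay for large times and far away (`exists_flow_le_decay`).

For the Hölder estimate, take two points at distance D. Times below D² are handled by the sizes of
the derivatives (for the undifferentiated flow, by its distance to ρ), times above D² by the mean
value inequality with one more derivative. Near the singular set the flow behaves like r^{1/2}, so
the gain is only √D s^{α/2-5/4}. This is integrable at infinity exactly when α < 1/2
(`exists_pot_sub_pot_le`).

The heat equation, integrated over all times, gives the pointwise Poisson equation off the singular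
set (`IsSource.laplacian_pot`), and integration by parts on the double cover gives the weak one.
Decay of the solution and its gradient shows that cut-offs of truncated time integrals converge to
it in energy (`IsSource.isL21`). Uniqueness follows from orthogonality and a Poincaré inequality for
functions that are odd on circles (`IsGreen.ae_eq`).

The bookkeeping device is `IsTower`: a function is carried together with all its iterated tangential
derivatives, with differentiability asked only off the singular set. Integrals over space or time
can then be differentiated entry by entry, and `IsTower.monomial_eq` recovers the monomials that
enter the norm. -/

/-- The distance between the projections to the base of two points of the double cover. -/
def baseDist (p q : Cover m) : ℝ := dist (proj p) (proj q)

/-- The real part of the product of the first coordinate of `p` and the conjugate of that of `q`. -/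
def crossRe (p q : Cover m) : ℝ := p.1.re * q.1.re + p.1.im * q.1.im

/-- The imaginary part of the product of the first coordinate of `p` and the conjugate of that
of `q`. -/
def crossIm (p q : Cover m) : ℝ := p.1.im * q.1.re - p.1.re * q.1.im

lemma crossRe_eq (p q : Cover m) : crossRe p q = (p.1 * (starRingEnd ℂ) q.1).re := by
  simp [crossRe]

lemma baseDist_nonneg (p q : Cover m) : 0 ≤ baseDist p q := dist_nonneg

lemma baseDist_sq (p q : Cover m) :
    baseDist p q ^ 2 = ‖p.1 ^ 2 - q.1 ^ 2‖ ^ 2 + ‖p.2 - q.2‖ ^ 2 := by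
  rw [baseDist, dist_eq_norm, WithLp.prod_norm_sq_eq_of_L2]
  rfl

lemma baseDist_comm (p q : Cover m) : baseDist p q = baseDist q p := dist_comm _ _

lemma baseDist_triangle (p q s : Cover m) : baseDist p s ≤ baseDist p q + baseDist q s :=
  dist_triangle _ _ _

lemma norm_fst_sub_le (p q : Cover m) : ‖p.1 ^ 2 - q.1 ^ 2‖ ≤ baseDist p q := by
  apply abs_le_of_sq_le_sq' _ (baseDist_nonneg p q) |>.2
  rw [baseDist_sq]; nlinarith [sq_nonneg ‖p.2 - q.2‖]

lemma norm_snd_sub_le (p q : Cover m) : ‖p.2 - q.2‖ ≤ baseDist p q := by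
  apply abs_le_of_sq_le_sq' _ (baseDist_nonneg p q) |>.2
  rw [baseDist_sq]; nlinarith [sq_nonneg ‖p.1 ^ 2 - q.1 ^ 2‖]

lemma baseDist_le_add (p q : Cover m) : baseDist p q ≤ ‖p.1 ^ 2 - q.1 ^ 2‖ + ‖p.2 - q.2‖ := by
  apply abs_le_of_sq_le_sq' _ (by positivity) |>.2
  rw [baseDist_sq]; nlinarith [norm_nonneg (p.1 ^ 2 - q.1 ^ 2), norm_nonneg (p.2 - q.2)]

lemma norm_sq_le_add (p q : Cover m) : ‖q.1‖ ^ 2 ≤ ‖p.1‖ ^ 2 + baseDist p q := by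
  have h := norm_fst_sub_le p q
  have h2 := norm_sub_norm_le (q.1 ^ 2) (p.1 ^ 2)
  rw [norm_sub_rev, norm_pow, norm_pow] at h2
  linarith

lemma norm_sq_fst (p : Cover m) : ‖p.1‖ ^ 2 = p.1.re ^ 2 + p.1.im ^ 2 := by
  rw [Complex.sq_norm, Complex.normSq_apply]; ring

lemma norm_sub_sq (p q : Cover m) : ‖p.1 ^ 2 - q.1 ^ 2‖ ^ 2 =
    ((p.1 ^ 2 - q.1 ^ 2).re) ^ 2 + ((p.1 ^ 2 - q.1 ^ 2).im) ^ 2 := by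
  rw [Complex.sq_norm, Complex.normSq_apply]; ring

/-- The polarisation identity `|z - y|² + 4 Re(w v̄)² = (|z| + |y|)²` for `z = w²` and `y = v²`. -/
lemma norm_sub_sq_add_crossRe (p q : Cover m) :
    ‖p.1 ^ 2 - q.1 ^ 2‖ ^ 2 + 4 * crossRe p q ^ 2 = (‖p.1‖ ^ 2 + ‖q.1‖ ^ 2) ^ 2 := by
  rw [norm_sub_sq, norm_sq_fst, norm_sq_fst, crossRe]
  simp [pow_two]; ring

lemma crossRe_sq_add_crossIm_sq (p q : Cover m) :
    crossRe p q ^ 2 + crossIm p q ^ 2 = (‖p.1‖ * ‖q.1‖) ^ 2 := by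
  rw [mul_pow, norm_sq_fst, norm_sq_fst, crossRe, crossIm]; ring

lemma abs_crossRe_le (p q : Cover m) : |crossRe p q| ≤ ‖p.1‖ * ‖q.1‖ := by
  apply abs_le_of_sq_le_sq _ (by positivity)
  rw [← crossRe_sq_add_crossIm_sq]; nlinarith [sq_nonneg (crossIm p q)]

lemma abs_crossIm_le (p q : Cover m) : |crossIm p q| ≤ ‖p.1‖ * ‖q.1‖ := by
  apply abs_le_of_sq_le_sq _ (by positivity)
  rw [← crossRe_sq_add_crossIm_sq]; nlinarith [sq_nonneg (crossRe p q)]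

/-! ### Hölder sections: decay at the singular set, global comparison and continuity. -/

/-- `f` satisfies the Hölder condition of `holderNorm` over all of `ℝⁿ` with constant `A`. -/
def HolderBound (α A : ℝ) (f : Cover m → ℝ) : Prop :=
  ∀ p q : Cover m, baseDist p q ≤ 1 / 2 * min (‖p.1‖ ^ 2) (‖q.1‖ ^ 2) → 0 < crossRe p q →
    |f p - f q| ≤ A * baseDist p q ^ α

/-- The two lifts of a point differ by the sign of w, and positivity of `crossRe` excludes the
opposite sign. -/
lemma eq_of_baseDist_eq_zero {p q : Cover m} (h : baseDist p q = 0) (hx : 0 < crossRe p q) :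
    p = q := by
  have h1 : p.1 ^ 2 = q.1 ^ 2 :=
    sub_eq_zero.1 (norm_le_zero_iff.1 ((norm_fst_sub_le p q).trans h.le))
  have h2 : p.2 = q.2 := sub_eq_zero.1 (norm_le_zero_iff.1 ((norm_snd_sub_le p q).trans h.le))
  rcases sq_eq_sq_iff_eq_or_eq_neg.1 h1 with h3 | h3
  · exact Prod.ext h3 h2
  · rw [crossRe, h3] at hx
    simp only [Complex.neg_re, Complex.neg_im] at hx
    nlinarith [sq_nonneg q.1.re, sq_nonneg q.1.im]

lemma holderBound_of_holderNorm_ne_top {α : ℝ} {f : Cover m → ℝ}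
    (h : holderNorm α univ f ≠ ⊤) : HolderBound α (holderNorm α univ f).toReal f := by
  intro p q hpq hx
  -- At distance zero the Hölder quotient carries no information, but there the two points coincide.
  rcases (baseDist_nonneg p q).eq_or_lt with h0 | h0
  · rw [eq_of_baseDist_eq_zero h0.symm hx, sub_self, abs_zero]
    exact mul_nonneg ENNReal.toReal_nonneg (Real.rpow_nonneg (baseDist_nonneg _ _) _)
  · have h1 : ENNReal.ofReal (|f p - f q| / baseDist p q ^ α) ≤ holderNorm α univ f := by
      unfold holderNorm
      refine le_iSup_of_le p <| le_iSup_of_le q <| le_iSup_of_le (mem_univ _) <|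
        le_iSup_of_le (mem_univ _) <| le_iSup_of_le ?_ <| le_iSup_of_le ?_ le_rfl
      · rw [norm_pow, norm_pow]; exact hpq
      · rwa [← crossRe_eq]
    have h2 := (ENNReal.ofReal_le_iff_le_toReal h).1 h1
    rwa [div_le_iff₀ (Real.rpow_pos_of_pos h0 α)] at h2

lemma IsSection.apply_zero {f : Cover m → ℝ} (hf : IsSection f) (t) : f (0, t) = 0 := by
  have := hf 0 t
  rw [neg_zero] at this; linarith

/-- A section with a Hölder bound decays like `|z|^α` at the singular set. -/
lemma HolderBound.abs_le {α A : ℝ} (hα : 0 < α) (hA : 0 ≤ A) {f : Cover m → ℝ}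
    (hf : IsSection f) (h : HolderBound α A f) (p : Cover m) :
    |f p| ≤ 8 * A * (‖p.1‖ ^ 2) ^ α := by
  obtain ⟨w, t⟩ := p
  rcases eq_or_ne w 0 with rfl | hw
  · rw [hf.apply_zero, abs_zero]
    exact mul_nonneg (by positivity) (Real.rpow_nonneg (by positivity) _)
  have hr : 0 < ‖w‖ ^ 2 := by positivity
  -- Multiplication by ζ moves z = w² by at most |z|π/8 ≤ |z|/2, an admissible step, and sixteen
  -- such steps carry w to -w. By oddness they add up to 2|f|, whence the constant 16/2 = 8.
  set ζ : ℂ := Complex.exp (Complex.I * (Real.pi / 16 : ℝ)) with hζ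
  have hζn : ‖ζ‖ = 1 := by rw [hζ, mul_comm]; exact Complex.norm_exp_ofReal_mul_I _
  have hζ2 : ‖ζ ^ 2 - 1‖ ≤ 1 / 2 := by
    have h1 : ζ ^ 2 = Complex.exp (Complex.I * (Real.pi / 8 : ℝ)) := by
      rw [hζ, ← Complex.exp_nat_mul]; congr 1; push_cast; ring
    rw [h1]
    refine (Real.norm_exp_I_mul_ofReal_sub_one_le).trans ?_
    rw [Real.norm_eq_abs, abs_of_pos (by positivity)]
    linarith [Real.pi_lt_four]
  have hζ16 : ζ ^ 16 = -1 := by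
    rw [hζ, ← Complex.exp_nat_mul, ← Complex.exp_pi_mul_I]; congr 1; push_cast; ring
  have hζre : 0 < ζ.re := by
    rw [hζ, mul_comm, Complex.exp_ofReal_mul_I_re]
    exact Real.cos_pos_of_mem_Ioo ⟨by linarith [Real.pi_pos], by linarith [Real.pi_pos]⟩
  have step : ∀ v : ℂ, ‖v‖ = ‖w‖ → |f (ζ * v, t) - f (v, t)| ≤ A * (‖w‖ ^ 2) ^ α := by
    intro v hv
    have hd : baseDist ((ζ * v, t) : Cover m) (v, t) ≤ 1 / 2 * ‖w‖ ^ 2 := by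
      refine (baseDist_le_add _ _).trans ?_
      have : (ζ * v) ^ 2 - v ^ 2 = (ζ ^ 2 - 1) * v ^ 2 := by ring
      simp only [sub_self, norm_zero, add_zero, this, norm_mul, norm_pow, hv]
      gcongr
    refine (h (ζ * v, t) (v, t) ?_ ?_).trans ?_
    · simpa [norm_mul, hζn, hv] using hd
    · have : crossRe ((ζ * v, t) : Cover m) (v, t) = ζ.re * ‖v‖ ^ 2 := by
        rw [Complex.sq_norm, Complex.normSq_apply, crossRe]
        simp; ring
      rw [this, hv]; positivity
    · gcongr
      · exact baseDist_nonneg _ _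
      · linarith
  have hk : ∀ k : ℕ, |f (ζ ^ k * w, t) - f (w, t)| ≤ k * (A * (‖w‖ ^ 2) ^ α) := by
    intro k
    induction k with
    | zero => simp
    | succ k ih =>
      have h1 := step (ζ ^ k * w) (by simp [norm_pow, hζn])
      rw [← mul_assoc, ← pow_succ'] at h1
      push_cast
      have := abs_sub_le (f (ζ ^ (k + 1) * w, t)) (f (ζ ^ k * w, t)) (f (w, t))
      linarith
  have h16 := hk 16
  rw [hζ16, neg_one_mul, hf w t] at h16
  have h3 : |-f (w, t) - f (w, t)| = 2 * |f (w, t)| := by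
    rw [show -f (w, t) - f (w, t) = (-2) * f (w, t) by ring, abs_mul]; norm_num
  rw [h3] at h16
  push_cast at h16
  linarith

/-- The sign of `crossRe`, a section in each variable which transports values near the diagonal. -/
def crossSign (p q : Cover m) : ℝ := if 0 < crossRe p q then 1 else -1

lemma abs_crossSign (p q : Cover m) : |crossSign p q| = 1 := by
  unfold crossSign; split_ifs <;> simp

lemma crossRe_neg_right (p q : Cover m) : crossRe p (-q.1, q.2) = -crossRe p q := by
  simp [crossRe]; ring

/-- Global comparison of the values of a section with a Hölder bound. -/
lemma HolderBound.abs_sub_le {α A : ℝ} (hα : 0 < α) (hα1 : α ≤ 1) (hA : 0 ≤ A) {f : Cover m → ℝ}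
    (hf : IsSection f) (h : HolderBound α A f) {p : Cover m} (hp : p.1 ≠ 0) (q : Cover m) :
    |f q - crossSign p q * f p| ≤ 72 * A * baseDist p q ^ α := by
  have hr : 0 < ‖p.1‖ ^ 2 := by positivity
  have hD := baseDist_nonneg p q
  have hDα : 0 ≤ baseDist p q ^ α := Real.rpow_nonneg hD _
  have hADα : 0 ≤ A * baseDist p q ^ α := mul_nonneg hA hDα
  -- Within |z|/4 the pair is admissible once the lift of `q` with the right sign is chosen. Beyond
  -- it both values are bounded by their decay at the singular set: |z| ≤ 4D and |y| ≤ 5D, hence 72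
  -- = 8(4 + 5).
  by_cases hc : baseDist p q ≤ ‖p.1‖ ^ 2 / 4
  · have hr' := norm_sq_le_add q p
    rw [baseDist_comm] at hr'
    have hmin : baseDist p q ≤ 1 / 2 * min (‖p.1‖ ^ 2) (‖q.1‖ ^ 2) := by
      rcases min_cases (‖p.1‖ ^ 2) (‖q.1‖ ^ 2) with h | h <;> rw [h.1] <;> linarith
    -- If Re(w v̄) = 0, then z and y lie on opposite rays and |z - y| = |z| + |y|, too far apart.
    have hne : crossRe p q ≠ 0 := by
      intro h0
      have h1 := norm_sub_sq_add_crossRe p q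
      rw [h0] at h1
      have h2 := norm_fst_sub_le p q
      nlinarith [norm_nonneg (p.1 ^ 2 - q.1 ^ 2), sq_nonneg ‖q.1‖]
    rcases lt_or_gt_of_ne hne with hx | hx
    · rw [crossSign, if_neg (by linarith)]
      have h1 := h p (-q.1, q.2) (by simpa [baseDist, proj] using hmin)
        (by rw [crossRe_neg_right]; linarith)
      rw [hf, show baseDist p (-q.1, q.2) = baseDist p q by simp [baseDist, proj]] at h1
      rw [show f q - -1 * f p = f p - -f q by ring]
      linarith
    · rw [crossSign, if_pos hx, one_mul, abs_sub_comm]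
      linarith [h p q hmin hx]
  · push Not at hc
    have h1 := h.abs_le hα hA hf p
    have h2 := h.abs_le hα hA hf q
    have h3 : (‖p.1‖ ^ 2) ^ α ≤ 4 * baseDist p q ^ α := by
      calc (‖p.1‖ ^ 2) ^ α ≤ (4 * baseDist p q) ^ α := by gcongr; linarith
        _ = 4 ^ α * baseDist p q ^ α := Real.mul_rpow (by norm_num) hD
        _ ≤ 4 ^ (1 : ℝ) * baseDist p q ^ α := by gcongr; norm_num
        _ = _ := by norm_num
    have h4 : (‖q.1‖ ^ 2) ^ α ≤ 5 * baseDist p q ^ α := by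
      calc (‖q.1‖ ^ 2) ^ α ≤ (5 * baseDist p q) ^ α := by
            gcongr; linarith [norm_sq_le_add p q]
        _ = 5 ^ α * baseDist p q ^ α := Real.mul_rpow (by norm_num) hD
        _ ≤ 5 ^ (1 : ℝ) * baseDist p q ^ α := by gcongr; norm_num
        _ = _ := by norm_num
    have h5 := abs_sub (f q) (crossSign p q * f p)
    rw [abs_mul, abs_crossSign, one_mul] at h5
    nlinarith

lemma continuous_baseDist_left (q : Cover m) : Continuous fun p : Cover m => baseDist p q := by
  have h : Continuous (proj : Cover m → Base m) := by
    unfold proj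
    exact (WithLp.prod_continuous_toLp 2 _ _).comp (by fun_prop)
  exact h.dist continuous_const

lemma continuous_proj : Continuous (proj : Cover m → Base m) := by
  unfold proj
  exact (WithLp.prod_continuous_toLp 2 _ _).comp (by fun_prop)

lemma HolderBound.continuous {α A : ℝ} (hα : 0 < α) (hα1 : α ≤ 1) (hA : 0 ≤ A) {f : Cover m → ℝ}
    (hf : IsSection f) (h : HolderBound α A f) : Continuous f := by
  rw [continuous_iff_continuousAt]
  intro p
  rw [ContinuousAt, tendsto_iff_norm_sub_tendsto_zero]
  rcases eq_or_ne p.1 0 with hp | hp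
  · have hfp : f p = 0 := by
      have := hf.apply_zero p.2
      rwa [← hp] at this
    have hlim : Tendsto (fun q : Cover m => 8 * A * (‖q.1‖ ^ 2) ^ α) (𝓝 p) (𝓝 0) := by
      have : Continuous (fun q : Cover m => 8 * A * (‖q.1‖ ^ 2) ^ α) := by
        apply continuous_const.mul
        exact (by fun_prop : Continuous fun q : Cover m => ‖q.1‖ ^ 2).rpow_const
          (fun _ => Or.inr hα.le)
      have h0 := this.tendsto p
      simpa [hp, Real.zero_rpow hα.ne'] using h0
    refine squeeze_zero (fun _ => norm_nonneg _) (fun q => ?_) hlim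
    rw [hfp, sub_zero]
    exact h.abs_le hα hA hf q
  · have hlim : Tendsto (fun q : Cover m => 72 * A * baseDist q p ^ α) (𝓝 p) (𝓝 0) := by
      have : Continuous (fun q : Cover m => 72 * A * baseDist q p ^ α) :=
        continuous_const.mul ((continuous_baseDist_left p).rpow_const (fun _ => Or.inr hα.le))
      have h0 := this.tendsto p
      simpa [baseDist, Real.zero_rpow hα.ne'] using h0
    refine squeeze_zero' (Eventually.of_forall fun _ => norm_nonneg _) ?_ hlim
    have hpos : 0 < crossRe p p := by
      have : crossRe p p = ‖p.1‖ ^ 2 := by rw [norm_sq_fst, crossRe]; ring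
      rw [this]; positivity
    have hc : Continuous (fun q : Cover m => crossRe p q) := by
      unfold crossRe; fun_prop
    filter_upwards [hc.continuousAt.eventually (lt_mem_nhds hpos)] with q hq
    have := h.abs_sub_le hα hα1 hA hf hp q
    rw [crossSign, if_pos hq, one_mul, baseDist_comm] at this
    exact this

/-! ### The measure on the double cover -/

lemma volume_im_eq_zero : volume {z : ℂ | z.im = 0} = 0 := by
  have h := Measure.addHaar_submodule (volume : Measure ℂ) (LinearMap.ker Complex.imLm) (by
    intro h
    have : Complex.I ∈ LinearMap.ker Complex.imLm := h ▸ Submodule.mem_top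
    simp at this)
  convert h using 2
  ext; simp

/-- Squaring maps the open right half-plane injectively onto the plane minus a half-line, with
Jacobian 4|w|². The left half-plane contributes equally, so the weight 2|w|² over the whole plane
counts each z once. -/
lemma lintegral_comp_sq {f : ℂ → ENNReal} (hf : Measurable f) :
    ∫⁻ w : ℂ, ENNReal.ofReal (2 * ‖w‖ ^ 2) * f (w ^ 2) = ∫⁻ z, f z := by
  set S : Set ℂ := {w | 0 < w.re} with hS
  have hSm : MeasurableSet S := measurableSet_lt measurable_const Complex.measurable_re
  have hinj : InjOn (fun w : ℂ => w ^ 2) S := by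
    intro a ha b hb hab
    rcases sq_eq_sq_iff_eq_or_eq_neg.1 hab with h | h
    · exact h
    · simp only [hS, mem_ofPred_eq] at ha hb
      rw [h, Complex.neg_re] at ha; linarith
  have hd : ∀ w ∈ S, HasFDerivWithinAt (fun w : ℂ => w ^ 2)
      (((ContinuousLinearMap.toSpanSingleton ℂ (2 * w))).restrictScalars ℝ) S w := by
    intro w _
    have := (hasDerivAt_pow 2 w).hasFDerivAt.restrictScalars ℝ
    simpa using this.hasFDerivWithinAt
  have hdet : ∀ w : ℂ, (((ContinuousLinearMap.toSpanSingleton ℂ (2 * w))).restrictScalars ℝ).det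
      = 4 * ‖w‖ ^ 2 := by
    intro w
    simp [ContinuousLinearMap.det, LinearMap.det_restrictScalars, Algebra.norm_complex_apply,
      Complex.normSq_eq_norm_sq, mul_pow]
    norm_num
  have himage : ∫⁻ z in (fun w : ℂ => w ^ 2) '' S, f z = ∫⁻ z, f z := by
    refine Eq.trans (setLIntegral_congr ?_) (setLIntegral_univ f)
    refine eventuallyEq_univ.2 ?_
    rw [mem_ae_iff]
    refine measure_mono_null ?_ volume_im_eq_zero
    intro z hz
    by_contra him
    apply hz
    obtain ⟨w, hw⟩ := IsAlgClosed.exists_pow_nat_eq z (n := 2) (by norm_num)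
    have hre : w.re ≠ 0 := by
      intro h0
      apply him
      simp only [mem_ofPred_eq]
      rw [← hw, pow_two, Complex.mul_im, h0]; ring
    rcases lt_or_gt_of_ne hre with h | h
    · exact ⟨-w, by simpa [hS] using h, by simpa using hw⟩
    · exact ⟨w, h, hw⟩
  have h1 := lintegral_image_eq_lintegral_abs_det_fderiv_mul volume hSm hd hinj f
  rw [himage] at h1
  rw [h1]
  set F : ℂ → ENNReal := fun w => ENNReal.ofReal (2 * ‖w‖ ^ 2) * f (w ^ 2) with hF
  have hFm : Measurable F := by
    apply Measurable.mul
    · fun_prop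
    · exact hf.comp (by fun_prop)
  have hFneg : ∀ w, F (-w) = F w := by intro w; simp [hF]
  have hcompl : ∫⁻ w in Sᶜ, F w = ∫⁻ w in S, F w := by
    have h2 : (Sᶜ : Set ℂ) =ᵐ[volume] (Neg.neg ⁻¹' S : Set ℂ) := by
      have hnull : volume {z : ℂ | z.re = 0} = 0 := by
        have h := Measure.addHaar_submodule (volume : Measure ℂ) (LinearMap.ker Complex.reLm) (by
          intro h
          have : (1 : ℂ) ∈ LinearMap.ker Complex.reLm := h ▸ Submodule.mem_top
          simp at this)
        convert h using 2
        ext; simp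
      refine (ae_iff.2 (measure_mono_null ?_ hnull)).set_eq
      intro z hz
      simp only [hS, mem_compl_iff, mem_ofPred_eq, mem_preimage, Complex.neg_re] at hz ⊢
      by_contra h0
      apply hz
      constructor
      · intro h; rcases lt_or_gt_of_ne h0 with h' | h'
        · linarith
        · exact absurd h' h
      · intro h; linarith
    rw [setLIntegral_congr h2]
    have h3 := (Measure.measurePreserving_neg (volume : Measure ℂ)).setLIntegral_comp_preimage
      hSm hFm
    simpa [hFneg] using h3
  rw [← lintegral_add_compl F hSm, hcompl, ← two_mul, ← lintegral_const_mul' _ _ (by simp)]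
  refine lintegral_congr fun w => ?_
  rw [hdet, abs_of_nonneg (by positivity), hF, ← mul_assoc]
  congr 1
  rw [show (2 : ENNReal) = ENNReal.ofReal 2 by simp, ← ENNReal.ofReal_mul (by norm_num)]
  ring_nf

instance : SFinite (coverMeasure m) := by unfold coverMeasure; infer_instance

lemma measurable_density : Measurable fun p : Cover m => ENNReal.ofReal (2 * ‖p.1‖ ^ 2) := by
  fun_prop

lemma lintegral_coverMeasure {f : Cover m → ENNReal} (hf : Measurable f) :
    ∫⁻ p, f p ∂(coverMeasure m) = ∫⁻ p, ENNReal.ofReal (2 * ‖p.1‖ ^ 2) * f p := by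
  rw [coverMeasure, lintegral_withDensity_eq_lintegral_mul _ measurable_density hf]
  rfl

lemma integral_coverMeasure (f : Cover m → ℝ) :
    ∫ p, f p ∂(coverMeasure m) = ∫ p, 2 * ‖p.1‖ ^ 2 * f p := by
  rw [coverMeasure, integral_withDensity_eq_integral_toReal_smul measurable_density
    (Eventually.of_forall fun _ => ENNReal.ofReal_lt_top)]
  congr 1; ext p
  rw [ENNReal.toReal_ofReal (by positivity), smul_eq_mul]

/-- The image of `coverMeasure` under the covering map is Lebesgue measure. This transfers Gaussian
integrals to the base, where translation invariance is available. -/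
lemma lintegral_coverMeasure_comp {F : ℂ × EuclideanSpace ℝ (Fin m) → ENNReal}
    (hF : Measurable F) :
    ∫⁻ p, F (p.1 ^ 2, p.2) ∂(coverMeasure m) = ∫⁻ y, F y := by
  have hsq : Measurable fun p : Cover m => (p.1 ^ 2, p.2) := by fun_prop
  rw [lintegral_coverMeasure (f := fun p => F (p.1 ^ 2, p.2)) (hF.comp hsq),
    Measure.volume_eq_prod,
    lintegral_prod_symm _ (by
      exact (measurable_density.mul (hF.comp hsq)).aemeasurable),
    lintegral_prod_symm _ hF.aemeasurable]
  refine lintegral_congr fun t => ?_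
  exact lintegral_comp_sq (f := fun z => F (z, t)) (by fun_prop)

lemma coverMeasure_absolutelyContinuous : coverMeasure m ≪ volume :=
  withDensity_absolutelyContinuous _ _

lemma volume_fst_eq_zero : volume {p : Cover m | p.1 = 0} = 0 := by
  have : {p : Cover m | p.1 = 0} = {(0 : ℂ)} ×ˢ univ := by ext; simp
  rw [this, Measure.volume_eq_prod, Measure.prod_prod]
  simp

lemma ae_fst_ne_zero : ∀ᵐ p ∂(coverMeasure m), p.1 ≠ 0 := by
  have h : ∀ᵐ p : Cover m, p.1 ≠ 0 := by
    rw [ae_iff]; simpa using volume_fst_eq_zero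
  exact coverMeasure_absolutelyContinuous.ae_le h

/-! ### Gaussian integrals -/

/-- The total mass of `exp (-c |x - y|²)` on the base. -/
def gaussMass (m : ℕ) (c : ℝ) : ℝ :=
  ∫ y : ℂ × EuclideanSpace ℝ (Fin m), Real.exp (-c * (‖y.1‖ ^ 2 + ‖y.2‖ ^ 2))

lemma integrable_exp_neg_norm_sq {V : Type*} [NormedAddCommGroup V] [InnerProductSpace ℝ V]
    [FiniteDimensional ℝ V] [MeasurableSpace V] [BorelSpace V] {c : ℝ} (hc : 0 < c) :
    Integrable fun v : V => Real.exp (-c * ‖v‖ ^ 2) := by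
  have h := GaussianFourier.integrable_cexp_neg_mul_sq_norm_add (V := V) (b := (c : ℂ))
    (by simpa using hc) 0 0
  refine h.norm.congr (Eventually.of_forall fun v => ?_)
  simp only [Complex.norm_exp]
  congr 1
  simp [← Complex.ofReal_pow]

lemma integrable_exp_neg_prod {c : ℝ} (hc : 0 < c) :
    Integrable fun y : ℂ × EuclideanSpace ℝ (Fin m) =>
      Real.exp (-c * (‖y.1‖ ^ 2 + ‖y.2‖ ^ 2)) := by
  have h := (integrable_exp_neg_norm_sq (V := ℂ) hc).mul_prod
    (integrable_exp_neg_norm_sq (V := EuclideanSpace ℝ (Fin m)) hc)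
  rw [Measure.volume_eq_prod]
  refine h.congr (Eventually.of_forall fun y => ?_)
  simp only [← Real.exp_add]
  congr 1; ring

lemma gaussMass_pos {c : ℝ} (hc : 0 < c) : 0 < gaussMass m c :=
  integral_exp_pos (integrable_exp_neg_prod hc)

lemma measurable_baseDist (p : Cover m) : Measurable fun q : Cover m => baseDist p q := by
  simp_rw [baseDist_comm p]
  exact (continuous_baseDist_left p).measurable

lemma lintegral_exp_neg_baseDist {c : ℝ} (hc : 0 < c) (p : Cover m) :
    ∫⁻ q, ENNReal.ofReal (Real.exp (-c * baseDist p q ^ 2)) ∂(coverMeasure m) =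
      ENNReal.ofReal (gaussMass m c) := by
  rw [gaussMass, ofReal_integral_eq_lintegral_ofReal (integrable_exp_neg_prod hc)
    (Eventually.of_forall fun _ => (Real.exp_pos _).le)]
  set G : ℂ × EuclideanSpace ℝ (Fin m) → ENNReal := fun y =>
    ENNReal.ofReal (Real.exp (-c * (‖y.1‖ ^ 2 + ‖y.2‖ ^ 2))) with hG
  have hGm : Measurable G := by fun_prop
  have h1 := lintegral_coverMeasure_comp (m := m)
    (F := fun y => G (y - (p.1 ^ 2, p.2))) (hGm.comp (by fun_prop))
  have h2 : ∫⁻ y : ℂ × EuclideanSpace ℝ (Fin m), G (y - (p.1 ^ 2, p.2)) = ∫⁻ y, G y := by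
    rw [Measure.volume_eq_prod]
    exact lintegral_sub_right_eq_self G _
  rw [h2] at h1
  rw [← h1]
  refine lintegral_congr fun q => ?_
  simp [hG, baseDist_sq, norm_sub_rev]

lemma integrable_exp_neg_baseDist {c : ℝ} (hc : 0 < c) (p : Cover m) :
    Integrable (fun q => Real.exp (-c * baseDist p q ^ 2)) (coverMeasure m) := by
  refine ⟨Measurable.aestronglyMeasurable ?_, ?_⟩
  · have := measurable_baseDist p; fun_prop
  · rw [hasFiniteIntegral_iff_ofReal (Eventually.of_forall fun _ => (Real.exp_pos _).le),
      lintegral_exp_neg_baseDist hc]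
    exact ENNReal.ofReal_lt_top

lemma integral_exp_neg_baseDist {c : ℝ} (hc : 0 < c) (p : Cover m) :
    ∫ q, Real.exp (-c * baseDist p q ^ 2) ∂(coverMeasure m) = gaussMass m c := by
  rw [integral_eq_lintegral_of_nonneg_ae (Eventually.of_forall fun _ => (Real.exp_pos _).le)
    (integrable_exp_neg_baseDist hc p).1, lintegral_exp_neg_baseDist hc,
    ENNReal.toReal_ofReal (gaussMass_pos hc).le]

/-- Polynomials are absorbed by Gaussians. -/
lemma exists_pow_mul_exp_le (N : ℕ) {c : ℝ} (hc : 0 < c) :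
    ∃ C, 0 < C ∧ ∀ x : ℝ, 0 ≤ x → (1 + x) ^ N * Real.exp (-c * x ^ 2) ≤ C := by
  obtain ⟨n, hn⟩ := exists_nat_ge (N / c)
  have hN : (N : ℝ) ≤ c * n := by rwa [div_le_iff₀' hc] at hn
  -- Since 1 + x ≤ e^x and N ≤ cn, the exponent is at most cnx - cx² ≤ cn².
  refine ⟨Real.exp (c * n ^ 2 + N), Real.exp_pos _, fun x hx => ?_⟩
  have h1 : (1 + x) ^ N ≤ Real.exp (N * x) := by
    rw [Real.exp_nat_mul]
    gcongr
    linarith [Real.add_one_le_exp x]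
  calc (1 + x) ^ N * Real.exp (-c * x ^ 2) ≤ Real.exp (N * x) * Real.exp (-c * x ^ 2) := by gcongr
    _ = Real.exp (N * x - c * x ^ 2) := by rw [← Real.exp_add]; ring_nf
    _ ≤ _ := by
      apply Real.exp_le_exp.2
      have : (N : ℝ) * x ≤ c * n * x := by gcongr
      nlinarith [sq_nonneg (x - n), mul_nonneg hc.le (sq_nonneg (x - n)),
        mul_nonneg hc.le (sq_nonneg (x:ℝ)), mul_nonneg hc.le (sq_nonneg (n:ℝ))]

/-! ### Dilations -/

/-- The parabolic dilation `(w, t) ↦ (a w, a² t)`, covering multiplication by `a²` on the base. -/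
def dil (a : ℝ) (p : Cover m) : Cover m := (a • p.1, a ^ 2 • p.2)

lemma baseDist_dil (a : ℝ) (p q : Cover m) :
    baseDist (dil a p) (dil a q) = a ^ 2 * baseDist p q := by
  apply (sq_eq_sq₀ (baseDist_nonneg _ _) (mul_nonneg (sq_nonneg a) (baseDist_nonneg _ _))).1
  rw [mul_pow, baseDist_sq, baseDist_sq]
  have h1 : (dil a p).1 ^ 2 - (dil a q).1 ^ 2 = (a ^ 2 : ℝ) • (p.1 ^ 2 - q.1 ^ 2) := by
    simp only [dil, Complex.real_smul]; push_cast; ring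
  have h2 : (dil a p).2 - (dil a q).2 = (a ^ 2 : ℝ) • (p.2 - q.2) := by
    simp only [dil, smul_sub]
  rw [h1, h2, norm_smul, norm_smul, Real.norm_of_nonneg (sq_nonneg a)]; ring

lemma dil_dil_inv {a : ℝ} (ha : a ≠ 0) (p : Cover m) : dil a (dil a⁻¹ p) = p := by
  simp only [dil, smul_smul, ← mul_pow, mul_inv_cancel₀ ha, one_pow, one_smul]

lemma dil_inv_dil {a : ℝ} (ha : a ≠ 0) (p : Cover m) : dil a⁻¹ (dil a p) = p := by
  simp only [dil, smul_smul, ← mul_pow, inv_mul_cancel₀ ha, one_pow, one_smul]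

lemma continuous_dil (a : ℝ) : Continuous (dil a : Cover m → Cover m) := by
  unfold dil; fun_prop

lemma norm_dil_fst {a : ℝ} (ha : 0 ≤ a) (p : Cover m) : ‖(dil a p).1‖ = a * ‖p.1‖ := by
  simp [dil, abs_of_nonneg ha]

lemma crossRe_dil (a : ℝ) (p q : Cover m) :
    crossRe (dil a p) (dil a q) = a ^ 2 * crossRe p q := by
  simp [crossRe, dil]; ring

/-- `dil a` as a homeomorphism. -/
def dilHomeo {a : ℝ} (ha : a ≠ 0) : Cover m ≃ₜ Cover m where
  toFun := dil a
  invFun := dil a⁻¹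
  left_inv := dil_inv_dil ha
  right_inv := dil_dil_inv ha
  continuous_toFun := continuous_dil a
  continuous_invFun := continuous_dil a⁻¹

lemma map_dil_volume {a : ℝ} (ha : 0 < a) :
    Measure.map (dil a : Cover m → Cover m) volume =
      ENNReal.ofReal ((a ^ (2 + 2 * m))⁻¹) • volume := by
  have h1 : (dil a : Cover m → Cover m) = Prod.map (a • ·) (a ^ 2 • ·) := rfl
  rw [h1, Measure.volume_eq_prod, ← Measure.map_prod_map _ _ (by fun_prop) (by fun_prop),
    Measure.map_addHaar_smul _ ha.ne', Measure.map_addHaar_smul _ (by positivity),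
    Measure.prod_smul_left, Measure.prod_smul_right, smul_smul]
  congr 1
  rw [← ENNReal.ofReal_mul (abs_nonneg _)]
  congr 1
  rw [abs_of_pos (by positivity), abs_of_pos (by positivity)]
  simp [Complex.finrank_real_complex]
  rw [← mul_inv, ← pow_mul, ← pow_add]

/-- Lebesgue measure on the cover contributes a^(2+2m) and the density |w|² another a². The total is
(a²)^n with n = m + 2, as for multiplication by a² on the base. -/
lemma integral_comp_dil {a : ℝ} (ha : 0 < a) (f : Cover m → ℝ) :
    ∫ p, f (dil a p) ∂(coverMeasure m) = (a ^ (4 + 2 * m))⁻¹ * ∫ p, f p ∂(coverMeasure m) := by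
  rw [integral_coverMeasure, integral_coverMeasure]
  have h1 : ∀ p : Cover m, 2 * ‖p.1‖ ^ 2 * f (dil a p) =
      (a ^ 2)⁻¹ * (fun q : Cover m => 2 * ‖q.1‖ ^ 2 * f q) (dil a p) := by
    intro p
    simp only [norm_dil_fst ha.le]
    field_simp
  simp_rw [h1]
  rw [integral_const_mul]
  have h2 : ∫ p : Cover m, (fun q : Cover m => 2 * ‖q.1‖ ^ 2 * f q) (dil a p) =
      ∫ q, (fun q : Cover m => 2 * ‖q.1‖ ^ 2 * f q) q ∂(Measure.map (dil a) volume) :=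
    ((dilHomeo (m := m) ha.ne').measurableEmbedding.integral_map (μ := volume)
      (fun q : Cover m => 2 * ‖q.1‖ ^ 2 * f q)).symm
  rw [h2, map_dil_volume ha, integral_smul_measure, ENNReal.toReal_ofReal (by positivity),
    smul_eq_mul, ← mul_assoc]
  congr 1
  rw [← mul_inv, ← pow_add]; congr 2; ring

/-- The admissibility of a pair is invariant under dilation; only the distance scales, by a². -/
lemma HolderBound.comp_dil {α A a : ℝ} (ha : 0 < a) {f : Cover m → ℝ}
    (h : HolderBound α A f) : HolderBound α (A * (a ^ 2) ^ α) (fun p => f (dil a p)) := by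
  intro p q hpq hx
  have h1 := h (dil a p) (dil a q) ?_ ?_
  · rw [baseDist_dil, Real.mul_rpow (by positivity) (baseDist_nonneg _ _)] at h1
    rwa [mul_assoc]
  · rw [baseDist_dil, norm_dil_fst ha.le, norm_dil_fst ha.le, mul_pow, mul_pow,
      ← mul_min_of_nonneg _ _ (by positivity)]
    nlinarith [sq_nonneg a]
  · rw [crossRe_dil]; positivity

lemma IsSection.comp_dil {a : ℝ} {f : Cover m → ℝ} (h : IsSection f) :
    IsSection fun p => f (dil a p) := by
  intro w t
  simpa [dil] using h (a • w) (a ^ 2 • t)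

/-! ### The error function -/

/-- The error function. -/
def erf (x : ℝ) : ℝ := 2 / √Real.pi * ∫ y in (0 : ℝ)..x, Real.exp (-y ^ 2)

lemma hasDerivAt_erf (x : ℝ) : HasDerivAt erf (2 / √Real.pi * Real.exp (-x ^ 2)) x := by
  have hc : Continuous fun y : ℝ => Real.exp (-y ^ 2) := by fun_prop
  exact (intervalIntegral.integral_hasDerivAt_right (hc.intervalIntegrable _ _)
    (hc.stronglyMeasurableAtFilter _ _) hc.continuousAt).const_mul _

lemma erf_neg (x : ℝ) : erf (-x) = -erf x := by
  unfold erf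
  have h := intervalIntegral.integral_comp_neg (a := 0) (b := x) (fun y : ℝ => Real.exp (-y ^ 2))
  simp only [neg_sq, neg_zero] at h
  rw [h, intervalIntegral.integral_symm]; ring

lemma contDiff_erf : ContDiff ℝ ((⊤ : ℕ∞) : WithTop ℕ∞) erf := by
  rw [contDiff_infty_iff_deriv]
  refine ⟨fun x => (hasDerivAt_erf x).differentiableAt, ?_⟩
  have : deriv erf = fun x => 2 / √Real.pi * Real.exp (-x ^ 2) :=
    funext fun x => (hasDerivAt_erf x).deriv
  rw [this]; fun_prop

lemma one_le_sqrt_pi : 1 ≤ √Real.pi := by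
  rw [Real.one_le_sqrt]; linarith [Real.pi_gt_three]

lemma abs_erf_le (x : ℝ) : |erf x| ≤ 2 * |x| := by
  have h : ‖∫ y in (0 : ℝ)..x, Real.exp (-y ^ 2)‖ ≤ 1 * |x - 0| := by
    apply intervalIntegral.norm_integral_le_of_norm_le_const
    intro y _
    rw [Real.norm_eq_abs, Real.abs_exp, Real.exp_le_one_iff]
    nlinarith [sq_nonneg y]
  rw [Real.norm_eq_abs, sub_zero, one_mul] at h
  rw [erf, abs_mul, abs_of_pos (by positivity)]
  have : 2 / √Real.pi ≤ 2 := div_le_self (by norm_num) one_le_sqrt_pi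
  gcongr

lemma tendsto_erf_atTop : Tendsto erf atTop (𝓝 1) := by
  have h_int : IntegrableOn (fun y : ℝ => Real.exp (-y ^ 2)) (Ioi 0) := by
    simpa using (integrable_exp_neg_mul_sq (b := 1) (by norm_num)).integrableOn
  have h1 : ∫ y in Ioi (0 : ℝ), Real.exp (-y ^ 2) = √Real.pi / 2 := by
    simpa using integral_gaussian_Ioi 1
  have h2 := (intervalIntegral_tendsto_integral_Ioi 0 h_int tendsto_id).const_mul (2 / √Real.pi)
  rw [h1] at h2
  have h3 : 2 / √Real.pi * (√Real.pi / 2) = 1 := by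
    have : √Real.pi ≠ 0 := by positivity
    field_simp
  rw [h3] at h2
  exact h2

lemma erf_mono : Monotone erf :=
  monotone_of_hasDerivAt_nonneg (fun x => hasDerivAt_erf x) (fun x => by positivity)

lemma erf_le_one (x : ℝ) : erf x ≤ 1 := erf_mono.ge_of_tendsto tendsto_erf_atTop x

lemma abs_erf_le_one (x : ℝ) : |erf x| ≤ 1 := by
  rw [abs_le]
  exact ⟨by have := erf_le_one (-x); rw [erf_neg] at this; linarith, erf_le_one x⟩

/-- Shift the integral by x and use (y + x)² ≥ y² + x² for nonnegative x and y, then let the upper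
limit tend to infinity. -/
lemma one_sub_erf_le {x : ℝ} (hx : 0 ≤ x) : 1 - erf x ≤ Real.exp (-x ^ 2) := by
  have key : ∀ b : ℝ, 0 ≤ b → erf (b + x) - erf x ≤ Real.exp (-x ^ 2) * erf b := by
    intro b hb
    have hc : Continuous fun y : ℝ => Real.exp (-y ^ 2) := by fun_prop
    have h1 : erf (b + x) - erf x = 2 / √Real.pi * ∫ y in (0 : ℝ)..b, Real.exp (-(y + x) ^ 2) := by
      rw [intervalIntegral.integral_comp_add_right (fun y => Real.exp (-y ^ 2)), zero_add, erf, erf,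
        ← mul_sub, intervalIntegral.integral_interval_sub_left (hc.intervalIntegrable _ _)
          (hc.intervalIntegrable _ _)]
    rw [h1, erf, mul_left_comm, ← intervalIntegral.integral_const_mul (Real.exp (-x ^ 2))]
    refine mul_le_mul_of_nonneg_left ?_ (by positivity)
    apply intervalIntegral.integral_mono_on hb
    · exact Continuous.intervalIntegrable (by fun_prop) _ _
    · exact Continuous.intervalIntegrable (by fun_prop) _ _
    · intro y hy
      rw [← Real.exp_add]
      apply Real.exp_le_exp.2
      nlinarith [mul_nonneg hy.1 hx]
  have h1 : Tendsto (fun b => erf (b + x) - erf x) atTop (𝓝 (1 - erf x)) :=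
    (tendsto_erf_atTop.comp (tendsto_atTop_add_const_right _ x tendsto_id)).sub_const _
  have h2 := tendsto_erf_atTop.const_mul (Real.exp (-x ^ 2))
  rw [mul_one] at h2
  exact le_of_tendsto_of_tendsto h1 h2 ((eventually_ge_atTop 0).mono key)

/-! ### Derivatives along the tangential fields -/

/-- The lift to the double cover of the tangential vector fields. -/
def fld (a : Fin 2 ⊕ Fin m) (p : Cover m) : Cover m := lift p (tangential a (proj p))

lemma fld_inl_zero (p : Cover m) : fld (Sum.inl 0) p = (p.1 / 2, 0) := by
  simp only [fld, lift, tangential, proj]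
  -- At w = 0 division by zero returns 0, which is also the value of the smooth extension of the
  -- field. The formula therefore holds everywhere.
  rcases eq_or_ne p.1 0 with h | h
  · simp [h]
  · congr 1
    change p.1 ^ 2 / (2 * p.1) = p.1 / 2
    field_simp

lemma fld_inl_one (p : Cover m) : fld (Sum.inl 1) p = (Complex.I * p.1 / 2, 0) := by
  simp only [fld, lift, tangential, proj]
  rcases eq_or_ne p.1 0 with h | h
  · simp [h]
  · congr 1
    change Complex.I * p.1 ^ 2 / (2 * p.1) = Complex.I * p.1 / 2
    field_simp

lemma fld_inr (i : Fin m) (p : Cover m) :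
    fld (Sum.inr i) p = (0, EuclideanSpace.single i 1) := by
  simp [fld, lift, tangential]

lemma monomial_cons (a : Fin 2 ⊕ Fin m) (l : List (Fin 2 ⊕ Fin m)) (s : Cover m → ℝ) :
    monomial (a :: l) s = fun p => fderiv ℝ (monomial l s) p (fld a p) := rfl

/-- `f` is differentiable, with the given derivative along `fld a`. -/
def Der (a : Fin 2 ⊕ Fin m) (f f' : Cover m → ℝ) : Prop :=
  ∀ p, ∃ L : Cover m →L[ℝ] ℝ, HasFDerivAt f L p ∧ L (fld a p) = f' p

section Der

variable {a : Fin 2 ⊕ Fin m} {f f' g g' : Cover m → ℝ}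

lemma Der.const (c : ℝ) : Der a (fun _ : Cover m => c) (fun _ => 0) :=
  fun p => ⟨0, hasFDerivAt_const c p, rfl⟩

lemma Der.add (hf : Der a f f') (hg : Der a g g') :
    Der a (fun p => f p + g p) (fun p => f' p + g' p) := by
  intro p
  obtain ⟨L, hL, h1⟩ := hf p
  obtain ⟨M, hM, h2⟩ := hg p
  exact ⟨L + M, hL.add hM, by simp [h1, h2]⟩

lemma Der.mul (hf : Der a f f') (hg : Der a g g') :
    Der a (fun p => f p * g p) (fun p => f' p * g p + f p * g' p) := by
  intro p
  obtain ⟨L, hL, h1⟩ := hf p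
  obtain ⟨M, hM, h2⟩ := hg p
  exact ⟨_, hL.mul hM, by simp [h1, h2]; ring⟩

lemma Der.comp {φ : ℝ → ℝ} {φ' : ℝ → ℝ} (hφ : ∀ x, HasDerivAt φ (φ' x) x) (hf : Der a f f') :
    Der a (fun p => φ (f p)) (fun p => φ' (f p) * f' p) := by
  intro p
  obtain ⟨L, hL, h1⟩ := hf p
  exact ⟨_, (hφ (f p)).comp_hasFDerivAt p hL, by simp [h1]⟩

lemma Der.congr (hf : Der a f f') (h : ∀ p, f' p = g' p) : Der a f g' := by
  intro p
  obtain ⟨L, hL, h1⟩ := hf p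
  exact ⟨L, hL, h1.trans (h p)⟩

lemma Der.along (hf : Der a f f') : (fun p => fderiv ℝ f p (fld a p)) = f' := by
  funext p
  obtain ⟨L, hL, h1⟩ := hf p
  rw [hL.fderiv, h1]

lemma Der.sum {ι : Type*} (s : Finset ι) {f f' : ι → Cover m → ℝ}
    (h : ∀ i ∈ s, Der a (f i) (f' i)) :
    Der a (fun p => ∑ i ∈ s, f i p) (fun p => ∑ i ∈ s, f' i p) := by
  classical
  induction s using Finset.induction_on with
  | empty => simpa using Der.const 0
  | insert i s hi ih =>
    simp only [Finset.sum_insert hi]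
    exact (h i (Finset.mem_insert_self _ _)).add
      (ih fun j hj => h j (Finset.mem_insert_of_mem hj))

end Der

/-- Derivative of `Re w` along `fld a`. -/
def dRe : Fin 2 ⊕ Fin m → Cover m → ℝ
  | Sum.inl 0 => fun p => p.1.re / 2
  | Sum.inl 1 => fun p => -p.1.im / 2
  | Sum.inr _ => fun _ => 0

/-- Derivative of `Im w` along `fld a`. -/
def dIm : Fin 2 ⊕ Fin m → Cover m → ℝ
  | Sum.inl 0 => fun p => p.1.im / 2
  | Sum.inl 1 => fun p => p.1.re / 2
  | Sum.inr _ => fun _ => 0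

/-- Derivative of `t_i` along `fld a`. -/
def dT (i : Fin m) : Fin 2 ⊕ Fin m → ℝ
  | Sum.inl _ => 0
  | Sum.inr j => if i = j then 1 else 0

lemma der_re (a : Fin 2 ⊕ Fin m) : Der a (fun p => p.1.re) (dRe a) := by
  intro p
  have h := (Complex.reCLM.comp
    (ContinuousLinearMap.fst ℝ ℂ (EuclideanSpace ℝ (Fin m)))).hasFDerivAt (x := p)
  refine ⟨_, h, ?_⟩
  match a with
  | Sum.inl 0 => simp [fld_inl_zero, dRe]
  | Sum.inl 1 => simp [fld_inl_one, dRe]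
  | Sum.inr i => simp [fld_inr, dRe]

lemma der_im (a : Fin 2 ⊕ Fin m) : Der a (fun p => p.1.im) (dIm a) := by
  intro p
  have h := (Complex.imCLM.comp
    (ContinuousLinearMap.fst ℝ ℂ (EuclideanSpace ℝ (Fin m)))).hasFDerivAt (x := p)
  refine ⟨_, h, ?_⟩
  match a with
  | Sum.inl 0 => simp [fld_inl_zero, dIm]
  | Sum.inl 1 => simp [fld_inl_one, dIm]
  | Sum.inr i => simp [fld_inr, dIm]

lemma der_t (i : Fin m) (a : Fin 2 ⊕ Fin m) : Der a (fun p => p.2 i) (fun _ => dT i a) := by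
  intro p
  have h := ((EuclideanSpace.proj (𝕜 := ℝ) i).comp
    (ContinuousLinearMap.snd ℝ ℂ (EuclideanSpace ℝ (Fin m)))).hasFDerivAt (x := p)
  refine ⟨_, h, ?_⟩
  match a with
  | Sum.inl 0 => simp [fld_inl_zero, dT]
  | Sum.inl 1 => simp [fld_inl_one, dT]
  | Sum.inr j => simp [fld_inr, dT]

/-- The weight of a tangential field: `1` for `r ∂/∂r`, `∂/∂θ`, and `0` for `∂/∂tᵢ`. -/
def wt : Fin 2 ⊕ Fin m → ℕ
  | Sum.inl _ => 1
  | Sum.inr _ => 0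

/-! ### Polynomial coefficients -/

/-- Polynomials in the coordinates of a pair of points, graded by their growth in `|z|` at bounded
distance of the two points. -/
inductive IsPoly : ℕ → (Cover m → Cover m → ℝ) → Prop
  | const (c : ℝ) : IsPoly 0 fun _ _ => c
  | reZ : IsPoly 1 fun p _ => p.1.re ^ 2 - p.1.im ^ 2
  | imZ : IsPoly 1 fun p _ => 2 * p.1.re * p.1.im
  -- Differences of coordinates have degree 0: they are bounded by the distance, which a Gaussian
  -- absorbs, and cost no power of |z|.
  | reSub : IsPoly 0 fun p q => (p.1.re ^ 2 - p.1.im ^ 2) - (q.1.re ^ 2 - q.1.im ^ 2)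
  | imSub : IsPoly 0 fun p q => 2 * p.1.re * p.1.im - 2 * q.1.re * q.1.im
  | tSub (i : Fin m) : IsPoly 0 fun p q => p.2 i - q.2 i
  | rLeft : IsPoly 1 fun p _ => p.1.re ^ 2 + p.1.im ^ 2
  | rRight : IsPoly 1 fun _ q => q.1.re ^ 2 + q.1.im ^ 2
  | add {j F G} : IsPoly j F → IsPoly j G → IsPoly j fun p q => F p q + G p q
  | mul {i j F G} : IsPoly i F → IsPoly j G → IsPoly (i + j) fun p q => F p q * G p q
  | weaken {i j F} : IsPoly i F → i ≤ j → IsPoly j F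

namespace IsPoly

lemma const' (j : ℕ) (c : ℝ) : IsPoly (m := m) j fun _ _ => c := (const c).weaken (Nat.zero_le _)

lemma const_mul {j : ℕ} {F : Cover m → Cover m → ℝ} (h : IsPoly j F) (c : ℝ) :
    IsPoly j fun p q => c * F p q := by
  simpa using (const c).mul h

lemma sum {j : ℕ} {ι : Type*} (s : Finset ι) {F : ι → Cover m → Cover m → ℝ}
    (h : ∀ i ∈ s, IsPoly j (F i)) : IsPoly j fun p q => ∑ i ∈ s, F i p q := by
  classical
  induction s using Finset.induction_on with
  | empty => simpa using const' j 0
  | insert i s hi ih =>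
    simp only [Finset.sum_insert hi]
    exact (h i (Finset.mem_insert_self _ _)).add
      (ih fun k hk => h k (Finset.mem_insert_of_mem hk))

lemma contDiff {j : ℕ} {F : Cover m → Cover m → ℝ} (h : IsPoly j F) :
    ContDiff ℝ ((⊤ : ℕ∞) : WithTop ℕ∞) (fun x : Cover m × Cover m => F x.1 x.2) := by
  have hre : ContDiff ℝ ((⊤ : ℕ∞) : WithTop ℕ∞) fun z : ℂ => z.re := Complex.reCLM.contDiff
  have him : ContDiff ℝ ((⊤ : ℕ∞) : WithTop ℕ∞) fun z : ℂ => z.im := Complex.imCLM.contDiff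
  have h1 : ContDiff ℝ ((⊤ : ℕ∞) : WithTop ℕ∞) fun x : Cover m × Cover m => x.1.1.re :=
    hre.comp (by fun_prop)
  have h2 : ContDiff ℝ ((⊤ : ℕ∞) : WithTop ℕ∞) fun x : Cover m × Cover m => x.1.1.im :=
    him.comp (by fun_prop)
  have h3 : ContDiff ℝ ((⊤ : ℕ∞) : WithTop ℕ∞) fun x : Cover m × Cover m => x.2.1.re :=
    hre.comp (by fun_prop)
  have h4 : ContDiff ℝ ((⊤ : ℕ∞) : WithTop ℕ∞) fun x : Cover m × Cover m => x.2.1.im :=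
    him.comp (by fun_prop)
  induction h with
  | const c => exact contDiff_const
  | reZ => exact (h1.pow 2).sub (h2.pow 2)
  | imZ => exact (contDiff_const.mul h1).mul h2
  | reSub => exact ((h1.pow 2).sub (h2.pow 2)).sub ((h3.pow 2).sub (h4.pow 2))
  | imSub => exact ((contDiff_const.mul h1).mul h2).sub ((contDiff_const.mul h3).mul h4)
  | tSub i =>
    have h5 : ContDiff ℝ ((⊤ : ℕ∞) : WithTop ℕ∞) fun t : EuclideanSpace ℝ (Fin m) => t i :=
      (EuclideanSpace.proj (𝕜 := ℝ) i).contDiff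
    exact (h5.comp (contDiff_snd.comp contDiff_fst)).sub (h5.comp (contDiff_snd.comp contDiff_snd))
  | rLeft => exact (h1.pow 2).add (h2.pow 2)
  | rRight => exact (h3.pow 2).add (h4.pow 2)
  | add _ _ ih1 ih2 => exact ih1.add ih2
  | mul _ _ ih1 ih2 => exact ih1.mul ih2
  | weaken _ _ ih => exact ih

lemma exists_bound {j : ℕ} {F : Cover m → Cover m → ℝ} (h : IsPoly j F) :
    ∃ (C : ℝ) (N : ℕ), 0 ≤ C ∧ ∀ p q,
      |F p q| ≤ C * (1 + ‖p.1‖ ^ 2) ^ j * (1 + baseDist p q) ^ N := by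
  induction h with
  | const c => exact ⟨|c|, 0, abs_nonneg _, fun p q => by simp⟩
  | reZ =>
    refine ⟨1, 0, zero_le_one, fun p q => ?_⟩
    rw [norm_sq_fst, abs_le]
    constructor <;> nlinarith [sq_nonneg p.1.re, sq_nonneg p.1.im]
  | imZ =>
    refine ⟨1, 0, zero_le_one, fun p q => ?_⟩
    rw [norm_sq_fst, abs_le]
    constructor <;> nlinarith [sq_nonneg (p.1.re + p.1.im), sq_nonneg (p.1.re - p.1.im)]
  | reSub =>
    refine ⟨1, 1, zero_le_one, fun p q => ?_⟩
    have h1 := (Complex.abs_re_le_norm (p.1 ^ 2 - q.1 ^ 2)).trans (norm_fst_sub_le p q)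
    have h2 : (p.1 ^ 2 - q.1 ^ 2).re =
        (p.1.re ^ 2 - p.1.im ^ 2) - (q.1.re ^ 2 - q.1.im ^ 2) := by
      simp [pow_two]
    rw [h2] at h1
    linarith
  | imSub =>
    refine ⟨1, 1, zero_le_one, fun p q => ?_⟩
    have h1 := (Complex.abs_im_le_norm (p.1 ^ 2 - q.1 ^ 2)).trans (norm_fst_sub_le p q)
    have h2 : (p.1 ^ 2 - q.1 ^ 2).im = 2 * p.1.re * p.1.im - 2 * q.1.re * q.1.im := by
      simp [pow_two]; ring
    rw [h2] at h1
    linarith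
  | tSub i =>
    refine ⟨1, 1, zero_le_one, fun p q => ?_⟩
    have h1 := (PiLp.norm_apply_le (p.2 - q.2) i).trans (norm_snd_sub_le p q)
    simp only [PiLp.sub_apply, Real.norm_eq_abs] at h1
    linarith
  | rLeft =>
    refine ⟨1, 0, zero_le_one, fun p q => ?_⟩
    rw [norm_sq_fst, abs_of_nonneg (by positivity)]; linarith
  | rRight =>
    refine ⟨1, 1, zero_le_one, fun p q => ?_⟩
    have h1 := norm_sq_le_add p q
    change |q.1.re ^ 2 + q.1.im ^ 2| ≤ _
    rw [← norm_sq_fst, abs_of_nonneg (by positivity)]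
    nlinarith [baseDist_nonneg p q, sq_nonneg ‖p.1‖,
      mul_nonneg (sq_nonneg ‖p.1‖) (baseDist_nonneg p q)]
  | @add j F G _ _ ih1 ih2 =>
    obtain ⟨C, N, hC, h1⟩ := ih1
    obtain ⟨C', N', hC', h2⟩ := ih2
    refine ⟨C + C', N + N', by positivity, fun p q => ?_⟩
    have hD := baseDist_nonneg p q
    have e1 : (1 + baseDist p q) ^ N ≤ (1 + baseDist p q) ^ (N + N') :=
      pow_le_pow_right₀ (by linarith) (by omega)
    have e2 : (1 + baseDist p q) ^ N' ≤ (1 + baseDist p q) ^ (N + N') :=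
      pow_le_pow_right₀ (by linarith) (by omega)
    calc |F p q + G p q| ≤ |F p q| + |G p q| := abs_add_le _ _
      _ ≤ C * (1 + ‖p.1‖ ^ 2) ^ j * (1 + baseDist p q) ^ N
          + C' * (1 + ‖p.1‖ ^ 2) ^ j * (1 + baseDist p q) ^ N' := add_le_add (h1 p q) (h2 p q)
      _ ≤ C * (1 + ‖p.1‖ ^ 2) ^ j * (1 + baseDist p q) ^ (N + N')
          + C' * (1 + ‖p.1‖ ^ 2) ^ j * (1 + baseDist p q) ^ (N + N') := by gcongr
      _ = _ := by ring
  | @mul i j F G _ _ ih1 ih2 =>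
    obtain ⟨C, N, hC, h1⟩ := ih1
    obtain ⟨C', N', hC', h2⟩ := ih2
    refine ⟨C * C', N + N', by positivity, fun p q => ?_⟩
    have hD := baseDist_nonneg p q
    rw [abs_mul]
    calc |F p q| * |G p q| ≤ (C * (1 + ‖p.1‖ ^ 2) ^ i * (1 + baseDist p q) ^ N)
          * (C' * (1 + ‖p.1‖ ^ 2) ^ j * (1 + baseDist p q) ^ N') :=
        mul_le_mul (h1 p q) (h2 p q) (abs_nonneg _) (by positivity)
      _ = _ := by rw [pow_add, pow_add]; ring
  | @weaken i j F _ hij ih =>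
    obtain ⟨C, N, hC, h1⟩ := ih
    refine ⟨C, N, hC, fun p q => (h1 p q).trans ?_⟩
    have hD := baseDist_nonneg p q
    have e1 : (1 + ‖p.1‖ ^ 2) ^ i ≤ (1 + ‖p.1‖ ^ 2) ^ j :=
      pow_le_pow_right₀ (by nlinarith [sq_nonneg ‖p.1‖]) hij
    gcongr

lemma exists_der_reZ (a : Fin 2 ⊕ Fin m) : ∃ F' : Cover m → Cover m → ℝ, IsPoly (wt a) F' ∧
    ∀ q, Der a (fun p => p.1.re ^ 2 - p.1.im ^ 2) (fun p => F' p q) := by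
  have hre := der_re a
  have him := der_im a
  have hd := (hre.mul hre).add ((him.mul him).mul (Der.const (-1)))
  match a with
  | Sum.inl 0 =>
    refine ⟨_, reZ, fun q => ?_⟩
    convert hd.congr (fun p => ?_) using 1
    · funext p; ring
    · simp only [dRe, dIm]; ring
  | Sum.inl 1 =>
    refine ⟨_, imZ.const_mul (-1), fun q => ?_⟩
    convert hd.congr (fun p => ?_) using 1
    · funext p; ring
    · simp only [dRe, dIm]; ring
  | Sum.inr _ =>
    refine ⟨_, const 0, fun q => ?_⟩
    convert hd.congr (fun p => ?_) using 1
    · funext p; ring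
    · simp only [dRe, dIm]; ring

lemma exists_der_imZ (a : Fin 2 ⊕ Fin m) : ∃ F' : Cover m → Cover m → ℝ, IsPoly (wt a) F' ∧
    ∀ q, Der a (fun p => 2 * p.1.re * p.1.im) (fun p => F' p q) := by
  have hre := der_re a
  have him := der_im a
  have hd := (hre.mul him).mul (Der.const 2)
  match a with
  | Sum.inl 0 =>
    refine ⟨_, imZ, fun q => ?_⟩
    convert hd.congr (fun p => ?_) using 1
    · funext p; ring
    · simp only [dRe, dIm]; ring
  | Sum.inl 1 =>
    refine ⟨_, reZ, fun q => ?_⟩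
    convert hd.congr (fun p => ?_) using 1
    · funext p; ring
    · simp only [dRe, dIm]; ring
  | Sum.inr _ =>
    refine ⟨_, const 0, fun q => ?_⟩
    convert hd.congr (fun p => ?_) using 1
    · funext p; ring
    · simp only [dRe, dIm]; ring

lemma exists_der_r (a : Fin 2 ⊕ Fin m) : ∃ F' : Cover m → Cover m → ℝ, IsPoly (wt a) F' ∧
    ∀ q, Der a (fun p => p.1.re ^ 2 + p.1.im ^ 2) (fun p => F' p q) := by
  have hre := der_re a
  have him := der_im a
  have hd := (hre.mul hre).add (him.mul him)
  match a with
  | Sum.inl 0 =>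
    refine ⟨_, rLeft, fun q => ?_⟩
    convert hd.congr (fun p => ?_) using 1
    · funext p; ring
    · simp only [dRe, dIm]; ring
  | Sum.inl 1 =>
    refine ⟨_, const' 1 0, fun q => ?_⟩
    convert hd.congr (fun p => ?_) using 1
    · funext p; ring
    · simp only [dRe, dIm]; ring
  | Sum.inr _ =>
    refine ⟨_, const 0, fun q => ?_⟩
    convert hd.congr (fun p => ?_) using 1
    · funext p; ring
    · simp only [dRe, dIm]; ring

/-- r∂_r and ∂_θ send z and z - y to multiples or rotations of z, which costs one degree; ∂_{t_i}
sends the generators to constants. Keeping track of this gives the weight |z|^`wtL` in the kernel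
bounds. -/
lemma exists_der {j : ℕ} {F : Cover m → Cover m → ℝ} (h : IsPoly j F) (a : Fin 2 ⊕ Fin m) :
    ∃ F' : Cover m → Cover m → ℝ, IsPoly (j + wt a) F' ∧
      ∀ q, Der a (fun p => F p q) (fun p => F' p q) := by
  obtain ⟨RZ, pRZ, hRZ⟩ := exists_der_reZ a
  obtain ⟨IZ, pIZ, hIZ⟩ := exists_der_imZ a
  obtain ⟨R, pR, hR⟩ := exists_der_r a
  induction h with
  | const c => exact ⟨_, const' _ 0, fun q => Der.const c⟩
  | reZ => exact ⟨_, pRZ.weaken (by omega), hRZ⟩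
  | imZ => exact ⟨_, pIZ.weaken (by omega), hIZ⟩
  | reSub =>
    refine ⟨_, pRZ.weaken (by omega), fun q => ?_⟩
    have := ((hRZ q).add (Der.const (-(q.1.re ^ 2 - q.1.im ^ 2)))).congr (fun p => add_zero _)
    simpa only [← sub_eq_add_neg] using this
  | imSub =>
    refine ⟨_, pIZ.weaken (by omega), fun q => ?_⟩
    have := ((hIZ q).add (Der.const (-(2 * q.1.re * q.1.im)))).congr (fun p => add_zero _)
    simpa only [← sub_eq_add_neg] using this
  | tSub i =>
    refine ⟨_, const' _ (dT i a), fun q => ?_⟩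
    have := ((der_t i a).add (Der.const (-(q.2 i)))).congr (fun p => add_zero _)
    simpa only [← sub_eq_add_neg] using this
  | rLeft => exact ⟨_, pR.weaken (by omega), hR⟩
  | rRight => exact ⟨_, const' _ 0, fun q => Der.const _⟩
  | add _ _ ih1 ih2 =>
    obtain ⟨F', hF', h1⟩ := ih1
    obtain ⟨G', hG', h2⟩ := ih2
    exact ⟨_, hF'.add hG', fun q => (h1 q).add (h2 q)⟩
  | @mul i j F G hF hG ih1 ih2 =>
    obtain ⟨F', hF', h1⟩ := ih1
    obtain ⟨G', hG', h2⟩ := ih2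
    refine ⟨_, ((hF'.mul hG).weaken ?_).add ((hF.mul hG').weaken ?_), fun q => (h1 q).mul (h2 q)⟩
    · omega
    · omega
  | weaken _ hij ih =>
    obtain ⟨F', hF', h1⟩ := ih
    exact ⟨F', hF'.weaken (by omega), h1⟩

end IsPoly

/-! ### The heat kernel at time one -/

/-- The squared distance of the projections, as a polynomial. -/
def quad (p q : Cover m) : ℝ :=
  ((p.1.re ^ 2 - p.1.im ^ 2) - (q.1.re ^ 2 - q.1.im ^ 2)) ^ 2 +
    (2 * p.1.re * p.1.im - 2 * q.1.re * q.1.im) ^ 2 + ∑ i, (p.2 i - q.2 i) ^ 2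

/-- The squared length `(|z| + |y|)² + |t - s|²` of the broken path through the singular set. -/
def hquad (p q : Cover m) : ℝ :=
  ((p.1.re ^ 2 + p.1.im ^ 2) + (q.1.re ^ 2 + q.1.im ^ 2)) ^ 2 + ∑ i, (p.2 i - q.2 i) ^ 2

/-- The Gaussian of the base. -/
def gk (p q : Cover m) : ℝ := Real.exp (-(1 / 4) * quad p q)

/-- The Gaussian of the broken path. -/
def hk (p q : Cover m) : ℝ := Real.exp (-(1 / 4) * hquad p q)

/-- The heat kernel of `V` at time one, up to normalisation. -/
def ker (p q : Cover m) : ℝ := gk p q * erf (crossRe p q)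

lemma quad_eq (p q : Cover m) : quad p q = baseDist p q ^ 2 := by
  rw [baseDist_sq, norm_sub_sq, EuclideanSpace.norm_sq_eq, quad]
  simp [pow_two]; ring

lemma hquad_eq (p q : Cover m) :
    hquad p q = (‖p.1‖ ^ 2 + ‖q.1‖ ^ 2) ^ 2 + ‖p.2 - q.2‖ ^ 2 := by
  rw [norm_sq_fst, norm_sq_fst, EuclideanSpace.norm_sq_eq, hquad]
  simp

lemma quad_add_crossRe (p q : Cover m) : quad p q + 4 * crossRe p q ^ 2 = hquad p q := by
  rw [hquad_eq, quad_eq, baseDist_sq, ← norm_sub_sq_add_crossRe]; ring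

lemma gk_mul_exp (p q : Cover m) : gk p q * Real.exp (-crossRe p q ^ 2) = hk p q := by
  rw [gk, hk, ← Real.exp_add, ← quad_add_crossRe]; congr 1; ring

/-- The squared length of the broken path dominates both |z|² and the squared distance; half of the
exponent is spent on each. -/
lemma hk_le (p q : Cover m) :
    hk p q ≤ Real.exp (-(1 / 8) * (‖p.1‖ ^ 2) ^ 2) * Real.exp (-(1 / 8) * baseDist p q ^ 2) := by
  rw [hk, ← Real.exp_add]
  apply Real.exp_le_exp.2
  have h1 := quad_add_crossRe p q
  rw [quad_eq] at h1
  have h2 := hquad_eq p q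
  nlinarith [sq_nonneg (crossRe p q), sq_nonneg ‖p.2 - q.2‖,
    mul_nonneg (sq_nonneg ‖p.1‖) (sq_nonneg ‖q.1‖), sq_nonneg (‖q.1‖ ^ 2)]

lemma hk_pos (p q : Cover m) : 0 < hk p q := Real.exp_pos _

lemma gk_pos (p q : Cover m) : 0 < gk p q := Real.exp_pos _

lemma gk_eq (p q : Cover m) : gk p q = Real.exp (-(1 / 4) * baseDist p q ^ 2) := by
  rw [gk, quad_eq]

lemma isPoly_quad : IsPoly (m := m) 0 quad := by
  have h : IsPoly (m := m) 0 fun p q => ∑ i, (p.2 i - q.2 i) * (p.2 i - q.2 i) :=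
    IsPoly.sum _ fun i _ => (IsPoly.tSub i).mul (IsPoly.tSub i)
  have := ((IsPoly.reSub (m := m).mul IsPoly.reSub).add (IsPoly.imSub.mul IsPoly.imSub)).add h
  convert this using 1
  funext p q; simp only [quad, pow_two]

lemma isPoly_hquad : IsPoly (m := m) 2 hquad := by
  have h : IsPoly (m := m) 0 fun p q => ∑ i, (p.2 i - q.2 i) * (p.2 i - q.2 i) :=
    IsPoly.sum _ fun i _ => (IsPoly.tSub i).mul (IsPoly.tSub i)
  have h1 := IsPoly.rLeft (m := m).add IsPoly.rRight
  have := (h1.mul h1).add (h.weaken (Nat.zero_le 2))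
  convert this using 1
  funext p q; simp only [hquad, pow_two]

/-! ### Closed form of the derivatives of the kernel. -/

/-- The coefficients of the derivatives of `crossRe` and `crossIm` along `fld a`. -/
def rot : Fin 2 ⊕ Fin m → ℝ × ℝ
  | Sum.inl 0 => (1 / 2, 0)
  | Sum.inl 1 => (0, -1 / 2)
  | Sum.inr _ => (0, 0)

lemma der_crossRe (a : Fin 2 ⊕ Fin m) (q : Cover m) : Der a (fun p => crossRe p q)
    (fun p => (rot a).1 * crossRe p q + (rot a).2 * crossIm p q) := by
  have h := ((der_re a).mul (Der.const q.1.re)).add ((der_im a).mul (Der.const q.1.im))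
  refine h.congr fun p => ?_
  match a with
  | Sum.inl 0 => simp only [rot, dRe, dIm, crossRe, crossIm]; ring
  | Sum.inl 1 => simp only [rot, dRe, dIm, crossRe, crossIm]; ring
  | Sum.inr _ => simp only [rot, dRe, dIm, crossRe, crossIm]; ring

lemma der_crossIm (a : Fin 2 ⊕ Fin m) (q : Cover m) : Der a (fun p => crossIm p q)
    (fun p => (rot a).1 * crossIm p q - (rot a).2 * crossRe p q) := by
  have h := ((der_im a).mul (Der.const q.1.re)).add ((der_re a).mul (Der.const (-q.1.im)))
  have h2 : (fun p : Cover m => crossIm p q) = fun p => p.1.im * q.1.re + p.1.re * -q.1.im := by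
    funext p; simp only [crossIm]; ring
  rw [h2]
  refine h.congr fun p => ?_
  match a with
  | Sum.inl 0 => simp only [rot, dRe, dIm, crossRe, crossIm]; ring
  | Sum.inl 1 => simp only [rot, dRe, dIm, crossRe, crossIm]; ring
  | Sum.inr _ => simp only [rot, dRe, dIm, crossRe, crossIm]; ring

lemma der_exp_quarter {a : Fin 2 ⊕ Fin m} {f f' : Cover m → ℝ} (h : Der a f f') :
    Der a (fun p => Real.exp (-(1 / 4) * f p))
      (fun p => -(1 / 4) * f' p * Real.exp (-(1 / 4) * f p)) :=
  ((((Der.const (-(1 / 4))).mul h)).comp (φ := Real.exp) (φ' := Real.exp)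
    Real.hasDerivAt_exp).congr fun p => by ring

/-- Differentiating erf produces exp(-`crossRe`²), which turns the Gaussian of the base into that of
the broken path. Thus all terms without erf carry the factor `hk`. -/
lemma der_ker {a : Fin 2 ⊕ Fin m} {q : Cover m} {Q' : Cover m → ℝ}
    (h : Der a (fun p => quad p q) Q') : Der a (fun p => ker p q)
      (fun p => -(1 / 4) * Q' p * ker p q + 2 / √Real.pi *
        ((rot a).1 * crossRe p q + (rot a).2 * crossIm p q) * hk p q) := by
  refine ((der_exp_quarter h).mul ((der_crossRe a q).comp hasDerivAt_erf)).congr fun p => ?_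
  rw [← gk_mul_exp, ker, gk]; ring

/-- The total weight of a list of tangential fields. -/
def wtL (l : List (Fin 2 ⊕ Fin m)) : ℕ := (l.map wt).sum

lemma wtL_cons (a : Fin 2 ⊕ Fin m) (l) : wtL (a :: l) = wt a + wtL l := by simp [wtL]

/-- The derivative of the heat kernel along a list of tangential fields. -/
def kerL (l : List (Fin 2 ⊕ Fin m)) (p q : Cover m) : ℝ := monomial l (fun p => ker p q) p

/-- The derivative of the Gaussian of the base along a list of tangential fields. -/
def gkL (l : List (Fin 2 ⊕ Fin m)) (p q : Cover m) : ℝ := monomial l (fun p => gk p q) p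

lemma kerL_nil (p q : Cover m) : kerL [] p q = ker p q := rfl

lemma gkL_nil (p q : Cover m) : gkL [] p q = gk p q := rfl

lemma kerL_cons (a : Fin 2 ⊕ Fin m) (l) (p q : Cover m) :
    kerL (a :: l) p q = fderiv ℝ (fun p => kerL l p q) p (fld a p) := rfl

lemma gkL_cons (a : Fin 2 ⊕ Fin m) (l) (p q : Cover m) :
    gkL (a :: l) p q = fderiv ℝ (fun p => gkL l p q) p (fld a p) := rfl

/-- Derivatives of the heat kernel are combinations, with polynomial coefficients, of the kernel
itself and of the Gaussian of the broken path; the Gaussian of the base has the same leading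
coefficient. -/
lemma exists_kerL_eq (l : List (Fin 2 ⊕ Fin m)) :
    ∃ (P A B : Cover m → Cover m → ℝ) (j : ℕ), IsPoly (wtL l) P ∧ IsPoly j A ∧ IsPoly j B ∧
      (∀ p q, kerL l p q =
        P p q * ker p q + (A p q * crossRe p q + B p q * crossIm p q) * hk p q) ∧
      ∀ p q, gkL l p q = P p q * gk p q := by
  induction l with
  | nil =>
    refine ⟨fun _ _ => 1, fun _ _ => 0, fun _ _ => 0, 0, IsPoly.const 1, IsPoly.const 0,
      IsPoly.const 0, fun p q => ?_, fun p q => ?_⟩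
    · rw [kerL_nil]; ring
    · rw [gkL_nil]; ring
  | cons a l ih =>
    obtain ⟨P, A, B, j, hP, hA, hB, hK, hG⟩ := ih
    obtain ⟨P', pP', hP'⟩ := hP.exists_der a
    obtain ⟨A', pA', hA'⟩ := hA.exists_der a
    obtain ⟨B', pB', hB'⟩ := hB.exists_der a
    obtain ⟨Q', pQ', hQ'⟩ := isPoly_quad.exists_der a
    obtain ⟨H', pH', hH'⟩ := isPoly_hquad.exists_der a
    -- Only the degree of `P` has to be exact. The coefficients of `hk` may have any degree, because
    -- `hk` itself decays in |z|.
    have hj : ∃ j', wtL l ≤ j' ∧ j + wt a ≤ j' ∧ j ≤ j' ∧ j + (2 + wt a) ≤ j' :=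
      ⟨wtL l + j + 2 + wt a, by omega, by omega, by omega, by omega⟩
    obtain ⟨j', h1, h2, h3, h4⟩ := hj
    refine ⟨fun p q => P' p q + (-(1 / 4)) * (P p q * Q' p q),
      fun p q => (2 / √Real.pi * (rot a).1) * P p q + (A' p q + ((rot a).1 * A p q +
        ((-(rot a).2) * B p q + (-(1 / 4)) * (A p q * H' p q)))),
      fun p q => (2 / √Real.pi * (rot a).2) * P p q + (B' p q + ((rot a).2 * A p q +
        ((rot a).1 * B p q + (-(1 / 4)) * (B p q * H' p q)))), j', ?_, ?_, ?_, ?_, ?_⟩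
    · rw [wtL_cons]
      exact (pP'.weaken (by omega)).add (((hP.mul pQ').weaken (by omega)).const_mul _)
    · exact ((hP.weaken h1).const_mul _).add ((pA'.weaken h2).add
        (((hA.weaken h3).const_mul _).add (((hB.weaken h3).const_mul _).add
          (((hA.mul pH').weaken h4).const_mul _))))
    · exact ((hP.weaken h1).const_mul _).add ((pB'.weaken h2).add
        (((hA.weaken h3).const_mul _).add (((hB.weaken h3).const_mul _).add
          (((hB.mul pH').weaken h4).const_mul _))))
    · intro p q
      rw [kerL_cons]
      simp_rw [hK]
      have hd := ((hP' q).mul (der_ker (hQ' q))).add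
        ((((hA' q).mul (der_crossRe a q)).add ((hB' q).mul (der_crossIm a q))).mul
          (der_exp_quarter (hH' q)))
      refine (congrFun hd.along p).trans ?_
      rw [show Real.exp (-(1 / 4) * hquad p q) = hk p q from rfl]
      ring
    · intro p q
      rw [gkL_cons]
      simp_rw [hG]
      have hd := (hP' q).mul (der_exp_quarter (hQ' q))
      refine (congrFun hd.along p).trans ?_
      rw [show Real.exp (-(1 / 4) * quad p q) = gk p q from rfl]
      ring

lemma contDiff_coord : ContDiff ℝ ((⊤ : ℕ∞) : WithTop ℕ∞)
      (fun x : Cover m × Cover m => crossRe x.1 x.2) ∧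
    ContDiff ℝ ((⊤ : ℕ∞) : WithTop ℕ∞) (fun x : Cover m × Cover m => crossIm x.1 x.2) := by
  have hre : ContDiff ℝ ((⊤ : ℕ∞) : WithTop ℕ∞) fun z : ℂ => z.re := Complex.reCLM.contDiff
  have him : ContDiff ℝ ((⊤ : ℕ∞) : WithTop ℕ∞) fun z : ℂ => z.im := Complex.imCLM.contDiff
  have h1 : ContDiff ℝ ((⊤ : ℕ∞) : WithTop ℕ∞) fun x : Cover m × Cover m => x.1.1.re :=
    hre.comp (by fun_prop)
  have h2 : ContDiff ℝ ((⊤ : ℕ∞) : WithTop ℕ∞) fun x : Cover m × Cover m => x.1.1.im :=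
    him.comp (by fun_prop)
  have h3 : ContDiff ℝ ((⊤ : ℕ∞) : WithTop ℕ∞) fun x : Cover m × Cover m => x.2.1.re :=
    hre.comp (by fun_prop)
  have h4 : ContDiff ℝ ((⊤ : ℕ∞) : WithTop ℕ∞) fun x : Cover m × Cover m => x.2.1.im :=
    him.comp (by fun_prop)
  exact ⟨(h1.mul h3).add (h2.mul h4), (h2.mul h3).sub (h1.mul h4)⟩

lemma contDiff_gk : ContDiff ℝ ((⊤ : ℕ∞) : WithTop ℕ∞)
    (fun x : Cover m × Cover m => gk x.1 x.2) :=
  (contDiff_const.mul isPoly_quad.contDiff).exp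

lemma contDiff_hk : ContDiff ℝ ((⊤ : ℕ∞) : WithTop ℕ∞)
    (fun x : Cover m × Cover m => hk x.1 x.2) :=
  (contDiff_const.mul isPoly_hquad.contDiff).exp

lemma contDiff_ker : ContDiff ℝ ((⊤ : ℕ∞) : WithTop ℕ∞)
    (fun x : Cover m × Cover m => ker x.1 x.2) :=
  contDiff_gk.mul (contDiff_erf.comp contDiff_coord.1)

lemma contDiff_kerL (l : List (Fin 2 ⊕ Fin m)) : ContDiff ℝ ((⊤ : ℕ∞) : WithTop ℕ∞)
    (fun x : Cover m × Cover m => kerL l x.1 x.2) := by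
  obtain ⟨P, A, B, j, hP, hA, hB, hK, -⟩ := exists_kerL_eq l
  simp_rw [hK]
  exact (hP.contDiff.mul contDiff_ker).add (((hA.contDiff.mul contDiff_coord.1).add
    (hB.contDiff.mul contDiff_coord.2)).mul contDiff_hk)

lemma contDiff_gkL (l : List (Fin 2 ⊕ Fin m)) : ContDiff ℝ ((⊤ : ℕ∞) : WithTop ℕ∞)
    (fun x : Cover m × Cover m => gkL l x.1 x.2) := by
  obtain ⟨P, A, B, j, hP, hA, hB, -, hG⟩ := exists_kerL_eq l
  simp_rw [hG]
  exact hP.contDiff.mul contDiff_gk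

lemma differentiable_kerL (l : List (Fin 2 ⊕ Fin m)) (q : Cover m) :
    Differentiable ℝ fun p => kerL l p q :=
  ((contDiff_kerL l).comp (contDiff_id.prodMk contDiff_const)).differentiable (by simp)

lemma differentiable_gkL (l : List (Fin 2 ⊕ Fin m)) (q : Cover m) :
    Differentiable ℝ fun p => gkL l p q :=
  ((contDiff_gkL l).comp (contDiff_id.prodMk contDiff_const)).differentiable (by simp)

/-! ### Kernel bounds -/

lemma exists_pow_mul_gauss_le (N : ℕ) : ∃ C, 0 < C ∧ ∀ x : ℝ, 0 ≤ x →
    (1 + x) ^ N * Real.exp (-(1 / 8) * x ^ 2) ≤ C * Real.exp (-(1 / 16) * x ^ 2) := by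
  obtain ⟨C, hC, h⟩ := exists_pow_mul_exp_le N (c := 1 / 16) (by norm_num)
  refine ⟨C, hC, fun x hx => ?_⟩
  calc (1 + x) ^ N * Real.exp (-(1 / 8) * x ^ 2)
      = (1 + x) ^ N * Real.exp (-(1 / 16) * x ^ 2) * Real.exp (-(1 / 16) * x ^ 2) := by
        rw [mul_assoc, ← Real.exp_add]; ring_nf
    _ ≤ _ := by gcongr; exact h x hx

lemma exists_poly_mul_gk_le {j : ℕ} {P : Cover m → Cover m → ℝ} (hP : IsPoly j P) :
    ∃ C, 0 < C ∧ ∀ p q, |P p q| * gk p q ≤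
      C * (1 + ‖p.1‖ ^ 2) ^ j * Real.exp (-(1 / 16) * baseDist p q ^ 2) := by
  obtain ⟨C, N, hC, h⟩ := hP.exists_bound
  obtain ⟨C', hC', h'⟩ := exists_pow_mul_gauss_le N
  refine ⟨C * C' + 1, by positivity, fun p q => ?_⟩
  have hD := baseDist_nonneg p q
  have h1 : gk p q ≤ Real.exp (-(1 / 8) * baseDist p q ^ 2) := by
    rw [gk_eq]; apply Real.exp_le_exp.2; nlinarith [sq_nonneg (baseDist p q)]
  calc |P p q| * gk p q
      ≤ (C * (1 + ‖p.1‖ ^ 2) ^ j * (1 + baseDist p q) ^ N) *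
          Real.exp (-(1 / 8) * baseDist p q ^ 2) :=
        mul_le_mul (h p q) h1 (gk_pos p q).le (by positivity)
    _ = C * (1 + ‖p.1‖ ^ 2) ^ j *
          ((1 + baseDist p q) ^ N * Real.exp (-(1 / 8) * baseDist p q ^ 2)) := by ring
    _ ≤ C * (1 + ‖p.1‖ ^ 2) ^ j * (C' * Real.exp (-(1 / 16) * baseDist p q ^ 2)) :=
        mul_le_mul_of_nonneg_left (h' _ hD) (by positivity)
    _ ≤ _ := by
        have : 0 ≤ (1 + ‖p.1‖ ^ 2) ^ j * Real.exp (-(1 / 16) * baseDist p q ^ 2) := by positivity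
        nlinarith

/-- The Gaussian of the broken path decays in |z| as well as in the distance, so it absorbs every
power of |z|. -/
lemma exists_poly_mul_hk_le {j : ℕ} {P : Cover m → Cover m → ℝ} (hP : IsPoly j P) :
    ∃ C, 0 < C ∧ ∀ p q, |P p q| * hk p q ≤ C * Real.exp (-(1 / 16) * (‖p.1‖ ^ 2) ^ 2) *
      Real.exp (-(1 / 16) * baseDist p q ^ 2) := by
  obtain ⟨C, N, hC, h⟩ := hP.exists_bound
  obtain ⟨C', hC', h'⟩ := exists_pow_mul_gauss_le N
  obtain ⟨C'', hC'', h''⟩ := exists_pow_mul_gauss_le j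
  refine ⟨C * C' * C'' + 1, by positivity, fun p q => ?_⟩
  have hD := baseDist_nonneg p q
  calc |P p q| * hk p q
      ≤ (C * (1 + ‖p.1‖ ^ 2) ^ j * (1 + baseDist p q) ^ N) *
          (Real.exp (-(1 / 8) * (‖p.1‖ ^ 2) ^ 2) * Real.exp (-(1 / 8) * baseDist p q ^ 2)) := by
        gcongr
        · exact (hk_pos _ _).le
        · exact h p q
        · exact hk_le p q
    _ = C * ((1 + ‖p.1‖ ^ 2) ^ j * Real.exp (-(1 / 8) * (‖p.1‖ ^ 2) ^ 2)) *
          ((1 + baseDist p q) ^ N * Real.exp (-(1 / 8) * baseDist p q ^ 2)) := by ring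
    _ ≤ C * (C'' * Real.exp (-(1 / 16) * (‖p.1‖ ^ 2) ^ 2)) *
          (C' * Real.exp (-(1 / 16) * baseDist p q ^ 2)) :=
        mul_le_mul (mul_le_mul_of_nonneg_left (h'' _ (by positivity)) hC) (h' _ hD)
          (by positivity) (by positivity)
    _ ≤ _ := by
        have : 0 ≤ Real.exp (-(1 / 16) * (‖p.1‖ ^ 2) ^ 2) *
          Real.exp (-(1 / 16) * baseDist p q ^ 2) := by positivity
        nlinarith

lemma exp_neg_le_one {x : ℝ} (hx : 0 ≤ x) : Real.exp (-(1 / 16) * x) ≤ 1 := by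
  rw [Real.exp_le_one_iff]; linarith

/-- Derivatives of the heat kernel vanish to first order at the singular set in both variables. -/
lemma exists_kerL_le_mul (l : List (Fin 2 ⊕ Fin m)) : ∃ C, 0 < C ∧ ∀ p q : Cover m,
    |kerL l p q| ≤ C * (‖p.1‖ * ‖q.1‖) * (1 + ‖p.1‖ ^ 2) ^ wtL l *
      Real.exp (-(1 / 16) * baseDist p q ^ 2) := by
  obtain ⟨P, A, B, j, hP, hA, hB, hK, -⟩ := exists_kerL_eq l
  obtain ⟨C₁, hC₁, h₁⟩ := exists_poly_mul_gk_le hP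
  obtain ⟨C₂, hC₂, h₂⟩ := exists_poly_mul_hk_le hA
  obtain ⟨C₃, hC₃, h₃⟩ := exists_poly_mul_hk_le hB
  refine ⟨2 * C₁ + C₂ + C₃, by positivity, fun p q => ?_⟩
  set W := ‖p.1‖ * ‖q.1‖ with hW
  set X := (1 + ‖p.1‖ ^ 2) ^ wtL l with hX
  set Y := Real.exp (-(1 / 16) * baseDist p q ^ 2) with hY
  have hW0 : 0 ≤ W := by positivity
  have hX1 : 1 ≤ X := one_le_pow₀ (by nlinarith [sq_nonneg ‖p.1‖])
  have hY0 : 0 < Y := Real.exp_pos _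
  have hx := abs_crossRe_le p q
  have hy := abs_crossIm_le p q
  have e0 := exp_neg_le_one (sq_nonneg (‖p.1‖ ^ 2))
  -- The factor |w||v| comes from |erf x| ≤ 2|x|; in the other terms it comes from `crossRe` and
  -- `crossIm` directly.
  have e1 : |P p q * ker p q| ≤ 2 * C₁ * W * X * Y := by
    rw [ker, abs_mul, abs_mul, abs_of_pos (gk_pos p q), ← mul_assoc]
    calc |P p q| * gk p q * |erf (crossRe p q)| ≤ (C₁ * X * Y) * (2 * W) :=
          mul_le_mul (h₁ p q) ((abs_erf_le _).trans (mul_le_mul_of_nonneg_left hx (by norm_num)))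
            (abs_nonneg _) (by positivity)
      _ = _ := by ring
  have aux : ∀ (C : ℝ) (F : Cover m → Cover m → ℝ) (x : ℝ), 0 < C → |x| ≤ W →
      |F p q| * hk p q ≤ C * Real.exp (-(1 / 16) * (‖p.1‖ ^ 2) ^ 2) * Y →
      |F p q * x * hk p q| ≤ C * W * X * Y := by
    intro C F x hC hx hF
    rw [abs_mul, abs_mul, abs_of_pos (hk_pos p q)]
    calc |F p q| * |x| * hk p q = (|F p q| * hk p q) * |x| := by ring
      _ ≤ (C * Real.exp (-(1 / 16) * (‖p.1‖ ^ 2) ^ 2) * Y) * W := by gcongr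
      _ ≤ (C * 1 * Y) * W := by gcongr
      _ ≤ (C * X * Y) * W := by gcongr
      _ = _ := by ring
  have e2 := aux C₂ A _ hC₂ hx (h₂ p q)
  have e3 := aux C₃ B _ hC₃ hy (h₃ p q)
  rw [hK, add_mul]
  calc _ ≤ |P p q * ker p q| + (|A p q * crossRe p q * hk p q| + |B p q * crossIm p q * hk p q|) :=
        (abs_add_le _ _).trans (by gcongr; exact abs_add_le _ _)
    _ ≤ 2 * C₁ * W * X * Y + (C₂ * W * X * Y + C₃ * W * X * Y) := by gcongr
    _ = _ := by ring

/-- Up to a term which is small away from the singular set, the derivatives of the heat kernel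
are the parallel transports of those of the Gaussian of the base. -/
lemma exists_kerL_sub_gkL_le (l : List (Fin 2 ⊕ Fin m)) : ∃ C, 0 < C ∧ ∀ p q : Cover m,
    |kerL l p q * crossSign p q - gkL l p q| ≤ C * Real.exp (-(1 / 16) * (‖p.1‖ ^ 2) ^ 2) *
      Real.exp (-(1 / 16) * baseDist p q ^ 2) := by
  obtain ⟨P, A, B, j, hP, hA, hB, hK, hG⟩ := exists_kerL_eq l
  have hRR : IsPoly (m := m) 1 fun p q => (p.1.re ^ 2 + p.1.im ^ 2) + (q.1.re ^ 2 + q.1.im ^ 2) :=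
    IsPoly.rLeft.add IsPoly.rRight
  obtain ⟨C₁, hC₁, h₁⟩ := exists_poly_mul_hk_le hP
  obtain ⟨C₂, hC₂, h₂⟩ := exists_poly_mul_hk_le (hA.mul hRR)
  obtain ⟨C₃, hC₃, h₃⟩ := exists_poly_mul_hk_le (hB.mul hRR)
  refine ⟨C₁ + C₂ + C₃, by positivity, fun p q => ?_⟩
  set Z := Real.exp (-(1 / 16) * (‖p.1‖ ^ 2) ^ 2) * Real.exp (-(1 / 16) * baseDist p q ^ 2) with hZ
  -- The factors `crossRe` and `crossIm` are traded for |z| + |y|, which is polynomial and can be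
  -- absorbed into the coefficients of `hk`.
  have hW : ‖p.1‖ * ‖q.1‖ ≤ |(p.1.re ^ 2 + p.1.im ^ 2) + (q.1.re ^ 2 + q.1.im ^ 2)| := by
    rw [← norm_sq_fst, ← norm_sq_fst, abs_of_nonneg (by positivity)]
    nlinarith [sq_nonneg (‖p.1‖ - ‖q.1‖), sq_nonneg ‖p.1‖, sq_nonneg ‖q.1‖]
  have hx := (abs_crossRe_le p q).trans hW
  have hy := (abs_crossIm_le p q).trans hW
  -- After multiplication by the sign, erf differs from 1 by at most exp(-`crossRe`²), and this
  -- factor converts `gk` into `hk`.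
  have herf : |erf (crossRe p q) * crossSign p q - 1| ≤ Real.exp (-crossRe p q ^ 2) := by
    have h : erf (crossRe p q) * crossSign p q = erf |crossRe p q| := by
      unfold crossSign
      split_ifs with h
      · rw [abs_of_pos h, mul_one]
      · rw [abs_of_nonpos (not_lt.1 h), erf_neg]; ring
    rw [h, abs_sub_comm, abs_of_nonneg (by linarith [erf_le_one |crossRe p q|]), ← sq_abs]
    exact one_sub_erf_le (abs_nonneg _)
  have hk0 := hk_pos p q
  have e1 : |P p q * gk p q * (erf (crossRe p q) * crossSign p q - 1)| ≤ C₁ * Z := by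
    rw [abs_mul, abs_mul, abs_of_pos (gk_pos p q)]
    calc _ ≤ |P p q| * gk p q * Real.exp (-crossRe p q ^ 2) := by
          have := gk_pos p q
          gcongr
      _ = |P p q| * hk p q := by rw [mul_assoc, gk_mul_exp]
      _ ≤ _ := (h₁ p q).trans_eq (mul_assoc _ _ _)
  have aux : ∀ (C : ℝ) (F : Cover m → Cover m → ℝ) (x : ℝ), 0 < C →
      |x| ≤ |(p.1.re ^ 2 + p.1.im ^ 2) + (q.1.re ^ 2 + q.1.im ^ 2)| →
      |F p q * ((p.1.re ^ 2 + p.1.im ^ 2) + (q.1.re ^ 2 + q.1.im ^ 2))| * hk p q ≤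
        C * Real.exp (-(1 / 16) * (‖p.1‖ ^ 2) ^ 2) * Real.exp (-(1 / 16) * baseDist p q ^ 2) →
      |F p q * x * hk p q * crossSign p q| ≤ C * Z := by
    intro C F x hC hx hF
    rw [abs_mul, abs_mul, abs_crossSign, mul_one, abs_of_pos hk0]
    refine le_trans ?_ (hF.trans_eq (mul_assoc _ _ _))
    rw [abs_mul, abs_mul]
    gcongr
  have e2 := aux C₂ A _ hC₂ hx (h₂ p q)
  have e3 := aux C₃ B _ hC₃ hy (h₃ p q)
  have hsplit : kerL l p q * crossSign p q - gkL l p q =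
      P p q * gk p q * (erf (crossRe p q) * crossSign p q - 1) +
        (A p q * crossRe p q * hk p q * crossSign p q +
          B p q * crossIm p q * hk p q * crossSign p q) := by
    rw [hK, hG, ker]; ring
  rw [hsplit]
  calc _ ≤ _ := (abs_add_le _ _).trans (add_le_add_right (abs_add_le _ _) _)
    _ ≤ C₁ * Z + (C₂ * Z + C₃ * Z) := by gcongr
    _ = _ := by rw [hZ]; ring

lemma exists_gkL_le (l : List (Fin 2 ⊕ Fin m)) : ∃ C, 0 < C ∧ ∀ p q : Cover m,
    |gkL l p q| ≤ C * (1 + ‖p.1‖ ^ 2) ^ wtL l * Real.exp (-(1 / 16) * baseDist p q ^ 2) := by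
  obtain ⟨P, A, B, j, hP, hA, hB, -, hG⟩ := exists_kerL_eq l
  obtain ⟨C₁, hC₁, h₁⟩ := exists_poly_mul_gk_le hP
  refine ⟨C₁, hC₁, fun p q => ?_⟩
  rw [hG, abs_mul, abs_of_pos (gk_pos p q)]
  exact h₁ p q

lemma exists_kerL_le (l : List (Fin 2 ⊕ Fin m)) : ∃ C, 0 < C ∧ ∀ p q : Cover m,
    |kerL l p q| ≤ C * (1 + ‖p.1‖ ^ 2) ^ wtL l * Real.exp (-(1 / 16) * baseDist p q ^ 2) := by
  obtain ⟨C₁, hC₁, h₁⟩ := exists_kerL_sub_gkL_le l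
  obtain ⟨C₂, hC₂, h₂⟩ := exists_gkL_le l
  refine ⟨C₁ + C₂, by positivity, fun p q => ?_⟩
  have e0 := exp_neg_le_one (sq_nonneg (‖p.1‖ ^ 2))
  have hX1 : 1 ≤ (1 + ‖p.1‖ ^ 2) ^ wtL l := one_le_pow₀ (by nlinarith [sq_nonneg ‖p.1‖])
  have h3 : |kerL l p q| = |kerL l p q * crossSign p q| := by
    rw [abs_mul, abs_crossSign, mul_one]
  rw [h3]
  calc |kerL l p q * crossSign p q|
      ≤ |kerL l p q * crossSign p q - gkL l p q| + |gkL l p q| := by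
        have := abs_add_le (kerL l p q * crossSign p q - gkL l p q) (gkL l p q)
        rwa [sub_add_cancel] at this
    _ ≤ C₁ * 1 * Real.exp (-(1 / 16) * baseDist p q ^ 2) +
        C₂ * (1 + ‖p.1‖ ^ 2) ^ wtL l * Real.exp (-(1 / 16) * baseDist p q ^ 2) := by
        refine add_le_add ((h₁ p q).trans ?_) (h₂ p q)
        gcongr
    _ ≤ C₁ * (1 + ‖p.1‖ ^ 2) ^ wtL l * Real.exp (-(1 / 16) * baseDist p q ^ 2) +
        C₂ * (1 + ‖p.1‖ ^ 2) ^ wtL l * Real.exp (-(1 / 16) * baseDist p q ^ 2) := by gcongr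
    _ = _ := by ring

attribute [irreducible] kerL gkL

/-! ### Towers of tangential derivatives -/

/-- The coframe dual to `fld`. -/
def cof : Fin 2 ⊕ Fin m → Cover m → Cover m →L[ℝ] ℝ
  | Sum.inl 0 => fun p => Complex.reCLM.comp
      ((ContinuousLinearMap.mul ℝ ℂ (2 / p.1)).comp (ContinuousLinearMap.fst ℝ _ _))
  | Sum.inl 1 => fun p => Complex.imCLM.comp
      ((ContinuousLinearMap.mul ℝ ℂ (2 / p.1)).comp (ContinuousLinearMap.fst ℝ _ _))
  | Sum.inr i => fun _ => (EuclideanSpace.proj i).comp (ContinuousLinearMap.snd ℝ _ _)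

lemma cof_inl_zero (p v : Cover m) : cof (Sum.inl 0) p v = (2 / p.1 * v.1).re := rfl

lemma cof_inl_one (p v : Cover m) : cof (Sum.inl 1) p v = (2 / p.1 * v.1).im := rfl

lemma cof_inr (i : Fin m) (p v : Cover m) : cof (Sum.inr i) p v = v.2 i := rfl

lemma sum_cof_smul_fld {p : Cover m} (hp : p.1 ≠ 0) (v : Cover m) :
    ∑ a, cof a p v • fld a p = v := by
  rw [Fintype.sum_sum_type, Fin.sum_univ_two, fld_inl_zero, fld_inl_one]
  simp only [fld_inr, cof_inl_zero, cof_inl_one, cof_inr]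
  apply Prod.ext
  · simp only [Prod.fst_add, Prod.smul_mk, Prod.fst_sum, Finset.sum_const_zero, add_zero,
      Complex.real_smul, smul_zero]
    have h2 : (2 / p.1 * v.1) * (p.1 / 2) = v.1 := by field_simp
    generalize 2 / p.1 * v.1 = c at h2
    rw [← h2]
    conv_rhs => rw [← Complex.re_add_im c]
    ring
  · simp only [Prod.snd_add, Prod.smul_mk, Prod.snd_sum, smul_zero, zero_add]
    ext i
    simp [Pi.single_apply]

lemma cof_fld {p : Cover m} (hp : p.1 ≠ 0) (a b : Fin 2 ⊕ Fin m) :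
    cof b p (fld a p) = if b = a then 1 else 0 := by
  have h1 : (2 / p.1 * (p.1 / 2)) = 1 := by field_simp
  have h2 : (2 / p.1 * (Complex.I * p.1 / 2)) = Complex.I := by field_simp
  match a, b with
  | Sum.inl 0, Sum.inl 0 => simp [cof_inl_zero, fld_inl_zero, h1]
  | Sum.inl 1, Sum.inl 0 => simp [cof_inl_zero, fld_inl_one, h2]
  | Sum.inl 0, Sum.inl 1 => simp [cof_inl_one, fld_inl_zero, h1]
  | Sum.inl 1, Sum.inl 1 => simp [cof_inl_one, fld_inl_one, h2]
  | Sum.inl 0, Sum.inr i => simp [cof_inr, fld_inl_zero]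
  | Sum.inl 1, Sum.inr i => simp [cof_inr, fld_inl_one]
  | Sum.inr i, Sum.inl 0 => simp [cof_inl_zero, fld_inr]
  | Sum.inr i, Sum.inl 1 => simp [cof_inl_one, fld_inr]
  | Sum.inr i, Sum.inr j => simp [cof_inr, fld_inr, PiLp.single_apply]

lemma eq_sum_cof {p : Cover m} (hp : p.1 ≠ 0) (L : Cover m →L[ℝ] ℝ) :
    L = ∑ a, L (fld a p) • cof a p := by
  refine ContinuousLinearMap.ext fun v => ?_
  conv_lhs => rw [← sum_cof_smul_fld hp v]
  rw [map_sum, sum_apply]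
  refine Finset.sum_congr rfl fun a _ => ?_
  rw [map_smul, smul_apply, smul_eq_mul, smul_eq_mul, mul_comm]

lemma abs_cof_inl_le (k : Fin 2) (p v : Cover m) :
    |cof (Sum.inl k) p v| ≤ 2 / ‖p.1‖ * ‖v.1‖ := by
  have h : ‖2 / p.1 * v.1‖ = 2 / ‖p.1‖ * ‖v.1‖ := by simp
  match k with
  | 0 => rw [cof_inl_zero, ← h]; exact Complex.abs_re_le_norm _
  | 1 => rw [cof_inl_one, ← h]; exact Complex.abs_im_le_norm _

lemma abs_cof_inr_le (i : Fin m) (p v : Cover m) : |cof (Sum.inr i) p v| ≤ ‖v.2‖ := by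
  rw [cof_inr]; exact PiLp.norm_apply_le v.2 i

lemma norm_cof_le (a : Fin 2 ⊕ Fin m) (p : Cover m) : ‖cof a p‖ ≤ 2 / ‖p.1‖ + 1 := by
  refine ContinuousLinearMap.opNorm_le_bound _ (by positivity) fun v => ?_
  have h1 : ‖v.1‖ ≤ ‖v‖ := norm_fst_le v
  have h2 : ‖v.2‖ ≤ ‖v‖ := norm_snd_le v
  have h3 : 0 ≤ 2 / ‖p.1‖ := by positivity
  match a with
  | Sum.inl k =>
    refine (abs_cof_inl_le k p v).trans ?_
    nlinarith [norm_nonneg v, mul_le_mul_of_nonneg_left h1 h3]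
  | Sum.inr i =>
    refine (abs_cof_inr_le i p v).trans ?_
    nlinarith [norm_nonneg v, mul_nonneg h3 (norm_nonneg v)]

lemma isOpen_regular : IsOpen {p : Cover m | p.1 ≠ 0} :=
  isOpen_ne_fun continuous_fst continuous_const

lemma contDiffOn_cof (a : Fin 2 ⊕ Fin m) (n : WithTop ℕ∞) :
    ContDiffOn ℝ n (cof a) {p : Cover m | p.1 ≠ 0} := by
  have h : ContDiffOn ℝ n (fun p : Cover m => 2 / p.1) {p : Cover m | p.1 ≠ 0} :=
    (contDiffOn_const (c := (2 : ℂ))).mul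
      (ContDiffOn.inv (f := fun p : Cover m => p.1) contDiff_fst.contDiffOn (fun p hp => hp))
  have h2 : ContDiffOn ℝ n (fun p : Cover m => (ContinuousLinearMap.mul ℝ ℂ (2 / p.1)).comp
      (ContinuousLinearMap.fst ℝ ℂ (EuclideanSpace ℝ (Fin m)))) {p : Cover m | p.1 ≠ 0} :=
    ((ContinuousLinearMap.mul ℝ ℂ).contDiff.comp_contDiffOn h).clm_comp contDiffOn_const
  match a with
  | Sum.inl 0 => exact contDiffOn_const.clm_comp h2
  | Sum.inl 1 => exact contDiffOn_const.clm_comp h2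
  | Sum.inr i => exact contDiffOn_const

/-- A family of functions, indexed by lists of tangential fields, is a tower of height `n` if, away
from the singular set, the derivatives of `F l` along the fields are the `F (a :: l)`, for lists
`l` of length less than `n`. -/
def IsTower (n : ℕ∞) (F : List (Fin 2 ⊕ Fin m) → Cover m → ℝ) : Prop :=
  ∀ l : List (Fin 2 ⊕ Fin m), (l.length : ℕ∞) < n → ∀ p : Cover m, p.1 ≠ 0 →
    HasFDerivAt (F l) (∑ a, F (a :: l) p • cof a p) p

namespace IsTower

variable {n : ℕ∞} {F : List (Fin 2 ⊕ Fin m) → Cover m → ℝ}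

lemma of_le {k : ℕ∞} (hF : IsTower n F) (h : k ≤ n) : IsTower k F :=
  fun l hl p hp => hF l (hl.trans_le h) p hp

lemma fderiv_fld (hF : IsTower n F) {l : List (Fin 2 ⊕ Fin m)} (hl : (l.length : ℕ∞) < n)
    {p : Cover m} (hp : p.1 ≠ 0) (a : Fin 2 ⊕ Fin m) :
    fderiv ℝ (F l) p (fld a p) = F (a :: l) p := by
  rw [(hF l hl p hp).fderiv]
  rw [sum_apply, Finset.sum_eq_single a]
  · simp [cof_fld hp]
  · intro b _ hb; simp [cof_fld hp, hb]
  · simp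

lemma monomial_eq (hF : IsTower n F) (l : List (Fin 2 ⊕ Fin m)) (hl : (l.length : ℕ∞) ≤ n)
    {p : Cover m} (hp : p.1 ≠ 0) : monomial l (F []) p = F l p := by
  induction l generalizing p with
  | nil => rfl
  | cons a l ih =>
    have hl' : (l.length : ℕ∞) < n := by
      refine lt_of_lt_of_le ?_ hl
      rw [List.length_cons]
      exact_mod_cast Nat.lt_succ_self _
    rw [monomial_cons, ← hF.fderiv_fld hl' hp a]
    have : monomial l (F []) =ᶠ[𝓝 p] F l := by
      filter_upwards [isOpen_regular.mem_nhds hp] with q hq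
      exact ih hl'.le hq
    simp only [this.fderiv_eq]

lemma contDiffOn {k : ℕ} {l : List (Fin 2 ⊕ Fin m)} (hF : IsTower (l.length + k : ℕ) F)
    (hc : ∀ l' : List (Fin 2 ⊕ Fin m), l'.length = l.length + k →
      ContinuousOn (F l') {p | p.1 ≠ 0}) :
    ContDiffOn ℝ k (F l) {p | p.1 ≠ 0} := by
  induction k generalizing l with
  | zero => exact contDiffOn_zero.2 (hc l rfl)
  | succ k ih =>
    have hl : (l.length : ℕ∞) < ((l.length + (k + 1) : ℕ) : ℕ∞) := by
      exact_mod_cast (by omega : l.length < l.length + (k + 1))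
    have hd := hF l hl
    have h1 := (contDiffOn_succ_iff_fderiv_of_isOpen (𝕜 := ℝ) (f := F l) (n := (k : WithTop ℕ∞))
      (isOpen_regular (m := m))).2 ⟨?_, ?_, ?_⟩
    · exact_mod_cast h1
    · exact fun p hp => (hd p hp).differentiableAt.differentiableWithinAt
    · intro h; simp at h
    · have h2 : ContDiffOn ℝ k (fun p => ∑ a, F (a :: l) p • cof a p) {p : Cover m | p.1 ≠ 0} := by
        refine ContDiffOn.sum fun a _ => ?_
        have hFa : ContDiffOn ℝ k (F (a :: l)) {p : Cover m | p.1 ≠ 0} := by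
          refine ih (l := a :: l) ?_ ?_
          · convert hF using 2; simp; ring
          · intro l' hl'; exact hc l' (by simp at hl'; omega)
        exact hFa.smul (contDiffOn_cof a _)
      exact h2.congr fun p hp => (hd p hp).fderiv

lemma contDiffOn_infty (hF : IsTower ⊤ F) (l : List (Fin 2 ⊕ Fin m)) :
    ContDiffOn ℝ ((⊤ : ℕ∞) : WithTop ℕ∞) (F l) {p | p.1 ≠ 0} := by
  rw [_root_.contDiffOn_infty]
  intro k
  refine (hF.of_le le_top).contDiffOn fun l' _ p hp => ?_
  exact (hF l' (by simp) p hp).continuousAt.continuousWithinAt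

/-- Differentiation under the integral sign for towers. -/
lemma integral {X : Type*} [MeasurableSpace X] {μ : Measure X}
    {Φ : X → List (Fin 2 ⊕ Fin m) → Cover m → ℝ} (hΦ : ∀ᵐ x ∂μ, IsTower n (Φ x))
    (hmeas : ∀ l p, AEStronglyMeasurable (fun x => Φ x l p) μ)
    (hb : ∀ l : List (Fin 2 ⊕ Fin m), (l.length : ℕ∞) ≤ n → ∀ p₀ : Cover m, p₀.1 ≠ 0 →
      ∃ b : X → ℝ, Integrable b μ ∧ ∃ s ∈ 𝓝 p₀, ∀ᵐ x ∂μ, ∀ p ∈ s, |Φ x l p| ≤ b x) :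
    IsTower n fun l p => ∫ x, Φ x l p ∂μ := by
  intro l hl p₀ hp₀
  have h_int : ∀ l : List (Fin 2 ⊕ Fin m), (l.length : ℕ∞) ≤ n →
      Integrable (fun x => Φ x l p₀) μ := by
    intro l hl
    obtain ⟨b, hbi, s, hs, hbs⟩ := hb l hl p₀ hp₀
    exact hbi.mono' (hmeas l p₀) (hbs.mono fun x hx => hx p₀ (mem_of_mem_nhds hs))
  have hl' : ∀ a : Fin 2 ⊕ Fin m, ((a :: l).length : ℕ∞) ≤ n := fun a => by
    rw [List.length_cons]; exact_mod_cast Order.add_one_le_of_lt hl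
  choose b hbi s hs hbs using fun a : Fin 2 ⊕ Fin m => hb (a :: l) (hl' a) p₀ hp₀
  have hw : 0 < ‖p₀.1‖ := norm_pos_iff.2 hp₀
  -- A bound for the coframe on the neighbourhood where |w| > |w₀|/2; the coframe blows up at the
  -- singular set.
  set c : ℝ := 2 / (‖p₀.1‖ / 2) + 1 with hc
  have hc0 : 0 ≤ c := by positivity
  set S : Set (Cover m) := (⋂ a, s a) ∩ {p | ‖p₀.1‖ / 2 < ‖p.1‖} with hS
  have hSn : S ∈ 𝓝 p₀ := by
    refine inter_mem (iInter_mem.2 hs) ?_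
    exact (isOpen_lt continuous_const (by fun_prop)).mem_nhds (half_lt_self hw)
  have key := hasFDerivAt_integral_of_dominated_of_fderiv_le (μ := μ) (x₀ := p₀) (s := S)
    (F := fun p x => Φ x l p) (F' := fun p x => ∑ a, Φ x (a :: l) p • cof a p)
    (bound := fun x => ∑ a, b a x * c) hSn (Eventually.of_forall fun p => hmeas l p)
    (h_int l hl.le) ?_ ?_ ?_ ?_
  · rw [integral_finsetSum _ fun a _ => (h_int (a :: l) (hl' a)).smul_const _] at key
    simp only [integral_smul_const] at key
    exact key
  · refine Finset.aestronglyMeasurable_fun_sum _ fun a _ => ?_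
    exact (hmeas (a :: l) p₀).smul_const _
  · have h := (ae_all_iff (ι := Fin 2 ⊕ Fin m)).2 hbs
    filter_upwards [h] with x hx p hp
    refine (norm_sum_le _ _).trans (Finset.sum_le_sum fun a _ => ?_)
    rw [norm_smul]
    have h1 := hx a p (mem_iInter.1 hp.1 a)
    have h2 : ‖cof a p‖ ≤ c := by
      refine (norm_cof_le a p).trans ?_
      rw [hc]
      have : ‖p₀.1‖ / 2 ≤ ‖p.1‖ := le_of_lt hp.2
      gcongr
    exact mul_le_mul h1 h2 (norm_nonneg _) ((abs_nonneg _).trans h1)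
  · exact integrable_finsetSum _ fun a _ => (hbi a).mul_const _
  · filter_upwards [hΦ] with x hx p hp
    refine hx l hl p fun h0 => ?_
    have h1 : ‖p₀.1‖ / 2 < ‖p.1‖ := hp.2
    rw [h0, norm_zero] at h1
    linarith

end IsTower

/-! ### The heat operator at time one -/

lemma exists_pow_mul_gauss_le' (N : ℕ) {c : ℝ} (hc : 0 < c) : ∃ C, 0 < C ∧ ∀ x : ℝ, 0 ≤ x →
    (1 + x) ^ N * Real.exp (-(2 * c) * x ^ 2) ≤ C * Real.exp (-c * x ^ 2) := by
  obtain ⟨C, hC, h⟩ := exists_pow_mul_exp_le N hc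
  refine ⟨C, hC, fun x hx => ?_⟩
  calc (1 + x) ^ N * Real.exp (-(2 * c) * x ^ 2)
      = (1 + x) ^ N * Real.exp (-c * x ^ 2) * Real.exp (-c * x ^ 2) := by
        rw [mul_assoc, ← Real.exp_add]; ring_nf
    _ ≤ _ := mul_le_mul_of_nonneg_right (h x hx) (Real.exp_pos _).le

lemma one_add_le_mul (p q : Cover m) :
    1 + ‖q.1‖ ^ 2 ≤ (1 + ‖p.1‖ ^ 2) * (1 + baseDist p q) := by
  have h := norm_sq_le_add p q
  nlinarith [baseDist_nonneg p q, sq_nonneg ‖p.1‖,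
    mul_nonneg (sq_nonneg ‖p.1‖) (baseDist_nonneg p q)]

/-- One wider Gaussian centred at `p₀` dominates all those centred within distance 1 of it. The
shift of centre lowers 1/16 to 1/32, and absorbing the growth of `f` lowers it to 1/64. -/
lemma exists_dominating {k : Cover m → Cover m → ℝ} {C : ℝ} {N : ℕ} (hC : 0 ≤ C)
    (hk : ∀ p q, |k p q| ≤ C * (1 + ‖p.1‖ ^ 2) ^ N * Real.exp (-(1 / 16) * baseDist p q ^ 2))
    {f : Cover m → ℝ} {B : ℝ} (hB : 0 ≤ B) (hf : ∀ q, |f q| ≤ B * (1 + ‖q.1‖ ^ 2))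
    (p₀ : Cover m) : ∃ b : Cover m → ℝ, Integrable b (coverMeasure m) ∧
      ∃ s ∈ 𝓝 p₀, ∀ q, ∀ p ∈ s, |k p q * f q| ≤ b q := by
  obtain ⟨C', hC', h'⟩ := exists_pow_mul_gauss_le' 1 (c := 1 / 64) (by norm_num)
  refine ⟨fun q => C * (2 + ‖p₀.1‖ ^ 2) ^ N * Real.exp (1 / 16) * (B * (1 + ‖p₀.1‖ ^ 2)) * C' *
    Real.exp (-(1 / 64) * baseDist p₀ q ^ 2),
    (integrable_exp_neg_baseDist (by norm_num) p₀).const_mul _, {p | baseDist p p₀ < 1},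
    (isOpen_lt (continuous_baseDist_left p₀) continuous_const).mem_nhds (by simp [baseDist]),
    fun q p hp => ?_⟩
  have hp : baseDist p p₀ < 1 := hp
  have hD := baseDist_nonneg p₀ q
  have hD' := baseDist_nonneg p q
  have h1 : 1 + ‖p.1‖ ^ 2 ≤ 2 + ‖p₀.1‖ ^ 2 := by
    have := norm_sq_le_add p₀ p
    rw [baseDist_comm] at this; linarith
  have h2 : Real.exp (-(1 / 16) * baseDist p q ^ 2) ≤
      Real.exp (1 / 16) * Real.exp (-(1 / 32) * baseDist p₀ q ^ 2) := by
    rw [← Real.exp_add]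
    apply Real.exp_le_exp.2
    have := baseDist_triangle p₀ p q
    rw [baseDist_comm p₀ p] at this
    -- Squaring gives D₀² ≤ 2 + 2D², so -D²/16 ≤ 1/16 - D₀²/32.
    have h3 : baseDist p₀ q ≤ 1 + baseDist p q := by linarith
    nlinarith [sq_nonneg (baseDist p q - 1), pow_le_pow_left₀ hD h3 2]
  have h3 : |f q| ≤ B * (1 + ‖p₀.1‖ ^ 2) * (1 + baseDist p₀ q) := by
    refine (hf q).trans ?_
    rw [mul_assoc]
    exact mul_le_mul_of_nonneg_left (one_add_le_mul p₀ q) hB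
  have h4 := h' _ hD
  rw [pow_one, show (2 * (1 / 64) : ℝ) = 1 / 32 by norm_num] at h4
  rw [abs_mul]
  calc |k p q| * |f q|
      ≤ (C * (2 + ‖p₀.1‖ ^ 2) ^ N *
          (Real.exp (1 / 16) * Real.exp (-(1 / 32) * baseDist p₀ q ^ 2))) *
          (B * (1 + ‖p₀.1‖ ^ 2) * (1 + baseDist p₀ q)) := by
        refine mul_le_mul ((hk p q).trans ?_) h3 (abs_nonneg _) (by positivity)
        gcongr
    _ = C * (2 + ‖p₀.1‖ ^ 2) ^ N * Real.exp (1 / 16) * (B * (1 + ‖p₀.1‖ ^ 2)) *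
          ((1 + baseDist p₀ q) * Real.exp (-(1 / 32) * baseDist p₀ q ^ 2)) := by ring
    _ ≤ C * (2 + ‖p₀.1‖ ^ 2) ^ N * Real.exp (1 / 16) * (B * (1 + ‖p₀.1‖ ^ 2)) *
          (C' * Real.exp (-(1 / 64) * baseDist p₀ q ^ 2)) :=
        mul_le_mul_of_nonneg_left h4 (by positivity)
    _ = _ := by ring

lemma continuous_kerL_right (l : List (Fin 2 ⊕ Fin m)) (p : Cover m) :
    Continuous fun q => kerL l p q :=
  (contDiff_kerL l).continuous.comp (Continuous.prodMk continuous_const continuous_id)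

lemma continuous_gkL_right (l : List (Fin 2 ⊕ Fin m)) (p : Cover m) :
    Continuous fun q => gkL l p q :=
  (contDiff_gkL l).continuous.comp (Continuous.prodMk continuous_const continuous_id)

lemma isTower_kerL (q : Cover m) (c : ℝ) : IsTower ⊤ fun l p => kerL l p q * c := by
  intro l _ p hp
  have h := ((differentiable_kerL l q p).hasFDerivAt).mul_const c
  rw [eq_sum_cof hp (fderiv ℝ (fun p => kerL l p q) p)] at h
  refine h.congr_fderiv ?_
  rw [Finset.smul_sum]
  refine Finset.sum_congr rfl fun a _ => ?_
  rw [smul_smul, mul_comm, ← kerL_cons]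

lemma isTower_gkL (q : Cover m) (c : ℝ) : IsTower ⊤ fun l p => gkL l p q * c := by
  intro l _ p hp
  have h := ((differentiable_gkL l q p).hasFDerivAt).mul_const c
  rw [eq_sum_cof hp (fderiv ℝ (fun p => gkL l p q) p)] at h
  refine h.congr_fderiv ?_
  rw [Finset.smul_sum]
  refine Finset.sum_congr rfl fun a _ => ?_
  rw [smul_smul, mul_comm, ← gkL_cons]

section Growth

variable {f : Cover m → ℝ} {B : ℝ}

lemma integrable_kerL_mul (l : List (Fin 2 ⊕ Fin m)) (hfm : Measurable f) (hB : 0 ≤ B)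
    (hf : ∀ q, |f q| ≤ B * (1 + ‖q.1‖ ^ 2)) (p : Cover m) :
    Integrable (fun q => kerL l p q * f q) (coverMeasure m) := by
  obtain ⟨C, hC, h⟩ := exists_kerL_le l
  obtain ⟨b, hbi, s, hs, hbs⟩ := exists_dominating hC.le h hB hf p
  exact hbi.mono' ((continuous_kerL_right l p).measurable.mul hfm).aestronglyMeasurable
    (Eventually.of_forall fun q => hbs q p (mem_of_mem_nhds hs))

lemma isTower_integral_kerL (hfm : Measurable f) (hB : 0 ≤ B)
    (hf : ∀ q, |f q| ≤ B * (1 + ‖q.1‖ ^ 2)) :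
    IsTower ⊤ fun l p => ∫ q, kerL l p q * f q ∂(coverMeasure m) := by
  refine IsTower.integral (Φ := fun q l p => kerL l p q * f q)
    (Eventually.of_forall fun q => isTower_kerL q (f q)) (fun l p =>
      ((continuous_kerL_right l p).measurable.mul hfm).aestronglyMeasurable) fun l _ p₀ _ => ?_
  obtain ⟨C, hC, h⟩ := exists_kerL_le l
  obtain ⟨b, hbi, s, hs, hbs⟩ := exists_dominating hC.le h hB hf p₀
  exact ⟨b, hbi, s, hs, Eventually.of_forall hbs⟩

end Growth

/-! ### Cancellation for the Gaussian of the base. -/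

lemma monomial_const (c : ℝ) {l : List (Fin 2 ⊕ Fin m)} (hl : l ≠ []) :
    monomial l (fun _ : Cover m => c) = fun _ => 0 := by
  induction l with
  | nil => exact absurd rfl hl
  | cons a l ih =>
    rw [monomial_cons]
    rcases eq_or_ne l [] with rfl | h
    · funext p
      change fderiv ℝ (fun _ : Cover m => c) p (fld a p) = 0
      simp
    · rw [ih h]; simp

lemma integrable_gkL (l : List (Fin 2 ⊕ Fin m)) (p : Cover m) :
    Integrable (fun q => gkL l p q) (coverMeasure m) := by
  obtain ⟨C, hC, h⟩ := exists_gkL_le l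
  exact ((integrable_exp_neg_baseDist (by norm_num) p).const_mul _).mono'
    (continuous_gkL_right l p).aestronglyMeasurable (Eventually.of_forall (h p))

lemma integral_gkL_nil (p : Cover m) :
    ∫ q, gkL [] p q ∂(coverMeasure m) = gaussMass m (1 / 4) := by
  simp_rw [gkL_nil, gk_eq]
  exact integral_exp_neg_baseDist (by norm_num) p

/-- Derivatives of the Gaussian of the base have integral zero. -/
lemma integral_gkL {l : List (Fin 2 ⊕ Fin m)} (hl : l ≠ []) {p : Cover m} (hp : p.1 ≠ 0) :
    ∫ q, gkL l p q ∂(coverMeasure m) = 0 := by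
  have ht : IsTower ⊤ fun l p => ∫ q, gkL l p q * (1 : ℝ) ∂(coverMeasure m) := by
    refine IsTower.integral (Φ := fun q l p => gkL l p q * (1 : ℝ))
      (Eventually.of_forall fun q => isTower_gkL q 1) (fun l p => by
        simpa using (continuous_gkL_right l p).aestronglyMeasurable) fun l _ p₀ _ => ?_
    obtain ⟨C, hC, h⟩ := exists_gkL_le l
    obtain ⟨b, hbi, s, hs, hbs⟩ := exists_dominating hC.le h (f := fun _ => 1) zero_le_one
      (fun q => by simp) p₀
    exact ⟨b, hbi, s, hs, Eventually.of_forall hbs⟩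
  have h := ht.monomial_eq l le_top hp
  simp only [mul_one] at h
  -- The total mass of the Gaussian does not depend on its centre, so differentiating under the
  -- integral yields zero.
  rw [← h]
  simp_rw [integral_gkL_nil]
  rw [monomial_const _ hl]

/-! ### Bounds for the heat operator on Hölder sections. -/

/-- The tower of derivatives of the heat operator at time one. -/
def heat (f : Cover m → ℝ) (l : List (Fin 2 ⊕ Fin m)) (p : Cover m) : ℝ :=
  (gaussMass m (1 / 4))⁻¹ * ∫ q, kerL l p q * f q ∂(coverMeasure m)

lemma IsTower.const_mul {n : ℕ∞} {F : List (Fin 2 ⊕ Fin m) → Cover m → ℝ} (hF : IsTower n F)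
    (c : ℝ) : IsTower n fun l p => c * F l p := by
  intro l hl p hp
  refine ((hF l hl p hp).const_mul c).congr_fderiv ?_
  rw [Finset.smul_sum]
  exact Finset.sum_congr rfl fun a _ => smul_smul _ _ _

lemma rpow_le_one_add {x α : ℝ} (hx : 0 ≤ x) (hα : 0 < α) (hα1 : α ≤ 1) : x ^ α ≤ 1 + x :=
  calc x ^ α ≤ (1 + x) ^ α := by gcongr; linarith
    _ ≤ (1 + x) ^ (1 : ℝ) := Real.rpow_le_rpow_of_exponent_le (by linarith) hα1
    _ = _ := Real.rpow_one _

lemma HolderBound.abs_le_growth {α A : ℝ} (hα : 0 < α) (hα1 : α ≤ 1) (hA : 0 ≤ A)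
    {f : Cover m → ℝ} (hf : IsSection f) (h : HolderBound α A f) (q : Cover m) :
    |f q| ≤ 8 * A * (1 + ‖q.1‖ ^ 2) :=
  (h.abs_le hα hA hf q).trans (mul_le_mul_of_nonneg_left
    (rpow_le_one_add (by positivity) hα hα1) (by positivity))

lemma isTower_heat {α A : ℝ} (hα : 0 < α) (hα1 : α ≤ 1) (hA : 0 ≤ A)
    {f : Cover m → ℝ} (hf : IsSection f) (h : HolderBound α A f) : IsTower ⊤ (heat f) :=
  (isTower_integral_kerL (h.continuous hα hα1 hA hf).measurable (by positivity)
    (h.abs_le_growth hα hα1 hA hf)).const_mul _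

/-- The heat operator applied to a Hölder section vanishes at the singular set. -/
lemma exists_heat_le_norm {α : ℝ} (hα : 0 < α) (hα1 : α ≤ 1) (l : List (Fin 2 ⊕ Fin m)) :
    ∃ C, 0 < C ∧ ∀ (A : ℝ) (f : Cover m → ℝ), 0 ≤ A → IsSection f → HolderBound α A f →
      ∀ p, |heat f l p| ≤ C * A * ‖p.1‖ * (1 + ‖p.1‖ ^ 2) ^ (wtL l + 2) := by
  obtain ⟨C, hC, h⟩ := exists_kerL_le_mul l
  obtain ⟨C', hC', h'⟩ := exists_pow_mul_gauss_le' 2 (c := 1 / 32) (by norm_num)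
  have hM := gaussMass_pos (m := m) (c := 1 / 4) (by norm_num)
  have hM' := gaussMass_pos (m := m) (c := 1 / 32) (by norm_num)
  refine ⟨(gaussMass m (1 / 4))⁻¹ * (C * 8 * C' * gaussMass m (1 / 32)), by positivity,
    fun A f hA hf hH p => ?_⟩
  have hb : ∀ q, |kerL l p q * f q| ≤ (C * 8 * C' * A * ‖p.1‖ * (1 + ‖p.1‖ ^ 2) ^ (wtL l + 2)) *
      Real.exp (-(1 / 32) * baseDist p q ^ 2) := by
    intro q
    have hD := baseDist_nonneg p q
    have h1 := hH.abs_le_growth hα hα1 hA hf q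
    have h2 : ‖q.1‖ ≤ 1 + ‖q.1‖ ^ 2 := by nlinarith [sq_nonneg (‖q.1‖ - 1)]
    have h3 := h' _ hD
    rw [show (2 * (1 / 32) : ℝ) = 1 / 16 by norm_num] at h3
    have h4 : (1 + ‖q.1‖ ^ 2) ^ 2 ≤ (1 + ‖p.1‖ ^ 2) ^ 2 * (1 + baseDist p q) ^ 2 := by
      rw [← mul_pow]; exact pow_le_pow_left₀ (by positivity) (one_add_le_mul p q) 2
    rw [abs_mul]
    calc |kerL l p q| * |f q|
        ≤ (C * (‖p.1‖ * (1 + ‖q.1‖ ^ 2)) * (1 + ‖p.1‖ ^ 2) ^ wtL l *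
            Real.exp (-(1 / 16) * baseDist p q ^ 2)) * (8 * A * (1 + ‖q.1‖ ^ 2)) := by
          refine mul_le_mul ((h p q).trans ?_) h1 (abs_nonneg _) (by positivity)
          gcongr
      _ = C * 8 * A * ‖p.1‖ * (1 + ‖p.1‖ ^ 2) ^ wtL l * Real.exp (-(1 / 16) * baseDist p q ^ 2) *
            (1 + ‖q.1‖ ^ 2) ^ 2 := by ring
      _ ≤ C * 8 * A * ‖p.1‖ * (1 + ‖p.1‖ ^ 2) ^ wtL l * Real.exp (-(1 / 16) * baseDist p q ^ 2) *
            ((1 + ‖p.1‖ ^ 2) ^ 2 * (1 + baseDist p q) ^ 2) :=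
          mul_le_mul_of_nonneg_left h4 (by positivity)
      _ = C * 8 * A * ‖p.1‖ * (1 + ‖p.1‖ ^ 2) ^ (wtL l + 2) *
            ((1 + baseDist p q) ^ 2 * Real.exp (-(1 / 16) * baseDist p q ^ 2)) := by
          rw [pow_add]; ring
      _ ≤ C * 8 * A * ‖p.1‖ * (1 + ‖p.1‖ ^ 2) ^ (wtL l + 2) *
            (C' * Real.exp (-(1 / 32) * baseDist p q ^ 2)) :=
          mul_le_mul_of_nonneg_left h3 (by positivity)
      _ = _ := by ring
  have h1 := norm_integral_le_of_norm_le (f := fun q => kerL l p q * f q)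
    ((integrable_exp_neg_baseDist (by norm_num : (0 : ℝ) < 1 / 32) p).const_mul _)
    (Eventually.of_forall hb)
  rw [integral_const_mul, integral_exp_neg_baseDist (by norm_num), Real.norm_eq_abs] at h1
  rw [heat, abs_mul, abs_of_pos (by positivity)]
  refine (mul_le_mul_of_nonneg_left h1 (by positivity)).trans_eq ?_
  ring

/-- Comparison of the heat operator applied to a Hölder section with the Gaussian of the base. -/
lemma exists_integral_kerL_sub_le {α : ℝ} (hα : 0 < α) (hα1 : α ≤ 1)
    (l : List (Fin 2 ⊕ Fin m)) :
    ∃ C, 0 < C ∧ ∀ (A : ℝ) (f : Cover m → ℝ), 0 ≤ A → IsSection f → HolderBound α A f →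
      ∀ p : Cover m, p.1 ≠ 0 → |∫ q, kerL l p q * f q ∂(coverMeasure m) -
        f p * ∫ q, gkL l p q ∂(coverMeasure m)| ≤ C * A * (1 + ‖p.1‖ ^ 2) ^ wtL l := by
  obtain ⟨C₁, hC₁, h₁⟩ := exists_kerL_le l
  obtain ⟨C₂, hC₂, h₂⟩ := exists_kerL_sub_gkL_le l
  obtain ⟨C₃, hC₃, h₃⟩ := exists_pow_mul_gauss_le' 1 (c := 1 / 32) (by norm_num)
  obtain ⟨C₄, hC₄, h₄⟩ := exists_pow_mul_exp_le 1 (c := 1 / 16) (by norm_num)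
  have hM' := gaussMass_pos (m := m) (c := 1 / 32) (by norm_num)
  refine ⟨(C₁ * 72 * C₃ + 8 * C₄ * C₂) * gaussMass m (1 / 32), by positivity,
    fun A f hA hf hH p hp => ?_⟩
  set X := (1 + ‖p.1‖ ^ 2) ^ wtL l with hX
  have hX1 : 1 ≤ X := one_le_pow₀ (by nlinarith [sq_nonneg ‖p.1‖])
  have hb : ∀ q, |kerL l p q * f q - f p * gkL l p q| ≤
      ((C₁ * 72 * C₃ + 8 * C₄ * C₂) * A * X) * Real.exp (-(1 / 32) * baseDist p q ^ 2) := by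
    intro q
    have hD := baseDist_nonneg p q
    have e1 := hH.abs_sub_le hα hα1 hA hf hp q
    have e2 := hH.abs_le_growth hα hα1 hA hf p
    have e3 := h₃ _ hD
    rw [pow_one, show (2 * (1 / 32) : ℝ) = 1 / 16 by norm_num] at e3
    have e4 := h₄ (‖p.1‖ ^ 2) (by positivity)
    rw [pow_one] at e4
    have e5 : Real.exp (-(1 / 16) * baseDist p q ^ 2) ≤
        Real.exp (-(1 / 32) * baseDist p q ^ 2) := by
      apply Real.exp_le_exp.2; nlinarith [sq_nonneg (baseDist p q)]
    -- Here the Hölder bound of `f` enters, at the cost of a power of the distance absorbed by the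
    -- Gaussian.
    have s1 : |kerL l p q * (f q - crossSign p q * f p)| ≤
        C₁ * 72 * C₃ * A * X * Real.exp (-(1 / 32) * baseDist p q ^ 2) := by
      rw [abs_mul]
      calc _ ≤ (C₁ * X * Real.exp (-(1 / 16) * baseDist p q ^ 2)) *
            (72 * A * (1 + baseDist p q)) :=
            mul_le_mul (h₁ p q) (e1.trans (mul_le_mul_of_nonneg_left
              (rpow_le_one_add hD hα hα1) (by positivity))) (abs_nonneg _) (by positivity)
        _ = C₁ * 72 * A * X * ((1 + baseDist p q) * Real.exp (-(1 / 16) * baseDist p q ^ 2)) := by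
            ring
        _ ≤ C₁ * 72 * A * X * (C₃ * Real.exp (-(1 / 32) * baseDist p q ^ 2)) :=
            mul_le_mul_of_nonneg_left e3 (by positivity)
        _ = _ := by ring
    -- The value f(p) may grow with |z|, but the difference between the kernel and the Gaussian
    -- decays in |z|. The resulting bound does not see this growth.
    have s2 : |f p * (kerL l p q * crossSign p q - gkL l p q)| ≤
        8 * C₄ * C₂ * A * X * Real.exp (-(1 / 32) * baseDist p q ^ 2) := by
      rw [abs_mul]
      calc _ ≤ (8 * A * (1 + ‖p.1‖ ^ 2)) * (C₂ * Real.exp (-(1 / 16) * (‖p.1‖ ^ 2) ^ 2) *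
            Real.exp (-(1 / 16) * baseDist p q ^ 2)) :=
            mul_le_mul e2 (h₂ p q) (abs_nonneg _) (by positivity)
        _ = 8 * A * C₂ * Real.exp (-(1 / 16) * baseDist p q ^ 2) *
            ((1 + ‖p.1‖ ^ 2) * Real.exp (-(1 / 16) * (‖p.1‖ ^ 2) ^ 2)) := by ring
        _ ≤ 8 * A * C₂ * Real.exp (-(1 / 32) * baseDist p q ^ 2) * C₄ := by gcongr
        _ = 8 * C₄ * C₂ * A * 1 * Real.exp (-(1 / 32) * baseDist p q ^ 2) := by ring
        _ ≤ _ := by gcongr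
    calc _ = |kerL l p q * (f q - crossSign p q * f p) +
          f p * (kerL l p q * crossSign p q - gkL l p q)| := by congr 1; ring
      _ ≤ _ := (abs_add_le _ _).trans (add_le_add s1 s2)
      _ = _ := by ring
  have hi := integrable_kerL_mul l (hH.continuous hα hα1 hA hf).measurable (by positivity)
    (hH.abs_le_growth hα hα1 hA hf) p
  have h1 := norm_integral_le_of_norm_le (f := fun q => kerL l p q * f q - f p * gkL l p q)
    ((integrable_exp_neg_baseDist (by norm_num : (0 : ℝ) < 1 / 32) p).const_mul _)
    (Eventually.of_forall hb)
  rw [integral_const_mul, integral_exp_neg_baseDist (by norm_num), Real.norm_eq_abs,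
    integral_sub hi ((integrable_gkL l p).const_mul _), integral_const_mul] at h1
  refine h1.trans_eq ?_
  ring

/-- The derivatives of the Gaussian have integral zero, so the term with f(p) in the comparison
drops out and only the oscillation of `f` remains. -/
lemma exists_heat_le {α : ℝ} (hα : 0 < α) (hα1 : α ≤ 1) {l : List (Fin 2 ⊕ Fin m)}
    (hl : l ≠ []) :
    ∃ C, 0 < C ∧ ∀ (A : ℝ) (f : Cover m → ℝ), 0 ≤ A → IsSection f → HolderBound α A f →
      ∀ p : Cover m, p.1 ≠ 0 → |heat f l p| ≤ C * A * (1 + ‖p.1‖ ^ 2) ^ wtL l := by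
  obtain ⟨C, hC, h⟩ := exists_integral_kerL_sub_le hα hα1 l
  have hM := gaussMass_pos (m := m) (c := 1 / 4) (by norm_num)
  refine ⟨(gaussMass m (1 / 4))⁻¹ * C, by positivity, fun A f hA hf hH p hp => ?_⟩
  have h1 := h A f hA hf hH p hp
  rw [integral_gkL hl hp, mul_zero, sub_zero] at h1
  rw [heat, abs_mul, abs_of_pos (by positivity)]
  refine (mul_le_mul_of_nonneg_left h1 (by positivity)).trans_eq ?_
  ring

lemma exists_heat_sub_le {α : ℝ} (hα : 0 < α) (hα1 : α ≤ 1) :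
    ∃ C, 0 < C ∧ ∀ (A : ℝ) (f : Cover m → ℝ), 0 ≤ A → IsSection f → HolderBound α A f →
      ∀ p : Cover m, p.1 ≠ 0 → |heat f [] p - f p| ≤ C * A := by
  obtain ⟨C, hC, h⟩ := exists_integral_kerL_sub_le (m := m) hα hα1 []
  have hM := gaussMass_pos (m := m) (c := 1 / 4) (by norm_num)
  refine ⟨(gaussMass m (1 / 4))⁻¹ * C, by positivity, fun A f hA hf hH p hp => ?_⟩
  have h1 := h A f hA hf hH p hp
  rw [integral_gkL_nil] at h1
  have h2 : heat f [] p - f p = (gaussMass m (1 / 4))⁻¹ *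
      (∫ q, kerL [] p q * f q ∂(coverMeasure m) - f p * gaussMass m (1 / 4)) := by
    rw [heat]; field_simp
  rw [h2, abs_mul, abs_of_pos (by positivity)]
  refine (mul_le_mul_of_nonneg_left h1 (by positivity)).trans_eq ?_
  simp [wtL]; ring

/-! ### The heat flow -/

/-- The indicator of the fields `∂/∂tᵢ`. -/
def nt : Fin 2 ⊕ Fin m → ℕ
  | Sum.inl _ => 0
  | Sum.inr _ => 1

/-- The number of `∂/∂tᵢ` in a list of tangential fields. -/
def ntL (l : List (Fin 2 ⊕ Fin m)) : ℕ := (l.map nt).sum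

lemma ntL_cons (a : Fin 2 ⊕ Fin m) (l) : ntL (a :: l) = nt a + ntL l := by simp [ntL]

lemma wt_add_nt (a : Fin 2 ⊕ Fin m) : wt a + nt a = 1 := by
  match a with
  | Sum.inl _ => rfl
  | Sum.inr _ => rfl

lemma wtL_add_ntL (l : List (Fin 2 ⊕ Fin m)) : wtL l + ntL l = l.length := by
  induction l with
  | nil => rfl
  | cons a l ih =>
    rw [wtL_cons, ntL_cons, List.length_cons, ← ih, ← wt_add_nt a]; ring

/-- `dil a` as a continuous linear map. -/
def dilL (a : ℝ) : Cover m →L[ℝ] Cover m :=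
  (a • ContinuousLinearMap.fst ℝ _ _).prod (a ^ 2 • ContinuousLinearMap.snd ℝ _ _)

lemma dilL_apply (a : ℝ) (p : Cover m) : dilL a p = dil a p := rfl

/-- r∂_r and ∂_θ commute with dilations and only the ∂_{t_i} scale; hence the exponent `ntL` in the
rescaled towers. -/
lemma cof_dil {b : ℝ} (hb : b ≠ 0) (a : Fin 2 ⊕ Fin m) (p v : Cover m) :
    cof a (dil b p) (dil b v) = (b ^ 2) ^ nt a * cof a p v := by
  have hb' : (b : ℂ) ≠ 0 := Complex.ofReal_ne_zero.2 hb
  have h : 2 / (dil b p).1 * (dil b v).1 = 2 / p.1 * v.1 := by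
    simp only [dil, Complex.real_smul]
    rcases eq_or_ne p.1 0 with h0 | h0
    · simp [h0]
    · field_simp
  match a with
  | Sum.inl 0 => rw [cof_inl_zero, cof_inl_zero, h]; simp [nt]
  | Sum.inl 1 => rw [cof_inl_one, cof_inl_one, h]; simp [nt]
  | Sum.inr i => rw [cof_inr, cof_inr]; simp [nt, dil]

lemma IsTower.comp_dil {n : ℕ∞} {F : List (Fin 2 ⊕ Fin m) → Cover m → ℝ} (hF : IsTower n F)
    {b : ℝ} (hb : b ≠ 0) : IsTower n fun l p => (b ^ 2) ^ ntL l * F l (dil b p) := by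
  intro l hl p hp
  have hp' : (dil b p).1 ≠ 0 := smul_ne_zero hb hp
  have h := ((hF l hl (dil b p) hp').comp p (dilL b).hasFDerivAt).const_mul ((b ^ 2) ^ ntL l)
  refine h.congr_fderiv ?_
  refine ContinuousLinearMap.ext fun v => ?_
  simp only [ContinuousLinearMap.comp_apply, smul_apply, sum_apply, smul_eq_mul, dilL_apply,
    Finset.mul_sum, cof_dil hb, ntL_cons, pow_add]
  exact Finset.sum_congr rfl fun a _ => by ring

/-- The derivatives along tangential fields of the heat flow of `ρ` at time `s`. -/
def flow (ρ : Cover m → ℝ) (l : List (Fin 2 ⊕ Fin m)) (s : ℝ) (p : Cover m) : ℝ :=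
  -- The base is scaled by √s, so the coordinate w on the double cover is scaled by √√s.
  ((√√s)⁻¹ ^ 2) ^ ntL l * heat (fun q => ρ (dil (√√s) q)) l (dil (√√s)⁻¹ p)

section

variable {α A s : ℝ} {ρ : Cover m → ℝ}

lemma isTower_flow (hα : 0 < α) (hα1 : α ≤ 1) (hA : 0 ≤ A) (hρ : IsSection ρ)
    (h : HolderBound α A ρ) (hs : 0 < s) : IsTower ⊤ fun l p => flow ρ l s p := by
  have ha : 0 < √√s := Real.sqrt_pos.2 (Real.sqrt_pos.2 hs)
  exact (isTower_heat hα hα1 (by positivity) hρ.comp_dil (h.comp_dil ha)).comp_dil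
    (inv_ne_zero ha.ne')

lemma sq_sqrt_sqrt : (√√s) ^ 2 = √s := Real.sq_sqrt (Real.sqrt_nonneg _)

lemma norm_sq_dil_inv (p : Cover m) :
    ‖(dil (√√s)⁻¹ p).1‖ ^ 2 = ‖p.1‖ ^ 2 / √s := by
  rw [norm_dil_fst (by positivity), mul_pow, inv_pow, sq_sqrt_sqrt]; field_simp

lemma dil_inv_fst_ne_zero (hs : 0 < s) {p : Cover m} (hp : p.1 ≠ 0) :
    (dil (√√s)⁻¹ p).1 ≠ 0 := by
  have ha : 0 < √√s := Real.sqrt_pos.2 (Real.sqrt_pos.2 hs)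
  exact smul_ne_zero (inv_ne_zero ha.ne') hp

end

/-! ### Bounds for the heat flow at all times. -/

/-- The bound at time one after rescaling: the Hölder constant gains √s^α and |z| becomes |z|/√s.
The powers of √s combine because `wtL` and `ntL` add up to the length of the list. -/
lemma exists_flow_le {α : ℝ} (hα : 0 < α) (hα1 : α ≤ 1) {l : List (Fin 2 ⊕ Fin m)}
    (hl : l ≠ []) :
    ∃ C, 0 < C ∧ ∀ (A : ℝ) (ρ : Cover m → ℝ), 0 ≤ A → IsSection ρ → HolderBound α A ρ →
      ∀ s, 0 < s → ∀ p : Cover m, p.1 ≠ 0 → |flow ρ l s p| ≤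
        C * A * √s ^ α * (√s ^ l.length)⁻¹ * (√s + ‖p.1‖ ^ 2) ^ wtL l := by
  obtain ⟨C, hC, h⟩ := exists_heat_le hα hα1 hl
  refine ⟨C, hC, fun A ρ hA hρ hH s hs p hp => ?_⟩
  have hσ : 0 < √s := Real.sqrt_pos.2 hs
  have ha : 0 < √√s := Real.sqrt_pos.2 hσ
  have h1 := h _ _ (by positivity) hρ.comp_dil (hH.comp_dil ha) _ (dil_inv_fst_ne_zero hs hp)
  rw [norm_sq_dil_inv, sq_sqrt_sqrt] at h1
  rw [flow, abs_mul, inv_pow, sq_sqrt_sqrt, abs_of_pos (by positivity)]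
  refine (mul_le_mul_of_nonneg_left h1 (by positivity)).trans_eq ?_
  have h2 : 1 + ‖p.1‖ ^ 2 / √s = (√s + ‖p.1‖ ^ 2) / √s := by field_simp
  rw [h2, div_pow, ← wtL_add_ntL, pow_add, mul_inv, inv_pow]
  field_simp

/-- The factor |w|/√√s improves on `exists_flow_le` in the region |z| ≤ √s, where the flow behaves
like r^{1/2}. -/
lemma exists_flow_le_norm {α : ℝ} (hα : 0 < α) (hα1 : α ≤ 1) (l : List (Fin 2 ⊕ Fin m)) :
    ∃ C, 0 < C ∧ ∀ (A : ℝ) (ρ : Cover m → ℝ), 0 ≤ A → IsSection ρ → HolderBound α A ρ →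
      ∀ s, 0 < s → ∀ p : Cover m, |flow ρ l s p| ≤
        C * A * √s ^ α * (√s ^ ntL l)⁻¹ * (‖p.1‖ * (√√s)⁻¹) *
          (1 + ‖p.1‖ ^ 2 / √s) ^ (wtL l + 2) := by
  obtain ⟨C, hC, h⟩ := exists_heat_le_norm hα hα1 l
  refine ⟨C, hC, fun A ρ hA hρ hH s hs p => ?_⟩
  have hσ : 0 < √s := Real.sqrt_pos.2 hs
  have ha : 0 < √√s := Real.sqrt_pos.2 hσ
  have h1 := h _ _ (by positivity) hρ.comp_dil (hH.comp_dil ha) (dil (√√s)⁻¹ p)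
  rw [norm_sq_dil_inv, sq_sqrt_sqrt, norm_dil_fst (by positivity)] at h1
  rw [flow, abs_mul, inv_pow, sq_sqrt_sqrt, abs_of_pos (by positivity)]
  refine (mul_le_mul_of_nonneg_left h1 (by positivity)).trans_eq ?_
  rw [inv_pow]; ring

lemma exists_flow_sub_le {α : ℝ} (hα : 0 < α) (hα1 : α ≤ 1) :
    ∃ C, 0 < C ∧ ∀ (A : ℝ) (ρ : Cover m → ℝ), 0 ≤ A → IsSection ρ → HolderBound α A ρ →
      ∀ s, 0 < s → ∀ p : Cover m, p.1 ≠ 0 → |flow ρ [] s p - ρ p| ≤ C * A * √s ^ α := by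
  obtain ⟨C, hC, h⟩ := exists_heat_sub_le (m := m) hα hα1
  refine ⟨C, hC, fun A ρ hA hρ hH s hs p hp => ?_⟩
  have hσ : 0 < √s := Real.sqrt_pos.2 hs
  have ha : 0 < √√s := Real.sqrt_pos.2 hσ
  have h1 := h _ _ (by positivity) hρ.comp_dil (hH.comp_dil ha) _ (dil_inv_fst_ne_zero hs hp)
  simp only [dil_dil_inv ha.ne', sq_sqrt_sqrt] at h1
  simpa [flow, ntL, mul_assoc] using h1

/-- The heat flow as an integral operator on the unscaled source. -/
lemma flow_eq (ρ : Cover m → ℝ) (l : List (Fin 2 ⊕ Fin m)) {s : ℝ} (hs : 0 < s) (p : Cover m) :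
    flow ρ l s p = (gaussMass m (1 / 4))⁻¹ * ((√s ^ (m + 2 + ntL l))⁻¹ *
      ∫ q, kerL l (dil (√√s)⁻¹ p) (dil (√√s)⁻¹ q) * ρ q ∂(coverMeasure m)) := by
  have hσ : 0 < √s := Real.sqrt_pos.2 hs
  have ha : 0 < √√s := Real.sqrt_pos.2 hσ
  have h := integral_comp_dil ha
    (fun q : Cover m => kerL l (dil (√√s)⁻¹ p) (dil (√√s)⁻¹ q) * ρ q)
  simp only [dil_inv_dil ha.ne'] at h
  rw [flow, heat, h, inv_pow, sq_sqrt_sqrt, show 4 + 2 * m = 2 * (m + 2) by ring, pow_mul,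
    sq_sqrt_sqrt, pow_add _ (m + 2), mul_inv, inv_pow]
  ring

/-- Chebyshev's inequality for an integrable Gaussian that is at least e⁻¹ on the unit ball. -/
lemma coverMeasure_unit_lt_top :
    coverMeasure m (proj ⁻¹' Metric.closedBall (0 : Base m) 1) < ⊤ := by
  have hsub : (proj ⁻¹' Metric.closedBall (0 : Base m) 1 : Set (Cover m)) ⊆
      {q | baseDist 0 q ≤ 1} := by
    intro q hq
    have h0 : proj (0 : Cover m) = 0 := by simp [proj]
    simpa [baseDist, h0, dist_comm] using hq
  refine (measure_mono hsub).trans_lt ?_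
  have hi := integrable_exp_neg_baseDist (m := m) (c := 1) one_pos 0
  have h2 := hi.measure_ge_lt_top (ε := Real.exp (-1)) (Real.exp_pos _)
  refine (measure_mono ?_).trans_lt h2
  intro q hq
  have hq : baseDist 0 q ≤ 1 := hq
  apply Real.exp_le_exp.2
  nlinarith [baseDist_nonneg 0 q]

/-- The norm of the projection to the base. -/
def baseNorm (p : Cover m) : ℝ := ‖proj p‖

lemma baseNorm_nonneg (p : Cover m) : 0 ≤ baseNorm p := norm_nonneg _

lemma norm_sq_le_baseNorm (p : Cover m) : ‖p.1‖ ^ 2 ≤ baseNorm p := by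
  have h := norm_sq_le_add (0 : Cover m) p
  have h0 : proj (0 : Cover m) = 0 := by simp [proj]
  simpa [baseDist, h0, baseNorm] using h

lemma norm_snd_le_baseNorm (p : Cover m) : ‖p.2‖ ≤ baseNorm p := by
  have h := norm_snd_sub_le p (0 : Cover m)
  have h0 : proj (0 : Cover m) = 0 := by simp [proj]
  simpa [baseDist, h0, baseNorm] using h

/-- Decay of the heat flow of a compactly supported section for large times and far away. -/
lemma exists_flow_le_decay {α : ℝ} (hα : 0 < α) (l : List (Fin 2 ⊕ Fin m)) :
    ∃ C, 0 < C ∧ ∀ (A : ℝ) (ρ : Cover m → ℝ), 0 ≤ A → IsSection ρ → HolderBound α A ρ →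
      tsupport ρ ⊆ proj ⁻¹' Metric.ball 0 1 →
      ∀ s, 0 < s → ∀ p : Cover m, |flow ρ l s p| ≤
        C * A * ‖p.1‖ * (√s ^ (m + 3 + ntL l))⁻¹ * (1 + ‖p.1‖ ^ 2 / √s) ^ wtL l *
          Real.exp (-(1 / 16) * (max (baseNorm p - 1) 0 / √s) ^ 2) := by
  obtain ⟨C, hC, h⟩ := exists_kerL_le_mul l
  have hM := gaussMass_pos (m := m) (c := 1 / 4) (by norm_num)
  set V : ℝ := (coverMeasure m).real (proj ⁻¹' Metric.closedBall (0 : Base m) 1) with hV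
  have hV0 : 0 ≤ V := measureReal_nonneg
  refine ⟨(gaussMass m (1 / 4))⁻¹ * (C * 8 * (V + 1)), by positivity,
    fun A ρ hA hρ hH hsupp s hs p => ?_⟩
  have hσ : 0 < √s := Real.sqrt_pos.2 hs
  have ha : 0 < √√s := Real.sqrt_pos.2 hσ
  set Z : ℝ := C * 8 * A * ‖p.1‖ * (√s)⁻¹ * (1 + ‖p.1‖ ^ 2 / √s) ^ wtL l *
    Real.exp (-(1 / 16) * (max (baseNorm p - 1) 0 / √s) ^ 2) with hZ
  have hZ0 : 0 ≤ Z := by positivity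
  have hclosed : MeasurableSet (proj ⁻¹' Metric.closedBall (0 : Base m) 1 : Set (Cover m)) :=
    (Metric.isClosed_closedBall.preimage continuous_proj).measurableSet
  have hb : ∀ q, ‖kerL l (dil (√√s)⁻¹ p) (dil (√√s)⁻¹ q) * ρ q‖ ≤
      indicator (proj ⁻¹' Metric.closedBall (0 : Base m) 1) (fun _ => Z) q := by
    intro q
    by_cases hq : q ∈ proj ⁻¹' Metric.closedBall (0 : Base m) 1
    · rw [indicator_of_mem hq, Real.norm_eq_abs, abs_mul]
      have hq1 : baseNorm q ≤ 1 := by simpa [baseNorm] using hq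
      have hq2 : ‖q.1‖ ^ 2 ≤ 1 := (norm_sq_le_baseNorm q).trans hq1
      have hq3 : ‖q.1‖ ≤ 1 := by nlinarith [norm_nonneg q.1]
      -- The source lives in the unit ball, so its points are at distance at least |x| - 1 from x;
      -- this yields the Gaussian decay far away.
      have hD : max (baseNorm p - 1) 0 ≤ baseDist p q := by
        refine max_le ?_ (baseDist_nonneg _ _)
        have : baseNorm p ≤ baseDist p q + baseNorm q := by
          rw [baseNorm, baseNorm, baseDist, dist_eq_norm]
          simpa using norm_add_le (proj p - proj q) (proj q)
        linarith
      have e1 : |ρ q| ≤ 8 * A := by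
        refine (hH.abs_le hα hA hρ q).trans ?_
        have : (‖q.1‖ ^ 2) ^ α ≤ 1 := Real.rpow_le_one (by positivity) hq2 hα.le
        nlinarith
      have e2 := h (dil (√√s)⁻¹ p) (dil (√√s)⁻¹ q)
      rw [norm_sq_dil_inv, norm_dil_fst (by positivity), norm_dil_fst (by positivity),
        baseDist_dil, inv_pow, sq_sqrt_sqrt] at e2
      calc _ ≤ (C * ((√√s)⁻¹ * ‖p.1‖ * ((√√s)⁻¹ * ‖q.1‖)) * (1 + ‖p.1‖ ^ 2 / √s) ^ wtL l *
            Real.exp (-(1 / 16) * ((√s)⁻¹ * baseDist p q) ^ 2)) * (8 * A) :=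
            mul_le_mul e2 e1 (abs_nonneg _) (by positivity)
        _ ≤ (C * ((√√s)⁻¹ * ‖p.1‖ * ((√√s)⁻¹ * 1)) * (1 + ‖p.1‖ ^ 2 / √s) ^ wtL l *
            Real.exp (-(1 / 16) * ((√s)⁻¹ * max (baseNorm p - 1) 0) ^ 2)) * (8 * A) := by
            have : 0 ≤ (√s)⁻¹ * max (baseNorm p - 1) 0 :=
              mul_nonneg (by positivity) (le_max_right _ _)
            have h3 : ((√s)⁻¹ * max (baseNorm p - 1) 0) ^ 2 ≤ ((√s)⁻¹ * baseDist p q) ^ 2 := by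
              gcongr
            have h4 := Real.exp_le_exp.2 (mul_le_mul_of_nonpos_left h3
              (by norm_num : (-(1 / 16) : ℝ) ≤ 0))
            refine mul_le_mul_of_nonneg_right (mul_le_mul ?_ h4 (Real.exp_pos _).le
              (by positivity)) (by positivity)
            gcongr
        _ = _ := by
            -- The vanishing of the kernel in each of the two variables gives one factor (√√s)⁻¹.
            -- Together they improve the decay in time from √s^(m+2) to √s^(m+3).
            have : (√√s)⁻¹ * ‖p.1‖ * ((√√s)⁻¹ * 1) = (√s)⁻¹ * ‖p.1‖ := by
              rw [mul_one, mul_right_comm, ← mul_inv, ← pow_two, sq_sqrt_sqrt]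
            rw [hZ, this, mul_comm (√s)⁻¹ (max _ _), ← div_eq_mul_inv]
            ring
    · rw [indicator_of_notMem hq]
      have : ρ q = 0 := by
        by_contra h0
        exact hq (Metric.ball_subset_closedBall (hsupp (subset_tsupport _ h0)))
      rw [this, mul_zero, norm_zero]
  have hfin := coverMeasure_unit_lt_top (m := m)
  have h1 := norm_integral_le_of_norm_le ((integrable_indicator_iff hclosed).2
    (integrableOn_const hfin.ne)) (Eventually.of_forall hb)
  rw [integral_indicator hclosed, setIntegral_const, ← hV, smul_eq_mul, Real.norm_eq_abs] at h1
  rw [flow_eq ρ l hs, abs_mul, abs_mul, abs_of_pos (by positivity), abs_of_pos (by positivity)]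
  calc _ ≤ (gaussMass m (1 / 4))⁻¹ * ((√s ^ (m + 2 + ntL l))⁻¹ * ((V + 1) * Z)) := by
        gcongr
        exact h1.trans (by nlinarith)
    _ = _ := by
        rw [hZ, show m + 3 + ntL l = m + 2 + ntL l + 1 by ring,
          pow_succ (√s) (m + 2 + ntL l), mul_inv]
        ring

/-- Measurability in time of the heat flow. -/
lemma measurable_flow {ρ : Cover m → ℝ} (hρ : Measurable ρ) (l : List (Fin 2 ⊕ Fin m))
    (p : Cover m) : Measurable fun s => flow ρ l s p := by
  have hk : Continuous fun x : Cover m × Cover m => kerL l x.1 x.2 := (contDiff_kerL l).continuous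
  have h1 : Measurable fun x : ℝ × Cover m => kerL l (dil (√√x.1)⁻¹ p) x.2 := by
    refine hk.measurable.comp (Measurable.prodMk ?_ measurable_snd)
    change Measurable fun x : ℝ × Cover m => ((√√x.1)⁻¹ • p.1, (√√x.1)⁻¹ ^ 2 • p.2)
    fun_prop
  have h2 : Measurable fun x : ℝ × Cover m => ρ (dil (√√x.1) x.2) := by
    refine hρ.comp ?_
    change Measurable fun x : ℝ × Cover m => ((√√x.1) • x.2.1, (√√x.1) ^ 2 • x.2.2)
    fun_prop
  have h3 : StronglyMeasurable (Function.uncurry fun (s : ℝ) (q : Cover m) =>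
      kerL l (dil (√√s)⁻¹ p) q * ρ (dil (√√s) q)) := (h1.mul h2).stronglyMeasurable
  have h4 := h3.integral_prod_right (ν := coverMeasure m)
  unfold flow heat
  exact Measurable.mul (by fun_prop) (h4.measurable.const_mul _)

/-! ### The time integral of the heat flow -/

/-- Hölder sections supported in the open unit ball. -/
structure IsSource (α A : ℝ) (ρ : Cover m → ℝ) : Prop where
  nonneg : 0 ≤ A
  isSection : IsSection ρ
  holder : HolderBound α A ρ
  supp : tsupport ρ ⊆ proj ⁻¹' Metric.ball 0 1

lemma exists_forall_length_le (N : ℕ) (c : List (Fin 2 ⊕ Fin m) → ℝ) :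
    ∃ C, 0 < C ∧ ∀ l : List (Fin 2 ⊕ Fin m), l.length ≤ N → c l ≤ C := by
  have hf := List.finite_length_le (Fin 2 ⊕ Fin m) N
  obtain ⟨C, hC⟩ := (hf.image c).bddAbove
  refine ⟨max C 1, by positivity, fun l hl => ?_⟩
  exact (hC ⟨l, hl, rfl⟩).trans (le_max_left _ _)

/-- The bounds for the heat flow, uniform over short lists. -/
lemma exists_flow_bounds {α : ℝ} (hα : 0 < α) (hα1 : α ≤ 1) (N : ℕ) :
    ∃ C, 0 < C ∧ ∀ l : List (Fin 2 ⊕ Fin m), l.length ≤ N → ∀ (A : ℝ) (ρ : Cover m → ℝ),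
      IsSource α A ρ → ∀ s, 0 < s → ∀ p : Cover m, p.1 ≠ 0 →
      (l ≠ [] → |flow ρ l s p| ≤
        C * A * √s ^ α * (√s ^ l.length)⁻¹ * (√s + ‖p.1‖ ^ 2) ^ wtL l) ∧
      (|flow ρ [] s p - ρ p| ≤ C * A * √s ^ α) ∧
      (|flow ρ l s p| ≤ C * A * √s ^ α * (√s ^ ntL l)⁻¹ * (‖p.1‖ * (√√s)⁻¹) *
          (1 + ‖p.1‖ ^ 2 / √s) ^ (wtL l + 2)) ∧
      (|flow ρ l s p| ≤
        C * A * ‖p.1‖ * (√s ^ (m + 3 + ntL l))⁻¹ * (1 + ‖p.1‖ ^ 2 / √s) ^ wtL l *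
          Real.exp (-(1 / 16) * (max (baseNorm p - 1) 0 / √s) ^ 2)) := by
  have h1 : ∀ l : List (Fin 2 ⊕ Fin m), ∃ C, 0 < C ∧ (l ≠ [] →
      ∀ (A : ℝ) (ρ : Cover m → ℝ), 0 ≤ A → IsSection ρ → HolderBound α A ρ →
      ∀ s, 0 < s → ∀ p : Cover m, p.1 ≠ 0 → |flow ρ l s p| ≤
        C * A * √s ^ α * (√s ^ l.length)⁻¹ * (√s + ‖p.1‖ ^ 2) ^ wtL l) := by
    intro l
    rcases eq_or_ne l [] with h | h
    · exact ⟨1, one_pos, fun h' => absurd h h'⟩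
    · obtain ⟨C, hC, h'⟩ := exists_flow_le hα hα1 h
      exact ⟨C, hC, fun _ => h'⟩
  choose c₁ hc₁ h₁ using h1
  obtain ⟨c₂, hc₂, h₂⟩ := exists_flow_sub_le (m := m) hα hα1
  choose c₃ hc₃ h₃ using exists_flow_le_norm (m := m) hα hα1
  choose c₄ hc₄ h₄ using exists_flow_le_decay (m := m) hα
  obtain ⟨C, hC, h⟩ := exists_forall_length_le N fun l => c₁ l + c₂ + c₃ l + c₄ l
  refine ⟨C, hC, fun l hl A ρ hρ s hs p hp => ?_⟩
  have hle := h l hl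
  have e1 : c₁ l ≤ C := by linarith [hc₁ l, hc₃ l, hc₄ l]
  have e2 : c₂ ≤ C := by linarith [hc₁ l, hc₃ l, hc₄ l]
  have e3 : c₃ l ≤ C := by linarith [hc₁ l, hc₃ l, hc₄ l]
  have e4 : c₄ l ≤ C := by linarith [hc₁ l, hc₃ l, hc₄ l]
  have hA := hρ.nonneg
  refine ⟨fun hne => (h₁ l hne A ρ hA hρ.isSection hρ.holder s hs p hp).trans ?_,
    (h₂ A ρ hA hρ.isSection hρ.holder s hs p hp).trans ?_,
    (h₃ l A ρ hA hρ.isSection hρ.holder s hs p).trans ?_,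
    (h₄ l A ρ hA hρ.isSection hρ.holder hρ.supp s hs p).trans ?_⟩
  · gcongr
  · gcongr
  · gcongr
  · gcongr

/-- An integrable bound for the time dependence of the heat flow. -/
def timeBound (α s : ℝ) : ℝ := if s ≤ 1 then s ^ (α / 2 - 1) else s ^ (-(3 / 2) : ℝ)

lemma integrableOn_timeBound {α : ℝ} (hα : 0 < α) : IntegrableOn (timeBound α) (Ioi 0) := by
  rw [← Ioc_union_Ioi_eq_Ioi (zero_le_one' ℝ)]
  refine IntegrableOn.union ?_ ?_
  · have h := (intervalIntegral.intervalIntegrable_rpow' (a := 0) (b := 1)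
      (show -1 < α / 2 - 1 by linarith)).1
    refine h.congr_fun (fun s hs => ?_) measurableSet_Ioc
    simp [timeBound, hs.2]
  · have h := integrableOn_Ioi_rpow_of_lt (show (-(3 / 2) : ℝ) < -1 by norm_num) one_pos
    refine h.congr_fun (fun s hs => ?_) measurableSet_Ioi
    have : ¬ s ≤ 1 := not_le.2 hs
    simp [timeBound, this]

lemma sqrt_rpow_mul_inv {s : ℝ} (hs : 0 < s) (α : ℝ) (k : ℕ) :
    √s ^ α * (√s ^ k)⁻¹ = s ^ (α / 2 - k / 2) := by
  rw [Real.sqrt_eq_rpow, ← Real.rpow_mul hs.le, ← Real.rpow_natCast, ← Real.rpow_mul hs.le,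
    ← Real.rpow_neg hs.le, ← Real.rpow_add hs]
  congr 1; ring

lemma sqrt_pow_inv {s : ℝ} (hs : 0 < s) (k : ℕ) : (√s ^ k)⁻¹ = s ^ (-(k / 2) : ℝ) := by
  have := sqrt_rpow_mul_inv hs 0 k
  simpa using this

lemma timeBound_nonneg {α s : ℝ} (hs : 0 < s) : 0 ≤ timeBound α s := by
  unfold timeBound; split_ifs <;> positivity

/-- With at most two derivatives the flow is O(s^{α/2-1}) at small times. At large times the decay
√s^{-(m+3)} is at most s^{-3/2} for every m. Both are integrable. -/
lemma exists_flow_le_timeBound {α : ℝ} (hα : 0 < α) (hα1 : α ≤ 1) :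
    ∃ C, 0 < C ∧ ∀ l : List (Fin 2 ⊕ Fin m), l.length ≤ 2 → ∀ (A : ℝ) (ρ : Cover m → ℝ),
      IsSource α A ρ → ∀ s, 0 < s → ∀ p : Cover m, p.1 ≠ 0 →
      |flow ρ l s p| ≤ C * A * (1 + ‖p.1‖ ^ 2) ^ 3 * timeBound α s := by
  obtain ⟨C, hC, h⟩ := exists_flow_bounds (m := m) hα hα1 2
  refine ⟨C + 8, by positivity, fun l hl A ρ hρ s hs p hp => ?_⟩
  obtain ⟨h1, h2, -, h4⟩ := h l hl A ρ hρ s hs p hp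
  have hA := hρ.nonneg
  have hσ : 0 < √s := Real.sqrt_pos.2 hs
  have hr : 0 ≤ ‖p.1‖ ^ 2 := by positivity
  have hr1 : 1 ≤ 1 + ‖p.1‖ ^ 2 := by linarith
  have hwt := wtL_add_ntL l
  unfold timeBound
  split_ifs with hs1
  · have hσ1 : √s ≤ 1 := Real.sqrt_le_one.2 hs1
    have e0 : √s ^ α * (√s ^ 2)⁻¹ = s ^ (α / 2 - 1) := by
      rw [sqrt_rpow_mul_inv hs]; norm_num
    have e1 : (1:ℝ) ≤ (√s ^ 2)⁻¹ := (one_le_inv₀ (by positivity)).2 (pow_le_one₀ hσ.le hσ1)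
    rw [← e0]
    rcases eq_or_ne l [] with rfl | hne
    · have e2 := hρ.holder.abs_le_growth hα hα1 hA hρ.isSection p
      have e3 : |flow ρ [] s p| ≤ 8 * A * (1 + ‖p.1‖ ^ 2) + C * A * √s ^ α := by
        have := abs_add_le (flow ρ [] s p - ρ p) (ρ p)
        rw [sub_add_cancel] at this
        linarith
      have e4 : (1:ℝ) ≤ √s ^ α * (√s ^ 2)⁻¹ := by
        rw [e0]
        exact Real.one_le_rpow_of_pos_of_le_one_of_nonpos hs hs1 (by linarith)
      have e5 : √s ^ α ≤ √s ^ α * (√s ^ 2)⁻¹ := le_mul_of_one_le_right (by positivity) e1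
      have e6 : 1 + ‖p.1‖ ^ 2 ≤ (1 + ‖p.1‖ ^ 2) ^ 3 := le_self_pow₀ hr1 (by norm_num)
      have e7 : 1 ≤ (1 + ‖p.1‖ ^ 2) ^ 3 := one_le_pow₀ hr1
      calc _ ≤ _ := e3
        _ ≤ 8 * A * (1 + ‖p.1‖ ^ 2) ^ 3 * (√s ^ α * (√s ^ 2)⁻¹) +
            C * A * (1 + ‖p.1‖ ^ 2) ^ 3 * (√s ^ α * (√s ^ 2)⁻¹) := by
            refine add_le_add ?_ ?_
            · calc _ ≤ 8 * A * (1 + ‖p.1‖ ^ 2) ^ 3 := by gcongr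
                _ ≤ _ := le_mul_of_one_le_right (by positivity) e4
            · calc _ ≤ C * A * 1 * (√s ^ α * (√s ^ 2)⁻¹) := by rw [mul_one]; gcongr
                _ ≤ _ := by gcongr
        _ = _ := by ring
    · refine (h1 hne).trans ?_
      have e2 : (√s ^ l.length)⁻¹ ≤ (√s ^ 2)⁻¹ := by
        apply inv_anti₀ (by positivity)
        exact pow_le_pow_of_le_one hσ.le hσ1 hl
      have e3 : (√s + ‖p.1‖ ^ 2) ^ wtL l ≤ (1 + ‖p.1‖ ^ 2) ^ 3 :=
        (pow_le_pow_left₀ (by positivity) (by linarith) _).trans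
          (pow_le_pow_right₀ hr1 (by omega))
      calc _ ≤ C * A * √s ^ α * (√s ^ 2)⁻¹ * (1 + ‖p.1‖ ^ 2) ^ 3 := by gcongr
        _ = C * A * (1 + ‖p.1‖ ^ 2) ^ 3 * (√s ^ α * (√s ^ 2)⁻¹) := by ring
        _ ≤ _ := by gcongr; linarith
  · have hσ1 : 1 ≤ √s := Real.one_le_sqrt.2 (le_of_lt (not_le.1 hs1))
    have e0 : (√s ^ 3)⁻¹ = s ^ (-(3 / 2) : ℝ) := by
      rw [sqrt_pow_inv hs]; norm_num
    rw [← e0]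
    have e1 : Real.exp (-(1 / 16) * (max (baseNorm p - 1) 0 / √s) ^ 2) ≤ 1 := by
      apply Real.exp_le_one_iff.2
      nlinarith [sq_nonneg (max (baseNorm p - 1) 0 / √s)]
    have e2 : (√s ^ (m + 3 + ntL l))⁻¹ ≤ (√s ^ 3)⁻¹ :=
      inv_anti₀ (by positivity) (pow_le_pow_right₀ hσ1 (by omega))
    have e3 : (1 + ‖p.1‖ ^ 2 / √s) ^ wtL l ≤ (1 + ‖p.1‖ ^ 2) ^ 2 :=
      (pow_le_pow_left₀ (by positivity) (by linarith [div_le_self hr hσ1]) _).trans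
        (pow_le_pow_right₀ hr1 (by omega))
    have e4 : ‖p.1‖ ≤ 1 + ‖p.1‖ ^ 2 := by nlinarith [sq_nonneg (‖p.1‖ - 1)]
    refine h4.trans ?_
    calc _ ≤ C * A * (1 + ‖p.1‖ ^ 2) * (√s ^ 3)⁻¹ * (1 + ‖p.1‖ ^ 2) ^ 2 * 1 := by
          refine mul_le_mul ?_ e1 (Real.exp_pos _).le (by positivity)
          gcongr
      _ = C * A * (1 + ‖p.1‖ ^ 2) ^ 3 * (√s ^ 3)⁻¹ := by ring
      _ ≤ _ := by gcongr; linarith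

/-- The tower of derivatives of the time integral of the heat flow over the set `I` of times. -/
def pot (ρ : Cover m → ℝ) (I : Set ℝ) (l : List (Fin 2 ⊕ Fin m)) (p : Cover m) : ℝ :=
  -∫ s in I, flow ρ l s p

section

variable {α A : ℝ} {ρ : Cover m → ℝ}

lemma IsSource.measurable (hα : 0 < α) (hα1 : α ≤ 1) (hρ : IsSource α A ρ) : Measurable ρ :=
  (hρ.holder.continuous hα hα1 hρ.nonneg hρ.isSection).measurable

lemma IsSource.integrableOn_flow (hα : 0 < α) (hα1 : α ≤ 1) (hρ : IsSource α A ρ)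
    {l : List (Fin 2 ⊕ Fin m)} (hl : l.length ≤ 2) {p : Cover m} (hp : p.1 ≠ 0) :
    IntegrableOn (fun s => flow ρ l s p) (Ioi 0) := by
  obtain ⟨C, hC, h⟩ := exists_flow_le_timeBound (m := m) hα hα1
  refine ((integrableOn_timeBound hα).const_mul (C * A * (1 + ‖p.1‖ ^ 2) ^ 3)).mono'
    (measurable_flow (hρ.measurable hα hα1) l p).aestronglyMeasurable ?_
  filter_upwards [ae_restrict_mem measurableSet_Ioi] with s hs
  exact h l hl A ρ hρ s hs p hp

lemma IsSource.exists_flow_dominated (hα : 0 < α) (hα1 : α ≤ 1) (hρ : IsSource α A ρ)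
    {l : List (Fin 2 ⊕ Fin m)} (hl : l.length ≤ 2) {p₀ : Cover m} (hp₀ : p₀.1 ≠ 0) :
    ∃ b : ℝ → ℝ, IntegrableOn b (Ioi 0) ∧ ∃ S ∈ 𝓝 p₀, ∀ s ∈ Ioi (0 : ℝ), ∀ p ∈ S,
      |flow ρ l s p| ≤ b s := by
  obtain ⟨C, hC, h⟩ := exists_flow_le_timeBound (m := m) hα hα1
  have hA := hρ.nonneg
  refine ⟨fun s => C * A * (1 + (‖p₀.1‖ + 1) ^ 2) ^ 3 * timeBound α s,
    (integrableOn_timeBound hα).const_mul _, {p | ‖p.1‖ < ‖p₀.1‖ + 1} ∩ {p | p.1 ≠ 0},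
    inter_mem ((isOpen_lt (by fun_prop) continuous_const).mem_nhds
      (show ‖p₀.1‖ < ‖p₀.1‖ + 1 by linarith)) (isOpen_regular.mem_nhds hp₀),
    fun s hs p hp => (h l hl A ρ hρ s hs p hp.2).trans ?_⟩
  have h1 : ‖p.1‖ ≤ ‖p₀.1‖ + 1 := le_of_lt hp.1
  have h2 := timeBound_nonneg (α := α) hs
  change _ ≤ C * A * (1 + (‖p₀.1‖ + 1) ^ 2) ^ 3 * timeBound α s
  gcongr

/-- The height is 2 because the time integral near s = 0 converges only up to two derivatives of the
flow. -/
lemma IsSource.isTower_pot (hα : 0 < α) (hα1 : α ≤ 1) (hρ : IsSource α A ρ) {I : Set ℝ}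
    (hI : MeasurableSet I) (hI0 : I ⊆ Ioi 0) : IsTower 2 (pot ρ I) := by
  have h := IsTower.integral (μ := volume.restrict I) (n := 2) (Φ := fun s l p => flow ρ l s p)
    ?_ (fun l p => (measurable_flow (hρ.measurable hα hα1) l p).aestronglyMeasurable) ?_
  · have h' := h.const_mul (-1)
    simp only [neg_one_mul] at h'
    exact h'
  · filter_upwards [ae_restrict_mem hI] with s hs
    exact (isTower_flow hα hα1 hρ.nonneg hρ.isSection hρ.holder (hI0 hs)).of_le le_top
  · intro l hl p₀ hp₀
    obtain ⟨b, hb, S, hS, hbS⟩ := hρ.exists_flow_dominated hα hα1 (l := l)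
      (by exact_mod_cast hl) hp₀
    refine ⟨b, hb.mono_set hI0, S, hS, ?_⟩
    filter_upwards [ae_restrict_mem hI] with s hs
    exact hbS s (hI0 hs)

lemma IsSource.continuousAt_pot (hα : 0 < α) (hα1 : α ≤ 1) (hρ : IsSource α A ρ) {I : Set ℝ}
    (hI : MeasurableSet I) (hI0 : I ⊆ Ioi 0) {l : List (Fin 2 ⊕ Fin m)} (hl : l.length ≤ 2)
    {p₀ : Cover m} (hp₀ : p₀.1 ≠ 0) : ContinuousAt (pot ρ I l) p₀ := by
  obtain ⟨b, hb, S, hS, hbS⟩ := hρ.exists_flow_dominated hα hα1 (l := l) hl hp₀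
  refine ContinuousAt.neg (continuousAt_of_dominated (bound := b) ?_ ?_ (hb.mono_set hI0) ?_)
  · exact Eventually.of_forall fun p =>
      (measurable_flow (hρ.measurable hα hα1) l p).aestronglyMeasurable
  · filter_upwards [hS] with p hp
    filter_upwards [ae_restrict_mem hI] with s hs
    exact hbS s (hI0 hs) p hp
  · filter_upwards [ae_restrict_mem hI] with s hs
    exact (isTower_flow hα hα1 hρ.nonneg hρ.isSection hρ.holder (hI0 hs) l (by simp)
      p₀ hp₀).continuousAt

lemma IsSource.contDiffOn_pot (hα : 0 < α) (hα1 : α ≤ 1) (hρ : IsSource α A ρ) :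
    ContDiffOn ℝ 2 (pot ρ (Ioi 0) []) {p | p.1 ≠ 0} := by
  have h := IsTower.contDiffOn (k := 2) (l := [])
    (hρ.isTower_pot hα hα1 measurableSet_Ioi Subset.rfl) fun l' hl' p hp =>
      (hρ.continuousAt_pot hα hα1 measurableSet_Ioi Subset.rfl
        (by simp at hl'; omega) hp).continuousWithinAt
  exact_mod_cast h

/-- Time integrals away from zero and infinity are smooth. -/
lemma IsSource.isTower_pot_Icc (hα : 0 < α) (hα1 : α ≤ 1) (hρ : IsSource α A ρ) {a b : ℝ}
    (ha : 0 < a) : IsTower ⊤ (pot ρ (Icc a b)) := by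
  have h := IsTower.integral (μ := volume.restrict (Icc a b)) (n := ⊤)
    (Φ := fun s l p => flow ρ l s p)
    ?_ (fun l p => (measurable_flow (hρ.measurable hα hα1) l p).aestronglyMeasurable) ?_
  · have h' := h.const_mul (-1)
    simp only [neg_one_mul] at h'
    exact h'
  · filter_upwards [ae_restrict_mem measurableSet_Icc] with s hs
    exact isTower_flow hα hα1 hρ.nonneg hρ.isSection hρ.holder (ha.trans_le hs.1)
  · intro l _ p₀ hp₀
    obtain ⟨C, hC, h⟩ := exists_flow_le_decay hα l
    have hA := hρ.nonneg
    refine ⟨fun _ => C * A * (‖p₀.1‖ + 1) * (√a ^ (m + 3 + ntL l))⁻¹ *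
      (1 + (‖p₀.1‖ + 1) ^ 2 / √a) ^ wtL l * 1, integrableOn_const (by simp),
      {p | ‖p.1‖ < ‖p₀.1‖ + 1}, (isOpen_lt (by fun_prop) continuous_const).mem_nhds
      (show ‖p₀.1‖ < ‖p₀.1‖ + 1 by linarith), ?_⟩
    filter_upwards [ae_restrict_mem measurableSet_Icc] with s hs p hp
    have hs0 := ha.trans_le hs.1
    refine (h A ρ hA hρ.isSection hρ.holder hρ.supp s hs0 p).trans ?_
    have e1 : Real.exp (-(1 / 16) * (max (baseNorm p - 1) 0 / √s) ^ 2) ≤ 1 := by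
      apply Real.exp_le_one_iff.2
      nlinarith [sq_nonneg (max (baseNorm p - 1) 0 / √s)]
    have h1 : ‖p.1‖ ≤ ‖p₀.1‖ + 1 := le_of_lt hp
    have h2 : √a ≤ √s := Real.sqrt_le_sqrt hs.1
    have h3 : 0 < √a := Real.sqrt_pos.2 ha
    refine mul_le_mul ?_ e1 (Real.exp_pos _).le (by positivity)
    gcongr

end

/-! ### Hölder estimates -/

/-- Write |w² - v²| = |w - v||w + v|; when Re(w v̄) > 0 one has |w + v| ≥ |w|. -/
lemma norm_sub_mul_norm_le {p q : Cover m} (hx : 0 < crossRe p q) :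
    ‖q.1 - p.1‖ * ‖p.1‖ ≤ baseDist p q := by
  refine le_trans ?_ (norm_fst_sub_le p q)
  have h1 : p.1 ^ 2 - q.1 ^ 2 = (q.1 - p.1) * -(p.1 + q.1) := by ring
  rw [h1, norm_mul, norm_neg]
  refine mul_le_mul_of_nonneg_left ?_ (norm_nonneg _)
  apply abs_le_of_sq_le_sq' _ (norm_nonneg _) |>.2
  rw [crossRe_eq] at hx
  have h2 := norm_sq_fst (p + q)
  rw [Prod.fst_add, Complex.add_re, Complex.add_im] at h2
  rw [norm_sq_fst, h2]
  simp only [Complex.mul_re, Complex.conj_re, Complex.conj_im] at hx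
  nlinarith [sq_nonneg q.1.re, sq_nonneg q.1.im]

/-- The mean value inequality for towers, along the lift of a short segment. -/
lemma IsTower.abs_sub_le {n : ℕ∞} {F : List (Fin 2 ⊕ Fin m) → Cover m → ℝ} (hF : IsTower n F)
    {l : List (Fin 2 ⊕ Fin m)} (hl : (l.length : ℕ∞) < n) {p q : Cover m} (hp : p.1 ≠ 0)
    (hD : baseDist p q ≤ 1 / 2 * ‖p.1‖ ^ 2) (hx : 0 < crossRe p q) {B : ℝ}
    (hB : ∀ c : Cover m, c.1 ≠ 0 → baseDist p q ≤ 2 * ‖c.1‖ ^ 2 → ‖c.1‖ ≤ max ‖p.1‖ ‖q.1‖ →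
      (∀ k, |F (Sum.inl k :: l) c| * (baseDist p q / ‖c.1‖ ^ 2) ≤ B) ∧
      ∀ i, |F (Sum.inr i :: l) c| * baseDist p q ≤ B) :
    |F l p - F l q| ≤ (6 + m) * B := by
  have hw : 0 < ‖p.1‖ := norm_pos_iff.2 hp
  have hD0 := baseDist_nonneg p q
  have h1 := norm_sub_mul_norm_le hx
  have h2 : ‖q.1 - p.1‖ ≤ ‖p.1‖ / 2 := by
    have : ‖q.1 - p.1‖ * ‖p.1‖ ≤ ‖p.1‖ / 2 * ‖p.1‖ := by nlinarith
    exact le_of_mul_le_mul_right this hw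
  -- The path is the straight segment upstairs. Since |v - w| ≤ |w|/2, it stays between |w|/2 and
  -- 3|w|/2 and avoids the singular set.
  set c : ℝ → Cover m := fun τ => p + τ • (q - p) with hc
  have hc1 : ∀ τ, (c τ).1 = p.1 + τ • (q.1 - p.1) := fun τ => rfl
  have hlow : ∀ τ ∈ Icc (0 : ℝ) 1, ‖p.1‖ / 2 ≤ ‖(c τ).1‖ ∧ ‖(c τ).1‖ ≤ 3 / 2 * ‖p.1‖ ∧
      ‖(c τ).1‖ ≤ max ‖p.1‖ ‖q.1‖ := by
    intro τ hτ
    have e1 : ‖τ • (q.1 - p.1)‖ ≤ ‖p.1‖ / 2 := by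
      rw [norm_smul, Real.norm_of_nonneg hτ.1]
      nlinarith [norm_nonneg (q.1 - p.1), hτ.2]
    rw [hc1]
    refine ⟨?_, ?_, ?_⟩
    · have := norm_sub_le_norm_add p.1 (τ • (q.1 - p.1)); linarith
    · have := norm_add_le p.1 (τ • (q.1 - p.1)); linarith
    · have e2 : p.1 + τ • (q.1 - p.1) = (1 - τ) • p.1 + τ • q.1 := by
        rw [smul_sub, sub_smul, one_smul]; abel
      rw [e2]
      refine (norm_add_le _ _).trans ?_
      rw [norm_smul, norm_smul, Real.norm_of_nonneg hτ.1,
        Real.norm_of_nonneg (by linarith [hτ.2])]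
      have := mul_le_mul_of_nonneg_left (le_max_left ‖p.1‖ ‖q.1‖) (by linarith [hτ.2] : 0 ≤ 1 - τ)
      have := mul_le_mul_of_nonneg_left (le_max_right ‖p.1‖ ‖q.1‖) hτ.1
      linarith
  have hne : ∀ τ ∈ Icc (0 : ℝ) 1, (c τ).1 ≠ 0 := fun τ hτ =>
    norm_pos_iff.1 (lt_of_lt_of_le (by linarith) (hlow τ hτ).1)
  have hder : ∀ τ ∈ Icc (0 : ℝ) 1, HasDerivWithinAt (fun τ => F l (c τ))
      ((∑ a, F (a :: l) (c τ) • cof a (c τ)) (q - p)) (Icc 0 1) τ := by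
    intro τ hτ
    have e1 : HasDerivAt c (q - p) τ := by
      have := ((hasDerivAt_id τ).smul_const (q - p)).const_add p
      rwa [one_smul] at this
    exact ((hF l hl _ (hne τ hτ)).comp_hasDerivAt τ e1).hasDerivWithinAt
  have key := norm_image_sub_le_of_norm_deriv_le_segment_01' (C := (6 + m) * B) hder ?_
  · have e0 : c 0 = p := by simp [hc]
    have e1 : c 1 = q := by simp [hc]
    rw [e0, e1] at key
    rwa [abs_sub_comm]
  · intro τ hτ
    have hτ' := Ico_subset_Icc_self hτ
    obtain ⟨g1, g2, g3⟩ := hlow τ hτ'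
    have hcpos : 0 < ‖(c τ).1‖ := norm_pos_iff.2 (hne τ hτ')
    obtain ⟨b1, b2⟩ := hB (c τ) (hne τ hτ') (by nlinarith) g3
    have hk : ∀ k : Fin 2, ‖F (Sum.inl k :: l) (c τ) * cof (Sum.inl k) (c τ) (q - p)‖ ≤
        3 * B := by
      intro k
      rw [norm_mul, Real.norm_eq_abs, Real.norm_eq_abs]
      -- The coframe is at most 2|v - w|/|c|. With |v - w||w| ≤ D and |c| ≤ 3|w|/2 this is at most
      -- 3D/|c|². The two planar directions thus give 6B and the m remaining ones mB.
      have f1 : |cof (Sum.inl k) (c τ) (q - p)| ≤ 3 * (baseDist p q / ‖(c τ).1‖ ^ 2) := by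
        refine (abs_cof_inl_le k _ _).trans ?_
        rw [Prod.fst_sub, div_mul_eq_mul_div, ← mul_div_assoc, div_le_div_iff₀ hcpos
          (by positivity)]
        nlinarith [mul_le_mul_of_nonneg_left g2 (norm_nonneg (q.1 - p.1))]
      have := b1 k
      calc _ ≤ |F (Sum.inl k :: l) (c τ)| * (3 * (baseDist p q / ‖(c τ).1‖ ^ 2)) := by gcongr
        _ ≤ _ := by linarith
    have hi : ∀ i : Fin m, ‖F (Sum.inr i :: l) (c τ) * cof (Sum.inr i) (c τ) (q - p)‖ ≤ B := by
      intro i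
      rw [norm_mul, Real.norm_eq_abs, Real.norm_eq_abs]
      have f1 : |cof (Sum.inr i) (c τ) (q - p)| ≤ baseDist p q := by
        refine (abs_cof_inr_le i _ _).trans ?_
        rw [Prod.snd_sub, norm_sub_rev]; exact norm_snd_sub_le p q
      exact (mul_le_mul_of_nonneg_left f1 (abs_nonneg _)).trans (b2 i)
    simp only [sum_apply, smul_apply, smul_eq_mul]
    refine (norm_sum_le _ _).trans ?_
    rw [Fintype.sum_sum_type, Fin.sum_univ_two]
    have := Finset.sum_le_card_nsmul Finset.univ _ _ fun i _ => hi i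
    simp only [Finset.card_univ, Fintype.card_fin, nsmul_eq_mul] at this
    linarith [hk 0, hk 1]

/-- Bounds for the derivatives of the heat flow that control its increments. -/
lemma exists_flow_cons_le {α : ℝ} (hα : 0 < α) (hα1 : α ≤ 1) :
    ∃ C, 0 < C ∧ ∀ l : List (Fin 2 ⊕ Fin m), l.length ≤ 2 → ∀ (A : ℝ) (ρ : Cover m → ℝ),
      IsSource α A ρ → ∀ D s, 0 < D → D ^ 2 ≤ s → ∀ p : Cover m, p.1 ≠ 0 → ‖p.1‖ ≤ 1 →
      D ≤ 2 * ‖p.1‖ ^ 2 →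
      (∀ k, |flow ρ (Sum.inl k :: l) s p| * (D / ‖p.1‖ ^ 2) ≤
        C * A * (√D * (√s ^ α * (√s ^ 2 * √√s)⁻¹))) ∧
      (∀ i, |flow ρ (Sum.inr i :: l) s p| * D ≤
        C * A * (√D * (√s ^ α * (√s ^ 2 * √√s)⁻¹))) := by
  obtain ⟨C, hC, h⟩ := exists_flow_bounds (m := m) hα hα1 3
  refine ⟨C * 64, by positivity, fun l hl A ρ hρ D s hD hDs p hp hp1 hDp => ?_⟩
  have hA := hρ.nonneg
  have hs : 0 < s := lt_of_lt_of_le (by positivity) hDs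
  have hσ : 0 < √s := Real.sqrt_pos.2 hs
  have hσ' : 0 < √√s := Real.sqrt_pos.2 hσ
  have hw : 0 < ‖p.1‖ := norm_pos_iff.2 hp
  have hDσ : D ≤ √s := Real.le_sqrt_of_sq_le hDs
  have hd : 0 < √D := Real.sqrt_pos.2 hD
  have hdD : √D ^ 2 = D := Real.sq_sqrt hD.le
  have hdσ : √D ≤ √√s := Real.sqrt_le_sqrt hDσ
  have hr1 : ‖p.1‖ ^ 2 ≤ 1 := pow_le_one₀ hw.le hp1
  have hdw : √D ≤ 2 * ‖p.1‖ := by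
    refine abs_le_of_sq_le_sq' ?_ (by positivity) |>.2
    rw [hdD]; nlinarith
  have hDw : D / ‖p.1‖ ≤ 2 * √D := by
    rw [div_le_iff₀ hw]; nlinarith
  have hD2 : D ≤ 2 * √D := by nlinarith
  set σ := √s with hσdef
  have hτ2 : √σ ^ 2 = σ := Real.sq_sqrt hσ.le
  set X := σ ^ α with hX
  have hX0 : 0 < X := Real.rpow_pos_of_pos hσ _
  -- One full power of D is more than needed: since D ≤ √s, half of it can be traded for √√s.
  have hsmall : D * (σ ^ 3)⁻¹ ≤ √D * (σ ^ 2 * √σ)⁻¹ := by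
    have e1 : D * (σ ^ 3)⁻¹ = √D * (σ ^ 2 * √σ)⁻¹ * (√D / √σ) := by
      rw [pow_succ σ 2]
      nth_rewrite 2 [← hτ2]
      nth_rewrite 1 [← hdD]
      field_simp
    rw [e1]
    exact mul_le_of_le_one_right (by positivity) ((div_le_one hσ').2 hdσ)
  have hlarge : 1 ≤ σ → (σ ^ 3)⁻¹ ≤ X * (σ ^ 2 * √σ)⁻¹ := by
    intro h1
    have e1 : 1 ≤ X := Real.one_le_rpow h1 hα.le
    have e2 : √σ ≤ σ := by
      rw [Real.sqrt_le_left hσ.le]; nlinarith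
    calc (σ ^ 3)⁻¹ ≤ (σ ^ 2 * √σ)⁻¹ := by
          apply inv_anti₀ (by positivity)
          rw [pow_succ σ 2]; gcongr
      _ ≤ _ := le_mul_of_one_le_left (by positivity) e1
  have hdecay : ∀ l' : List (Fin 2 ⊕ Fin m), l'.length ≤ 3 → 1 ≤ σ →
      |flow ρ l' s p| ≤ C * 8 * A * ‖p.1‖ * (X * (σ ^ 2 * √σ)⁻¹) := by
    intro l' hl' h1
    obtain ⟨-, -, -, h4⟩ := h l' hl' A ρ hρ s hs p hp
    have hwt := wtL_add_ntL l'
    refine h4.trans ?_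
    have e1 : Real.exp (-(1 / 16) * (max (baseNorm p - 1) 0 / σ) ^ 2) ≤ 1 := by
      apply Real.exp_le_one_iff.2
      nlinarith [sq_nonneg (max (baseNorm p - 1) 0 / σ)]
    have e2 : (σ ^ (m + 3 + ntL l'))⁻¹ ≤ X * (σ ^ 2 * √σ)⁻¹ :=
      (inv_anti₀ (by positivity) (pow_le_pow_right₀ h1 (by omega))).trans (hlarge h1)
    have e3 : (1 + ‖p.1‖ ^ 2 / σ) ^ wtL l' ≤ 8 := by
      have : ‖p.1‖ ^ 2 / σ ≤ 1 := (div_le_self (by positivity) h1).trans hr1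
      calc _ ≤ (2 : ℝ) ^ wtL l' := pow_le_pow_left₀ (by positivity) (by linarith) _
        _ ≤ 2 ^ 3 := pow_le_pow_right₀ (by norm_num) (by omega)
        _ = 8 := by norm_num
    calc _ ≤ C * A * ‖p.1‖ * (X * (σ ^ 2 * √σ)⁻¹) * 8 * 1 := by
          refine mul_le_mul ?_ e1 (Real.exp_pos _).le (by positivity)
          gcongr
      _ = _ := by ring
  have hlen : ∀ a : Fin 2 ⊕ Fin m, (a :: l).length ≤ 3 := fun a => by simp; omega
  have hpowlen : ∀ a : Fin 2 ⊕ Fin m, σ ≤ 1 → (σ ^ (a :: l).length)⁻¹ ≤ (σ ^ 3)⁻¹ := fun a h1 =>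
    inv_anti₀ (by positivity) (pow_le_pow_of_le_one hσ.le h1 (hlen a))
  have hwl := wtL_add_ntL l
  constructor
  · intro k
    have hwt : wtL (Sum.inl k :: l) = wtL l + 1 := by rw [wtL_cons]; simp [wt, add_comm]
    have hnt : ntL (Sum.inl k :: l) = ntL l := by rw [ntL_cons]; simp [nt]
    -- Large times: the decay estimate supplies a factor |w|, and |w| · D/|z| = D/|w| ≤ 2√D because
    -- D ≤ 2|z| < 4|z|.
    rcases le_or_gt 1 σ with h1 | h1
    · calc _ ≤ C * 8 * A * ‖p.1‖ * (X * (σ ^ 2 * √σ)⁻¹) * (D / ‖p.1‖ ^ 2) :=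
            mul_le_mul_of_nonneg_right (hdecay _ (hlen _) h1) (by positivity)
        _ = C * 8 * A * (X * (σ ^ 2 * √σ)⁻¹) * (D / ‖p.1‖) := by field_simp
        _ ≤ C * 8 * A * (X * (σ ^ 2 * √σ)⁻¹) * (2 * √D) := by gcongr
        _ = C * 16 * A * (√D * (X * (σ ^ 2 * √σ)⁻¹)) := by ring
        _ ≤ _ := by gcongr; norm_num
    -- Far from the singular set at scale √s, the weight of the extra planar derivative gives a
    -- factor |z| that cancels the division by |z|.
    · rcases le_or_gt σ (‖p.1‖ ^ 2) with h2 | h2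
      · have h3 := (h _ (hlen (Sum.inl k)) A ρ hρ s hs p hp).1 (by simp)
        have e1 : (σ + ‖p.1‖ ^ 2) ^ (wtL l + 1) ≤ 8 * ‖p.1‖ ^ 2 := by
          rw [pow_succ]
          calc _ ≤ (2 : ℝ) ^ wtL l * (2 * ‖p.1‖ ^ 2) := by
                gcongr <;> linarith
            _ ≤ 2 ^ 2 * (2 * ‖p.1‖ ^ 2) := by
                gcongr
                · norm_num
                · omega
            _ = _ := by ring
        rw [hwt] at h3
        calc _ ≤ (C * A * X * (σ ^ 3)⁻¹ * (8 * ‖p.1‖ ^ 2)) * (D / ‖p.1‖ ^ 2) := by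
              refine mul_le_mul_of_nonneg_right (h3.trans ?_) (by positivity)
              have := hpowlen (Sum.inl k) h1.le
              gcongr
          _ = C * 8 * A * X * (D * (σ ^ 3)⁻¹) := by field_simp
          _ ≤ C * 8 * A * X * (√D * (σ ^ 2 * √σ)⁻¹) := by gcongr
          _ = C * 8 * A * (√D * (X * (σ ^ 2 * √σ)⁻¹)) := by ring
          _ ≤ _ := by gcongr; norm_num
      -- Near the singular set only the factor |w|/√√s is available, leaving D/|w|, of order √D.
      -- This is the regime that limits the exponent to α < 1/2.
      · obtain ⟨-, -, h3, -⟩ := h _ (hlen (Sum.inl k)) A ρ hρ s hs p hp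
        rw [hwt, hnt] at h3
        have e1 : (1 + ‖p.1‖ ^ 2 / σ) ^ (wtL l + 1 + 2) ≤ 32 := by
          have : ‖p.1‖ ^ 2 / σ ≤ 1 := (div_le_one hσ).2 h2.le
          calc _ ≤ (2 : ℝ) ^ (wtL l + 1 + 2) := pow_le_pow_left₀ (by positivity) (by linarith) _
            _ ≤ 2 ^ 5 := pow_le_pow_right₀ (by norm_num) (by omega)
            _ = 32 := by norm_num
        have e2 : (σ ^ ntL l)⁻¹ ≤ (σ ^ 2)⁻¹ :=
          inv_anti₀ (by positivity) (pow_le_pow_of_le_one hσ.le h1.le (by omega))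
        calc _ ≤ (C * A * X * (σ ^ 2)⁻¹ * (‖p.1‖ * (√σ)⁻¹) * 32) * (D / ‖p.1‖ ^ 2) := by
              refine mul_le_mul_of_nonneg_right (h3.trans ?_) (by positivity)
              gcongr
          _ = C * 32 * A * (X * (σ ^ 2 * √σ)⁻¹) * (D / ‖p.1‖) := by field_simp
          _ ≤ C * 32 * A * (X * (σ ^ 2 * √σ)⁻¹) * (2 * √D) := by gcongr
          _ = _ := by ring
  · intro i
    have hwt : wtL (Sum.inr i :: l) = wtL l := by rw [wtL_cons]; simp [wt]
    -- The fields ∂_{t_i} involve no division by |z|, so the two ranges of time suffice.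
    rcases le_or_gt 1 σ with h1 | h1
    · calc _ ≤ C * 8 * A * ‖p.1‖ * (X * (σ ^ 2 * √σ)⁻¹) * D :=
            mul_le_mul_of_nonneg_right (hdecay _ (hlen _) h1) (by positivity)
        _ ≤ C * 8 * A * 1 * (X * (σ ^ 2 * √σ)⁻¹) * (2 * √D) := by gcongr
        _ = C * 16 * A * (√D * (X * (σ ^ 2 * √σ)⁻¹)) := by ring
        _ ≤ _ := by gcongr; norm_num
    · have h3 := (h _ (hlen (Sum.inr i)) A ρ hρ s hs p hp).1 (by simp)
      rw [hwt] at h3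
      have e1 : (σ + ‖p.1‖ ^ 2) ^ wtL l ≤ 4 := by
        calc _ ≤ (2 : ℝ) ^ wtL l := pow_le_pow_left₀ (by positivity) (by linarith) _
          _ ≤ 2 ^ 2 := pow_le_pow_right₀ (by norm_num) (by omega)
          _ = 4 := by norm_num
      calc _ ≤ (C * A * X * (σ ^ 3)⁻¹ * 4) * D := by
            refine mul_le_mul_of_nonneg_right (h3.trans ?_) (by positivity)
            have := hpowlen (Sum.inr i) h1.le
            gcongr
        _ = C * 4 * A * X * (D * (σ ^ 3)⁻¹) := by ring
        _ ≤ C * 4 * A * X * (√D * (σ ^ 2 * √σ)⁻¹) := by gcongr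
        _ = C * 4 * A * (√D * (X * (σ ^ 2 * √σ)⁻¹)) := by ring
        _ ≤ _ := by gcongr; norm_num

lemma fst_ne_zero_of_crossRe_pos {p q : Cover m} (h : 0 < crossRe p q) : p.1 ≠ 0 ∧ q.1 ≠ 0 := by
  constructor <;> intro h0 <;> simp [crossRe, h0] at h

/-- The increments of the heat flow for small times. -/
lemma exists_flow_sub_flow_le_small {α : ℝ} (hα : 0 < α) (hα1 : α ≤ 1) :
    ∃ C, 0 < C ∧ ∀ l : List (Fin 2 ⊕ Fin m), l.length ≤ 2 → ∀ (A : ℝ) (ρ : Cover m → ℝ),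
      IsSource α A ρ → ∀ p q : Cover m, ‖p.1‖ ≤ 1 → ‖q.1‖ ≤ 1 →
      baseDist p q ≤ 1 / 2 * min (‖p.1‖ ^ 2) (‖q.1‖ ^ 2) → 0 < crossRe p q →
      ∀ s, 0 < s → s ≤ baseDist p q ^ 2 →
      |flow ρ l s p - flow ρ l s q| ≤ C * A * (s ^ (α / 2 - 1) + baseDist p q ^ α) := by
  obtain ⟨C, hC, h⟩ := exists_flow_bounds (m := m) hα hα1 2
  refine ⟨8 * C + 1, by positivity, fun l hl A ρ hρ p q hp1 hq1 hD hx s hs hsD => ?_⟩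
  obtain ⟨hp, hq⟩ := fst_ne_zero_of_crossRe_pos hx
  have hA := hρ.nonneg
  have hσ : 0 < √s := Real.sqrt_pos.2 hs
  have hD0 := baseDist_nonneg p q
  have hrp : ‖p.1‖ ^ 2 ≤ 1 := pow_le_one₀ (norm_nonneg _) hp1
  have hrq : ‖q.1‖ ^ 2 ≤ 1 := pow_le_one₀ (norm_nonneg _) hq1
  have hD1 : baseDist p q ≤ 1 := by
    have := min_le_left (‖p.1‖ ^ 2) (‖q.1‖ ^ 2); linarith
  have hσ1 : √s ≤ 1 := (Real.sqrt_le_left hD0).2 hsD |>.trans hD1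
  have e0 : √s ^ α * (√s ^ 2)⁻¹ = s ^ (α / 2 - 1) := by
    rw [sqrt_rpow_mul_inv hs]; norm_num
  have e1 : (1:ℝ) ≤ (√s ^ 2)⁻¹ := (one_le_inv₀ (by positivity)).2 (pow_le_one₀ hσ.le hσ1)
  have hs0 : 0 < s ^ (α / 2 - 1) := Real.rpow_pos_of_pos hs _
  have hDα : 0 ≤ baseDist p q ^ α := Real.rpow_nonneg hD0 _
  -- Without derivatives the flow need not be small. It is compared with ρ at both points, and the
  -- Hölder condition on ρ gives the term D^α.
  rcases eq_or_ne l [] with rfl | hne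
  · have h1 := (h [] hl A ρ hρ s hs p hp).2.1
    have h2 := (h [] hl A ρ hρ s hs q hq).2.1
    have h3 := hρ.holder p q hD hx
    have h4 : √s ^ α ≤ s ^ (α / 2 - 1) := by
      rw [← e0]; exact le_mul_of_one_le_right (by positivity) e1
    have h5 : |flow ρ [] s p - flow ρ [] s q| ≤
        |flow ρ [] s p - ρ p| + |flow ρ [] s q - ρ q| + |ρ p - ρ q| := by
      have := abs_add_three (flow ρ [] s p - ρ p) (-(flow ρ [] s q - ρ q)) (ρ p - ρ q)
      rw [abs_neg] at this
      rwa [show flow ρ [] s p - ρ p + -(flow ρ [] s q - ρ q) + (ρ p - ρ q) =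
        flow ρ [] s p - flow ρ [] s q by ring] at this
    have h6 : C * A * √s ^ α ≤ C * A * s ^ (α / 2 - 1) := by gcongr
    have h7 : 0 ≤ C * A * s ^ (α / 2 - 1) := by positivity
    have h8 : 0 ≤ A * s ^ (α / 2 - 1) := by positivity
    have h9 : 0 ≤ C * A * baseDist p q ^ α := by positivity
    linarith
  · have key : ∀ c : Cover m, c.1 ≠ 0 → ‖c.1‖ ^ 2 ≤ 1 → |flow ρ l s c| ≤
        4 * C * A * s ^ (α / 2 - 1) := by
      intro c hc hc1
      refine ((h l hl A ρ hρ s hs c hc).1 hne).trans ?_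
      have hwt := wtL_add_ntL l
      have e2 : (√s ^ l.length)⁻¹ ≤ (√s ^ 2)⁻¹ := by
        apply inv_anti₀ (by positivity)
        exact pow_le_pow_of_le_one hσ.le hσ1 hl
      have e3 : (√s + ‖c.1‖ ^ 2) ^ wtL l ≤ 4 := by
        calc _ ≤ (2 : ℝ) ^ wtL l := pow_le_pow_left₀ (by positivity) (by linarith) _
          _ ≤ 2 ^ 2 := pow_le_pow_right₀ (by norm_num) (by omega)
          _ = 4 := by norm_num
      calc _ ≤ C * A * √s ^ α * (√s ^ 2)⁻¹ * 4 := by gcongr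
        _ = 4 * C * A * (√s ^ α * (√s ^ 2)⁻¹) := by ring
        _ = _ := by rw [e0]
    have h1 := key p hp hrp
    have h2 := key q hq hrq
    have h3 := abs_sub (flow ρ l s p) (flow ρ l s q)
    have h8 : 0 ≤ A * s ^ (α / 2 - 1) := by positivity
    have h9 : 0 ≤ (8 * C + 1) * A * baseDist p q ^ α := by positivity
    linarith

/-- The increments of the heat flow for large times. -/
lemma exists_flow_sub_flow_le_large {α : ℝ} (hα : 0 < α) (hα1 : α ≤ 1) :
    ∃ C, 0 < C ∧ ∀ l : List (Fin 2 ⊕ Fin m), l.length ≤ 2 → ∀ (A : ℝ) (ρ : Cover m → ℝ),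
      IsSource α A ρ → ∀ p q : Cover m, ‖p.1‖ ≤ 1 → ‖q.1‖ ≤ 1 → 0 < baseDist p q →
      baseDist p q ≤ 1 / 2 * min (‖p.1‖ ^ 2) (‖q.1‖ ^ 2) → 0 < crossRe p q →
      ∀ s, baseDist p q ^ 2 ≤ s →
      |flow ρ l s p - flow ρ l s q| ≤ C * A * √(baseDist p q) * s ^ (α / 2 - 5 / 4) := by
  obtain ⟨C, hC, h⟩ := exists_flow_cons_le (m := m) hα hα1
  refine ⟨(6 + m) * C, by positivity, fun l hl A ρ hρ p q hp1 hq1 hD0 hD hx s hsD => ?_⟩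
  have hs : 0 < s := lt_of_lt_of_le (by positivity) hsD
  have hσ : 0 < √s := Real.sqrt_pos.2 hs
  have e0 : √s ^ α * (√s ^ 2 * √√s)⁻¹ = s ^ (α / 2 - 5 / 4) := by
    rw [mul_inv, ← mul_assoc, sqrt_rpow_mul_inv hs, Real.sqrt_eq_rpow, Real.sqrt_eq_rpow,
      ← Real.rpow_mul hs.le, ← Real.rpow_neg hs.le, ← Real.rpow_add hs]
    congr 1; norm_num; ring
  have h1 := (isTower_flow hα hα1 hρ.nonneg hρ.isSection hρ.holder hs).abs_sub_le (l := l)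
    (by simp) (fst_ne_zero_of_crossRe_pos hx).1
    (hD.trans (by gcongr; exact min_le_left _ _)) hx
    (B := C * A * (√(baseDist p q) * (√s ^ α * (√s ^ 2 * √√s)⁻¹))) fun c hc hcD hc1 =>
      h l hl A ρ hρ (baseDist p q) s hD0 hsD c hc (hc1.trans (max_le hp1 hq1)) hcD
  rw [e0] at h1
  refine h1.trans_eq ?_
  ring

/-- The Hölder estimate for the time integral of the heat flow. -/
lemma exists_pot_sub_pot_le {α : ℝ} (hα : 0 < α) (hα1 : α < 1 / 2) :
    ∃ C, 0 < C ∧ ∀ l : List (Fin 2 ⊕ Fin m), l.length ≤ 2 → ∀ (A : ℝ) (ρ : Cover m → ℝ),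
      IsSource α A ρ → ∀ p q : Cover m, ‖p.1‖ ≤ 1 → ‖q.1‖ ≤ 1 → 0 < baseDist p q →
      baseDist p q ≤ 1 / 2 * min (‖p.1‖ ^ 2) (‖q.1‖ ^ 2) → 0 < crossRe p q →
      |pot ρ (Ioi 0) l p - pot ρ (Ioi 0) l q| ≤ C * A * baseDist p q ^ α := by
  have hα1' : α ≤ 1 := by linarith
  obtain ⟨C₁, hC₁, h₁⟩ := exists_flow_sub_flow_le_small (m := m) hα hα1'
  obtain ⟨C₂, hC₂, h₂⟩ := exists_flow_sub_flow_le_large (m := m) hα hα1'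
  -- The place where α < 1/2 is needed: it makes s^{α/2-5/4} integrable at infinity.
  have hc : 0 < 1 / 4 - α / 2 := by linarith
  refine ⟨C₁ * ((α / 2)⁻¹ + 1) + C₂ * (1 / 4 - α / 2)⁻¹, by positivity,
    fun l hl A ρ hρ p q hp1 hq1 hD0 hD hx => ?_⟩
  obtain ⟨hp, hq⟩ := fst_ne_zero_of_crossRe_pos hx
  have hA := hρ.nonneg
  set D := baseDist p q with hDdef
  have hrp : ‖p.1‖ ^ 2 ≤ 1 := pow_le_one₀ (norm_nonneg _) hp1
  have hD1 : D ≤ 1 := by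
    have := min_le_left (‖p.1‖ ^ 2) (‖q.1‖ ^ 2); linarith
  have hD2 : 0 < D ^ 2 := by positivity
  have hip := hρ.integrableOn_flow hα hα1' hl hp
  have hiq := hρ.integrableOn_flow hα hα1' hl hq
  have hi : IntegrableOn (fun s => flow ρ l s p - flow ρ l s q) (Ioi 0) := hip.sub hiq
  have e1 : |pot ρ (Ioi 0) l p - pot ρ (Ioi 0) l q| =
      |∫ s in Ioi 0, (flow ρ l s p - flow ρ l s q)| := by
    rw [integral_sub hip hiq, pot, pot, ← abs_neg]; congr 1; ring
  -- At time D² the diffusion length equals the distance of the two points; the two pieces then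
  -- scale alike, each like D^α.
  have e2 : ∫ s in Ioi 0, (flow ρ l s p - flow ρ l s q) =
      (∫ s in Ioc 0 (D ^ 2), (flow ρ l s p - flow ρ l s q)) +
      ∫ s in Ioi (D ^ 2), (flow ρ l s p - flow ρ l s q) := by
    rw [← setIntegral_union (Ioc_disjoint_Ioi le_rfl) measurableSet_Ioi
      (hi.mono_set Ioc_subset_Ioi_self) (hi.mono_set (Ioi_subset_Ioi hD2.le)),
      Ioc_union_Ioi_eq_Ioi hD2.le]
  have h_int : IntegrableOn (fun s : ℝ => s ^ (α / 2 - 1)) (Ioc 0 (D ^ 2)) :=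
    (intervalIntegral.intervalIntegrable_rpow' (a := 0) (b := D ^ 2)
      (show -1 < α / 2 - 1 by linarith)).1
  have hval : ∫ s in Ioc 0 (D ^ 2), s ^ (α / 2 - 1) = (α / 2)⁻¹ * D ^ α := by
    rw [← intervalIntegral.integral_of_le hD2.le, integral_rpow (Or.inl (by linarith)),
      Real.zero_rpow (by linarith), sub_add_cancel, sub_zero, ← Real.rpow_natCast D 2,
      ← Real.rpow_mul hD0.le, div_eq_inv_mul]
    congr 2; push_cast; ring
  have s1 : |∫ s in Ioc 0 (D ^ 2), (flow ρ l s p - flow ρ l s q)| ≤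
      C₁ * ((α / 2)⁻¹ + 1) * A * D ^ α := by
    have := norm_integral_le_of_norm_le (μ := volume.restrict (Ioc 0 (D ^ 2)))
      (f := fun s => flow ρ l s p - flow ρ l s q)
      (g := fun s => C₁ * A * (s ^ (α / 2 - 1) + D ^ α))
      ((h_int.add (integrableOn_const (by simp))).const_mul _) ?_
    · refine this.trans ?_
      rw [integral_const_mul, integral_add h_int (integrableOn_const (by simp)), hval,
        setIntegral_const]
      simp only [measureReal_def, Real.volume_Ioc, sub_zero, smul_eq_mul,
        ENNReal.toReal_ofReal hD2.le]
      -- The constant D^α is integrated over a time interval of length D² ≤ 1.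
      have e3 : D ^ 2 * D ^ α ≤ D ^ α :=
        mul_le_of_le_one_left (by positivity) (pow_le_one₀ hD0.le hD1)
      have e4 : C₁ * A * (D ^ 2 * D ^ α) ≤ C₁ * A * D ^ α := by gcongr
      linarith
    · filter_upwards [ae_restrict_mem measurableSet_Ioc] with s hs
      exact h₁ l hl A ρ hρ p q hp1 hq1 hD hx s hs.1 hs.2
  have hlt : α / 2 - 5 / 4 < -1 := by linarith
  have hval2 : √D * ∫ s in Ioi (D ^ 2), s ^ (α / 2 - 5 / 4) = (1 / 4 - α / 2)⁻¹ * D ^ α := by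
    rw [integral_Ioi_rpow_of_lt hlt hD2, show α / 2 - 5 / 4 + 1 = -(1 / 4 - α / 2) by ring,
      ← Real.rpow_natCast D 2, ← Real.rpow_mul hD0.le, neg_div_neg_eq, Real.sqrt_eq_rpow,
      ← mul_div_assoc, ← Real.rpow_add hD0, div_eq_inv_mul]
    congr 2; push_cast; ring
  have s2 : |∫ s in Ioi (D ^ 2), (flow ρ l s p - flow ρ l s q)| ≤
      C₂ * (1 / 4 - α / 2)⁻¹ * A * D ^ α := by
    have := norm_integral_le_of_norm_le (μ := volume.restrict (Ioi (D ^ 2)))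
      (f := fun s => flow ρ l s p - flow ρ l s q)
      (g := fun s => C₂ * A * √D * s ^ (α / 2 - 5 / 4))
      ((integrableOn_Ioi_rpow_of_lt hlt hD2).const_mul _) ?_
    · refine this.trans_eq ?_
      rw [integral_const_mul, mul_assoc, hval2]; ring
    · filter_upwards [ae_restrict_mem measurableSet_Ioi] with s hs
      exact h₂ l hl A ρ hρ p q hp1 hq1 hD0 hD hx s (le_of_lt hs)
  rw [e1, e2]
  refine (abs_add_le _ _).trans ((add_le_add s1 s2).trans_eq ?_)
  ring

lemma exists_dNorm_pot_le {α : ℝ} (hα : 0 < α) (hα1 : α < 1 / 2) :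
    ∃ C, 0 < C ∧ ∀ (A : ℝ) (ρ : Cover m → ℝ), IsSource α A ρ →
      dNorm 2 α (Metric.ball 0 1) (pot ρ (Ioi 0) []) ≤ ENNReal.ofReal (C * A) := by
  obtain ⟨C, hC, h⟩ := exists_pot_sub_pot_le (m := m) hα hα1
  refine ⟨C, hC, fun A ρ hρ => ?_⟩
  have hA := hρ.nonneg
  refine iSup₂_le fun l hl => iSup₂_le fun p q => iSup₂_le fun hpU hqU => iSup₂_le fun hD hx => ?_
  have hx' : 0 < crossRe p q := by rwa [crossRe_eq]
  obtain ⟨hp, hq⟩ := fst_ne_zero_of_crossRe_pos hx'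
  have hunit : ∀ c : Cover m, proj c ∈ Metric.ball (0 : Base m) 1 → ‖c.1‖ ≤ 1 := by
    intro c hc
    have h1 : baseNorm c < 1 := by simpa [baseNorm] using hc
    have h2 := norm_sq_le_baseNorm c
    nlinarith [norm_nonneg c.1]
  apply ENNReal.ofReal_le_ofReal
  have ht := hρ.isTower_pot hα (by linarith) measurableSet_Ioi Subset.rfl
  have hl' : (l.length : ℕ∞) ≤ 2 := by exact_mod_cast hl
  -- The monomials are literal iterated derivatives; off the singular set they agree with the
  -- entries of the tower, for which the increments are known.
  rw [ht.monomial_eq l hl' hp, ht.monomial_eq l hl' hq]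
  rcases (baseDist_nonneg p q).eq_or_lt with h0 | h0
  · have : p = q := eq_of_baseDist_eq_zero h0.symm hx'
    subst this
    simp only [sub_self, abs_zero, zero_div]; positivity
  · have hpos : 0 < dist (proj p) (proj q) := h0
    rw [div_le_iff₀ (Real.rpow_pos_of_pos hpos α)]
    refine h l hl A ρ hρ p q (hunit p hpU) (hunit q hqU) h0 ?_ hx'
    simpa [baseDist] using hD

/-! ### The heat equation -/

/-- Derivative of the squared distance along the tangential fields. -/
def dQuad : Fin 2 ⊕ Fin m → Cover m → Cover m → ℝ
  | Sum.inl 0 => fun q p => 2 * ((p.1.re ^ 2 + p.1.im ^ 2) ^ 2 - crossRe p q ^ 2 + crossIm p q ^ 2)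
  | Sum.inl 1 => fun q p => 4 * crossRe p q * crossIm p q
  | Sum.inr i => fun q p => 2 * (p.2 i - q.2 i)

lemma der_sum_sq (a : Fin 2 ⊕ Fin m) (q : Cover m) :
    Der a (fun p => ∑ i, (p.2 i - q.2 i) ^ 2) (fun p => ∑ i, 2 * (p.2 i - q.2 i) * dT i a) := by
  refine Der.sum _ fun i _ => ?_
  have h := ((der_t i a).add (Der.const (-q.2 i))).mul ((der_t i a).add (Der.const (-q.2 i)))
  have h2 : (fun p : Cover m => (p.2 i - q.2 i) ^ 2) =
      fun p => (p.2 i + -q.2 i) * (p.2 i + -q.2 i) := by funext p; ring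
  rw [h2]
  exact h.congr fun p => by ring

lemma Der.sq {a : Fin 2 ⊕ Fin m} {f f' : Cover m → ℝ} (h : Der a f f') :
    Der a (fun p => f p ^ 2) (fun p => 2 * f p * f' p) := by
  have h2 : (fun p => f p ^ 2) = fun p => f p * f p := by funext p; ring
  rw [h2]
  exact (h.mul h).congr fun p => by ring

lemma der_quad (a : Fin 2 ⊕ Fin m) (q : Cover m) : Der a (fun p => quad p q) (dQuad a q) := by
  have hr := (der_re a).sq.add ((Der.const (-1)).mul (der_im a).sq)
  have hi := ((Der.const 2).mul (der_re a)).mul (der_im a)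
  have h := ((hr.add (Der.const (-(q.1.re ^ 2 - q.1.im ^ 2)))).sq.add
    (hi.add (Der.const (-(2 * q.1.re * q.1.im)))).sq).add (der_sum_sq a q)
  have h2 : (fun p : Cover m => quad p q) = fun p =>
      (p.1.re ^ 2 + -1 * p.1.im ^ 2 + -(q.1.re ^ 2 - q.1.im ^ 2)) ^ 2 +
      (2 * p.1.re * p.1.im + -(2 * q.1.re * q.1.im)) ^ 2 + ∑ i, (p.2 i - q.2 i) ^ 2 := by
    funext p; simp only [quad]; ring
  rw [h2]
  refine h.congr fun p => ?_
  match a with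
  | Sum.inl 0 =>
    simp only [dRe, dIm, dT, dQuad, crossRe, crossIm, mul_zero, Finset.sum_const_zero]; ring
  | Sum.inl 1 =>
    simp only [dRe, dIm, dT, dQuad, crossRe, crossIm, mul_zero, Finset.sum_const_zero]; ring
  | Sum.inr j =>
    simp only [dRe, dIm, dT, dQuad, mul_ite, mul_one, mul_zero, Finset.sum_ite_eq',
      Finset.mem_univ, if_true]
    ring

/-- Derivative of `hquad` along the tangential fields. -/
def dHquad : Fin 2 ⊕ Fin m → Cover m → Cover m → ℝ
  | Sum.inl 0 => fun q p => 2 * (p.1.re ^ 2 + p.1.im ^ 2) *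
      ((p.1.re ^ 2 + p.1.im ^ 2) + (q.1.re ^ 2 + q.1.im ^ 2))
  | Sum.inl 1 => fun _ _ => 0
  | Sum.inr i => fun q p => 2 * (p.2 i - q.2 i)

lemma der_hquad (a : Fin 2 ⊕ Fin m) (q : Cover m) : Der a (fun p => hquad p q) (dHquad a q) := by
  have hr := (der_re a).sq.add (der_im a).sq
  have h := (hr.add (Der.const (q.1.re ^ 2 + q.1.im ^ 2))).sq.add (der_sum_sq a q)
  refine h.congr fun p => ?_
  match a with
  | Sum.inl 0 => simp only [dRe, dIm, dT, dHquad, mul_zero, Finset.sum_const_zero]; ring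
  | Sum.inl 1 => simp only [dRe, dIm, dT, dHquad, mul_zero, Finset.sum_const_zero]; ring
  | Sum.inr j =>
    simp only [dRe, dIm, dT, dHquad, mul_ite, mul_one, mul_zero, Finset.sum_ite_eq',
      Finset.mem_univ, if_true]
    ring

lemma der_hk (a : Fin 2 ⊕ Fin m) (q : Cover m) :
    Der a (fun p => hk p q) (fun p => -(1 / 4) * dHquad a q p * hk p q) :=
  der_exp_quarter (der_hquad a q)

/-- Second derivatives of `quad` along the same field. -/
def ddQuad : Fin 2 ⊕ Fin m → Cover m → Cover m → ℝ
  | Sum.inl 0 => fun q p => 2 * (2 * (p.1.re ^ 2 + p.1.im ^ 2) ^ 2 -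
      crossRe p q ^ 2 + crossIm p q ^ 2)
  | Sum.inl 1 => fun q p => 2 * (crossRe p q ^ 2 - crossIm p q ^ 2)
  | Sum.inr _ => fun _ _ => 2

lemma der_dQuad (a : Fin 2 ⊕ Fin m) (q : Cover m) : Der a (dQuad a q) (ddQuad a q) := by
  match a with
  | Sum.inl 0 =>
    have h := (Der.const (a := (Sum.inl 0 : Fin 2 ⊕ Fin m)) 2).mul
      ((((der_re (Sum.inl 0)).sq.add (der_im (Sum.inl 0)).sq).sq.add
      ((Der.const (-1)).mul (der_crossRe _ q).sq)).add (der_crossIm _ q).sq)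
    have h2 : dQuad (Sum.inl 0) q = fun p : Cover m =>
      2 * ((p.1.re ^ 2 + p.1.im ^ 2) ^ 2 + -1 * crossRe p q ^ 2 + crossIm p q ^ 2) := by
      funext p; simp only [dQuad]; ring
    rw [h2]
    exact h.congr fun p => by simp only [ddQuad, rot, dRe, dIm]; ring
  | Sum.inl 1 =>
    have h := ((Der.const (a := (Sum.inl 1 : Fin 2 ⊕ Fin m)) 4).mul (der_crossRe _ q)).mul
      (der_crossIm _ q)
    exact h.congr fun p => by simp only [ddQuad, rot]; ring
  | Sum.inr i =>
    have h := (Der.const (a := (Sum.inr i : Fin 2 ⊕ Fin m)) 2).mul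
      ((der_t i _).add (Der.const (-q.2 i)))
    have h2 : dQuad (Sum.inr i) q = fun p : Cover m => 2 * (p.2 i + -q.2 i) := by
      funext p; simp only [dQuad]; ring
    rw [h2]
    exact h.congr fun p => by simp [ddQuad, dT]

/-- Second derivative of `crossRe` along the same field. -/
def ddCross : Fin 2 ⊕ Fin m → ℝ
  | Sum.inl 0 => 1 / 4
  | Sum.inl 1 => -(1 / 4)
  | Sum.inr _ => 0

/-- Only repeated fields are needed, because the Laplacian satisfies |z|²Δ = (r∂_r)² + ∂_θ² +
|z|²∑∂_{t_i}² with no mixed terms. -/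
lemma kerL_pair (a : Fin 2 ⊕ Fin m) (p q : Cover m) : kerL [a, a] p q =
    (-(1 / 4) * ddQuad a q p + 1 / 16 * dQuad a q p ^ 2) * ker p q +
    2 / √Real.pi * (ddCross a * crossRe p q - 1 / 4 * (dQuad a q p + dHquad a q p) *
      ((rot a).1 * crossRe p q + (rot a).2 * crossIm p q)) * hk p q := by
  rw [kerL_cons]
  have h1 : (fun p => kerL [a] p q) = fun p => -(1 / 4) * dQuad a q p * ker p q + 2 / √Real.pi *
        ((rot a).1 * crossRe p q + (rot a).2 * crossIm p q) * hk p q := by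
    rw [← (der_ker (der_quad a q)).along]
    funext p
    rw [kerL_cons]
    simp only [kerL_nil]
  rw [h1]
  have h2 := (((Der.const (-(1 / 4))).mul (der_dQuad a q)).mul (der_ker (der_quad a q))).add
    (((Der.const (2 / √Real.pi)).mul (((Der.const (rot a).1).mul (der_crossRe a q)).add
      ((Der.const (rot a).2).mul (der_crossIm a q)))).mul (der_hk a q))
  refine (congrFun h2.along p).trans ?_
  match a with
  | Sum.inl 0 => simp only [ddCross, rot]; ring
  | Sum.inl 1 => simp only [ddCross, rot]; ring
  | Sum.inr _ => simp only [ddCross, rot]; ring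

/-- The Laplacian of the heat kernel at time one. -/
lemma laplacian_kerL (p q : Cover m) :
    kerL [Sum.inl 0, Sum.inl 0] p q + kerL [Sum.inl 1, Sum.inl 1] p q +
      (‖p.1‖ ^ 2) ^ 2 * ∑ i : Fin m, kerL [Sum.inr i, Sum.inr i] p q =
    (‖p.1‖ ^ 2) ^ 2 * ((quad p q / 4 - (m + 2) / 2) * ker p q -
      crossRe p q / √Real.pi * hk p q) := by
  simp only [kerL_pair]
  have h1 : ∑ i : Fin m, ((-(1 / 4) * ddQuad (Sum.inr i) q p +
      1 / 16 * dQuad (Sum.inr i) q p ^ 2) * ker p q +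
      2 / √Real.pi * (ddCross (Sum.inr i : Fin 2 ⊕ Fin m) * crossRe p q -
      1 / 4 * (dQuad (Sum.inr i) q p + dHquad (Sum.inr i) q p) *
      ((rot (Sum.inr i : Fin 2 ⊕ Fin m)).1 * crossRe p q +
        (rot (Sum.inr i : Fin 2 ⊕ Fin m)).2 * crossIm p q)) * hk p q) =
      (-(1 / 2) * m + 1 / 4 * ∑ i, (p.2 i - q.2 i) ^ 2) * ker p q := by
    have : ∀ i : Fin m, ((-(1 / 4) * ddQuad (Sum.inr i) q p +
      1 / 16 * dQuad (Sum.inr i) q p ^ 2) * ker p q +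
      2 / √Real.pi * (ddCross (Sum.inr i : Fin 2 ⊕ Fin m) * crossRe p q -
      1 / 4 * (dQuad (Sum.inr i) q p + dHquad (Sum.inr i) q p) *
      ((rot (Sum.inr i : Fin 2 ⊕ Fin m)).1 * crossRe p q +
        (rot (Sum.inr i : Fin 2 ⊕ Fin m)).2 * crossIm p q)) * hk p q) =
        (-(1 / 2) + 1 / 4 * (p.2 i - q.2 i) ^ 2) * ker p q := fun i => by
      simp only [ddQuad, dQuad, ddCross, rot]; ring
    rw [Finset.sum_congr rfl fun i _ => this i, ← Finset.sum_mul, Finset.sum_add_distrib,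
      ← Finset.mul_sum]
    simp only [Finset.sum_const, Finset.card_univ, Fintype.card_fin, nsmul_eq_mul]; ring
  rw [h1, norm_sq_fst, quad]
  simp only [ddQuad, dQuad, ddCross, dHquad, rot, crossRe, crossIm]
  ring

/-- The time derivative of the heat kernel at time one. -/
def kerD (p q : Cover m) : ℝ :=
  (quad p q / 4 - (m + 2) / 2) * ker p q - crossRe p q / √Real.pi * hk p q

/-- A bound uniform in both points, for differentiating the flow in time under the integral. The
polynomial factors are absorbed through x e^{-x} ≤ 1 and |x| e^{-x²} ≤ 1. -/
lemma abs_kerD_le (p q : Cover m) : |kerD p q| ≤ m + 4 := by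
  have hQ : 0 ≤ quad p q := by rw [quad_eq]; positivity
  have hg : gk p q ≤ 1 := by
    rw [gk]; apply Real.exp_le_one_iff.2; linarith
  have hg0 := gk_pos p q
  have h1 : |ker p q| ≤ gk p q := by
    rw [ker, abs_mul, abs_of_pos hg0]
    exact mul_le_of_le_one_right hg0.le (abs_erf_le_one _)
  have h2 : quad p q / 4 * gk p q ≤ 1 := by
    rw [gk, show -(1 / 4) * quad p q = -(quad p q / 4) by ring, Real.exp_neg,
      ← div_eq_mul_inv, div_le_one (Real.exp_pos _)]
    linarith [Real.add_one_le_exp (quad p q / 4)]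
  have h3 : |crossRe p q| * hk p q ≤ 1 := by
    have e1 : |crossRe p q| * Real.exp (-crossRe p q ^ 2) ≤ 1 := by
      rw [Real.exp_neg, ← div_eq_mul_inv, div_le_one (Real.exp_pos _)]
      have := Real.add_one_le_exp (crossRe p q ^ 2)
      nlinarith [sq_nonneg (|crossRe p q| - 1), sq_abs (crossRe p q)]
    rw [← gk_mul_exp, mul_left_comm]
    exact mul_le_one₀ hg (by positivity) e1
  have h4 : (√Real.pi)⁻¹ ≤ 1 := by
    apply inv_le_one_of_one_le₀
    exact Real.one_le_sqrt.2 (by linarith [Real.pi_gt_three])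
  have h5 : |(quad p q / 4 - (m + 2) / 2) * ker p q| ≤ 1 + (m + 2) / 2 := by
    rw [abs_mul]
    have e1 : |quad p q / 4 - (m + 2) / 2| ≤ quad p q / 4 + (m + 2) / 2 := by
      have : (0 : ℝ) ≤ m := Nat.cast_nonneg m
      rw [abs_le]; constructor <;> linarith
    calc _ ≤ (quad p q / 4 + (m + 2) / 2) * gk p q :=
          mul_le_mul e1 h1 (abs_nonneg _) (by positivity)
      _ = quad p q / 4 * gk p q + (m + 2) / 2 * gk p q := by ring
      _ ≤ 1 + (m + 2) / 2 * 1 := by gcongr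
      _ = _ := by ring
  have h6 : |crossRe p q / √Real.pi * hk p q| ≤ 1 := by
    rw [abs_mul, abs_div, abs_of_pos (hk_pos p q), abs_of_nonneg (Real.sqrt_nonneg _),
      div_eq_mul_inv, mul_right_comm]
    exact mul_le_one₀ h3 (by positivity) h4
  rw [kerD]
  refine (abs_sub _ _).trans ((add_le_add h5 h6).trans ?_)
  have : (0 : ℝ) ≤ m := Nat.cast_nonneg m
  linarith

/-! ### Time derivative of the kernel and of the flow. -/

lemma quad_dil_inv {s : ℝ} (p q : Cover m) :
    quad (dil (√√s)⁻¹ p) (dil (√√s)⁻¹ q) = quad p q * (√s ^ 2)⁻¹ := by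
  rw [quad_eq, quad_eq, baseDist_dil, inv_pow, sq_sqrt_sqrt]; ring

lemma crossRe_dil_inv {s : ℝ} (p q : Cover m) :
    crossRe (dil (√√s)⁻¹ p) (dil (√√s)⁻¹ q) = crossRe p q * (√s)⁻¹ := by
  rw [crossRe_dil, inv_pow, sq_sqrt_sqrt]; ring

/-- Time enters the rescaled kernel only through σ = √s. With n = m + 2, the factor 2σ⁻¹ combines
with dσ/ds = 1/(2σ) to 1/s. -/
lemma hasDerivAt_profile (n : ℕ) (Q x : ℝ) {σ : ℝ} (hσ : σ ≠ 0) :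
    HasDerivAt (fun σ : ℝ => (σ ^ n)⁻¹ * (Real.exp (-(1 / 4) * (Q * (σ ^ 2)⁻¹)) * erf (x * σ⁻¹)))
      ((σ ^ n)⁻¹ * (2 * σ⁻¹) * ((Q * (σ ^ 2)⁻¹ / 4 - n / 2) *
        (Real.exp (-(1 / 4) * (Q * (σ ^ 2)⁻¹)) * erf (x * σ⁻¹)) - x * σ⁻¹ / √Real.pi *
        (Real.exp (-(1 / 4) * (Q * (σ ^ 2)⁻¹)) * Real.exp (-(x * σ⁻¹) ^ 2)))) σ := by
  have h1 := (hasDerivAt_pow n σ).inv (pow_ne_zero n hσ)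
  have h2 := ((((hasDerivAt_pow 2 σ).inv (pow_ne_zero 2 hσ)).const_mul Q).const_mul
    (-(1 / 4))).exp
  have h3 := (hasDerivAt_erf (x * σ⁻¹)).comp σ ((hasDerivAt_inv hσ).const_mul x)
  have hn : (n : ℝ) * σ ^ (n - 1) = n * σ ^ n * σ⁻¹ := by
    rcases n with _ | n
    · simp
    · rw [Nat.add_sub_cancel, pow_succ]; field_simp
  have hpi : √Real.pi ≠ 0 := (Real.sqrt_pos.2 Real.pi_pos).ne'
  refine (h1.mul (h2.mul h3)).congr_deriv ?_
  simp only [Pi.mul_apply, Pi.inv_apply, Function.comp_apply]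
  rw [hn]
  generalize Real.exp (-(1 / 4) * (Q * (σ ^ 2)⁻¹)) = E
  generalize Real.exp (-(x * σ⁻¹) ^ 2) = E'
  generalize erf (x * σ⁻¹) = F
  have : σ ^ n ≠ 0 := pow_ne_zero n hσ
  field_simp
  ring

lemma hasDerivAt_kernel (p q : Cover m) {s : ℝ} (hs : 0 < s) :
    HasDerivAt (fun s => (√s ^ (m + 2))⁻¹ * ker (dil (√√s)⁻¹ p) (dil (√√s)⁻¹ q))
      ((√s ^ (m + 2))⁻¹ * s⁻¹ * kerD (dil (√√s)⁻¹ p) (dil (√√s)⁻¹ q)) s := by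
  have hσ : 0 < √s := Real.sqrt_pos.2 hs
  have h := (hasDerivAt_profile (m + 2) (quad p q) (crossRe p q) hσ.ne').comp s
    (Real.hasDerivAt_sqrt hs.ne')
  have e : (fun s => (√s ^ (m + 2))⁻¹ * ker (dil (√√s)⁻¹ p) (dil (√√s)⁻¹ q)) =
      (fun σ : ℝ => (σ ^ (m + 2))⁻¹ * (Real.exp (-(1 / 4) * (quad p q * (σ ^ 2)⁻¹)) *
        erf (crossRe p q * σ⁻¹))) ∘ fun s => √s := by
    funext s
    simp only [Function.comp_apply, ker, gk, quad_dil_inv, crossRe_dil_inv]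
  rw [e]
  refine h.congr_deriv ?_
  rw [kerD, ← gk_mul_exp, ker, gk, quad_dil_inv, crossRe_dil_inv]
  have hs2 : s⁻¹ = (2 * (√s)⁻¹) * (1 / (2 * √s)) := by
    have := Real.sq_sqrt hs.le
    field_simp
    rw [this]
  rw [hs2]
  push_cast
  ring

section

variable {α A : ℝ} {ρ : Cover m → ℝ}

lemma IsSource.eq_zero (hρ : IsSource α A ρ) {q : Cover m} (hq : 1 ≤ baseNorm q) : ρ q = 0 := by
  by_contra h0
  have : baseNorm q < 1 := by simpa [baseNorm] using hρ.supp (subset_tsupport _ h0)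
  linarith

lemma IsSource.integrable (hα : 0 < α) (hα1 : α ≤ 1) (hρ : IsSource α A ρ) :
    Integrable ρ (coverMeasure m) := by
  have hclosed : MeasurableSet (proj ⁻¹' Metric.closedBall (0 : Base m) 1 : Set (Cover m)) :=
    (Metric.isClosed_closedBall.preimage continuous_proj).measurableSet
  refine ((integrable_indicator_iff hclosed).2 (integrableOn_const (C := 8 * A)
    coverMeasure_unit_lt_top.ne)).mono' (hρ.measurable hα hα1).aestronglyMeasurable
    (Eventually.of_forall fun q => ?_)
  have hA := hρ.nonneg
  by_cases hq : q ∈ proj ⁻¹' Metric.closedBall (0 : Base m) 1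
  · rw [indicator_of_mem hq, Real.norm_eq_abs]
    have hq1 : baseNorm q ≤ 1 := by simpa [baseNorm] using hq
    refine (hρ.holder.abs_le hα hA hρ.isSection q).trans ?_
    have : (‖q.1‖ ^ 2) ^ α ≤ 1 :=
      Real.rpow_le_one (by positivity) ((norm_sq_le_baseNorm q).trans hq1) hα.le
    nlinarith
  · rw [indicator_of_notMem hq, hρ.eq_zero, norm_zero]
    have : ¬ baseNorm q ≤ 1 := by simpa [baseNorm] using hq
    exact (not_le.1 this).le

lemma continuous_ker_dil (l : List (Fin 2 ⊕ Fin m)) (p : Cover m) (b : ℝ) :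
    Continuous fun q => kerL l p (dil b q) :=
  (continuous_kerL_right l p).comp (continuous_dil b)

lemma IsSource.integrable_kerL_dil (hα : 0 < α) (hα1 : α ≤ 1) (hρ : IsSource α A ρ)
    (l : List (Fin 2 ⊕ Fin m)) (p : Cover m) (b : ℝ) :
    Integrable (fun q => kerL l p (dil b q) * ρ q) (coverMeasure m) := by
  obtain ⟨C, hC, h⟩ := exists_kerL_le l
  refine (hρ.integrable hα hα1).bdd_mul (c := C * (1 + ‖p.1‖ ^ 2) ^ wtL l)
    (continuous_ker_dil l p b).aestronglyMeasurable (Eventually.of_forall fun q => ?_)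
  refine (h p _).trans (mul_le_of_le_one_right (by positivity) ?_)
  exact exp_neg_le_one (by positivity)

/-- The time derivative of the heat flow. -/
def flowD (ρ : Cover m → ℝ) (s : ℝ) (p : Cover m) : ℝ :=
  (gaussMass m (1 / 4))⁻¹ *
    ∫ q, ((√s ^ (m + 2))⁻¹ * s⁻¹ * kerD (dil (√√s)⁻¹ p) (dil (√√s)⁻¹ q)) * ρ q ∂(coverMeasure m)

lemma continuous_kerD_right (p : Cover m) : Continuous fun q => kerD p q := by
  have hr : Continuous fun q : Cover m => (p, q) := Continuous.prodMk continuous_const continuous_id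
  have h1 := isPoly_quad.contDiff.continuous.comp hr
  have h2 := contDiff_ker.continuous.comp hr
  have h3 := contDiff_coord.1.continuous.comp hr
  have h4 := contDiff_hk.continuous.comp hr
  exact (((h1.div_const 4).sub continuous_const).mul h2).sub ((h3.div_const _).mul h4)

lemma IsSource.hasDerivAt_flow (hα : 0 < α) (hα1 : α ≤ 1) (hρ : IsSource α A ρ) (p : Cover m)
    {s : ℝ} (hs : 0 < s) : HasDerivAt (fun s => flow ρ [] s p) (flowD ρ s p) s := by
  have hmeas : ∀ s : ℝ, AEStronglyMeasurable (fun q => ((√s ^ (m + 2))⁻¹ *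
      ker (dil (√√s)⁻¹ p) (dil (√√s)⁻¹ q)) * ρ q) (coverMeasure m) := by
    intro s
    have := continuous_ker_dil [] (dil (√√s)⁻¹ p) (√√s)⁻¹
    simp only [kerL_nil] at this
    exact ((this.measurable.const_mul _).mul (hρ.measurable hα hα1)).aestronglyMeasurable
  have key := hasDerivAt_integral_of_dominated_loc_of_deriv_le (μ := coverMeasure m)
    (s := Ioi (s / 2)) (x₀ := s)
    (F := fun s q => ((√s ^ (m + 2))⁻¹ * ker (dil (√√s)⁻¹ p) (dil (√√s)⁻¹ q)) * ρ q)
    (F' := fun s q => ((√s ^ (m + 2))⁻¹ * s⁻¹ * kerD (dil (√√s)⁻¹ p) (dil (√√s)⁻¹ q)) * ρ q)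
    (bound := fun q => ((√(s / 2) ^ (m + 2))⁻¹ * (s / 2)⁻¹ * (m + 4)) * |ρ q|)
    (Ioi_mem_nhds (by linarith)) (Eventually.of_forall hmeas) ?_ ?_ ?_ ?_ ?_
  · have h := key.2.const_mul (gaussMass m (1 / 4))⁻¹
    refine h.congr_of_eventuallyEq ?_
    filter_upwards [Ioi_mem_nhds hs] with τ hτ
    rw [flow_eq ρ [] hτ, ← integral_const_mul]
    simp only [kerL_nil, ntL, List.map_nil, List.sum_nil, add_zero, mul_assoc]
  · have := (hρ.integrable_kerL_dil hα hα1 [] (dil (√√s)⁻¹ p) (√√s)⁻¹).const_mul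
      (√s ^ (m + 2))⁻¹
    simpa only [kerL_nil, mul_assoc] using this
  · exact ((((continuous_kerD_right _).comp (continuous_dil _)).measurable.const_mul _).mul
      (hρ.measurable hα hα1)).aestronglyMeasurable
  · refine Eventually.of_forall fun q τ hτ => ?_
    have hτ : s / 2 < τ := hτ
    have hs2 : 0 < s / 2 := by positivity
    have hτ0 : 0 < τ := hs2.trans hτ
    have h1 : √(s / 2) ≤ √τ := Real.sqrt_le_sqrt hτ.le
    have h2 : 0 < √(s / 2) := Real.sqrt_pos.2 hs2
    have h3 := abs_kerD_le (dil (√√τ)⁻¹ p) (dil (√√τ)⁻¹ q)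
    rw [Real.norm_eq_abs, abs_mul, abs_mul, abs_of_pos (a := (√τ ^ (m + 2))⁻¹ * τ⁻¹)
      (by positivity)]
    gcongr
  · exact (hρ.integrable hα hα1).abs.const_mul _
  · exact Eventually.of_forall fun q τ hτ =>
      (hasDerivAt_kernel p q (lt_trans (by positivity) hτ)).mul_const _

/-- The heat equation. -/
lemma IsSource.laplacian_flow (hα : 0 < α) (hα1 : α ≤ 1) (hρ : IsSource α A ρ) (p : Cover m)
    {s : ℝ} (hs : 0 < s) :
    flow ρ [Sum.inl 0, Sum.inl 0] s p + flow ρ [Sum.inl 1, Sum.inl 1] s p +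
      (‖p.1‖ ^ 2) ^ 2 * ∑ i : Fin m, flow ρ [Sum.inr i, Sum.inr i] s p =
    (‖p.1‖ ^ 2) ^ 2 * flowD ρ s p := by
  have hσ : 0 < √s := Real.sqrt_pos.2 hs
  have hi := fun l => hρ.integrable_kerL_dil hα hα1 l (dil (√√s)⁻¹ p) (√√s)⁻¹
  simp only [flow_eq ρ _ hs, flowD, ntL, nt, List.map_cons, List.map_nil, List.sum_cons,
    List.sum_nil, add_zero, Nat.reduceAdd]
  have e1 : (√s ^ (m + 2 + 2))⁻¹ = (√s ^ (m + 2))⁻¹ * s⁻¹ := by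
    rw [pow_add, mul_inv, Real.sq_sqrt hs.le]
  -- The factor 1/s of the time derivative is what turns |z|² into its rescaled value, so the
  -- identity at time one applies.
  have e2 : (‖p.1‖ ^ 2) ^ 2 * s⁻¹ = (‖(dil (√√s)⁻¹ p).1‖ ^ 2) ^ 2 := by
    rw [norm_sq_dil_inv, div_pow, Real.sq_sqrt hs.le, div_eq_mul_inv]
  have e3 : ∀ q, ((√s ^ (m + 2))⁻¹ * s⁻¹ * kerD (dil (√√s)⁻¹ p) (dil (√√s)⁻¹ q)) * ρ q =
      ((√s ^ (m + 2))⁻¹ * s⁻¹) * (kerD (dil (√√s)⁻¹ p) (dil (√√s)⁻¹ q) * ρ q) := fun q => by ring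
  rw [integral_congr_ae (Eventually.of_forall e3), integral_const_mul, e1]
  have key : (∫ q, kerL [Sum.inl 0, Sum.inl 0] (dil (√√s)⁻¹ p) (dil (√√s)⁻¹ q) * ρ q
        ∂(coverMeasure m)) +
      (∫ q, kerL [Sum.inl 1, Sum.inl 1] (dil (√√s)⁻¹ p) (dil (√√s)⁻¹ q) * ρ q ∂(coverMeasure m)) +
      (‖(dil (√√s)⁻¹ p).1‖ ^ 2) ^ 2 * ∑ i : Fin m,
        ∫ q, kerL [Sum.inr i, Sum.inr i] (dil (√√s)⁻¹ p) (dil (√√s)⁻¹ q) * ρ q ∂(coverMeasure m) =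
      (‖(dil (√√s)⁻¹ p).1‖ ^ 2) ^ 2 *
        ∫ q, kerD (dil (√√s)⁻¹ p) (dil (√√s)⁻¹ q) * ρ q ∂(coverMeasure m) := by
    have h12 : Integrable (fun q =>
        kerL [Sum.inl 0, Sum.inl 0] (dil (√√s)⁻¹ p) (dil (√√s)⁻¹ q) * ρ q +
        kerL [Sum.inl 1, Sum.inl 1] (dil (√√s)⁻¹ p) (dil (√√s)⁻¹ q) * ρ q) (coverMeasure m) :=
      (hi _).add (hi _)
    rw [← integral_finsetSum _ fun i _ => hi _, ← integral_const_mul, ← integral_const_mul,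
      ← integral_add (hi _) (hi _), ← integral_add h12
        ((integrable_finsetSum _ fun i _ => hi _).const_mul _)]
    refine integral_congr_ae (Eventually.of_forall fun q => ?_)
    have := laplacian_kerL (dil (√√s)⁻¹ p) (dil (√√s)⁻¹ q)
    simp only [kerD]
    rw [← mul_assoc, ← this, ← Finset.sum_mul]
    ring
  rw [← e2] at key
  simp only [← Finset.mul_sum]
  linear_combination (gaussMass m (1 / 4))⁻¹ * (√s ^ (m + 2))⁻¹ * key

lemma IsSource.tendsto_flow_zero (hα : 0 < α) (hα1 : α ≤ 1) (hρ : IsSource α A ρ) {p : Cover m}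
    (hp : p.1 ≠ 0) : Tendsto (fun s => flow ρ [] s p) (𝓝[>] 0) (𝓝 (ρ p)) := by
  obtain ⟨C, hC, h⟩ := exists_flow_sub_le (m := m) hα hα1
  rw [tendsto_iff_norm_sub_tendsto_zero]
  have h1 : Tendsto (fun s => C * A * √s ^ α) (𝓝[>] 0) (𝓝 0) := by
    have : Tendsto (fun s : ℝ => C * A * √s ^ α) (𝓝 0) (𝓝 (C * A * √0 ^ α)) := by
      have hc : Continuous fun s : ℝ => √s ^ α :=
        (Real.continuous_rpow_const hα.le).comp Real.continuous_sqrt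
      exact (continuous_const.mul hc).tendsto 0
    rw [Real.sqrt_zero, Real.zero_rpow hα.ne', mul_zero] at this
    exact this.mono_left nhdsWithin_le_nhds
  refine squeeze_zero' (Eventually.of_forall fun s => norm_nonneg _) ?_ h1
  filter_upwards [self_mem_nhdsWithin] with s hs
  exact h A ρ hρ.nonneg hρ.isSection hρ.holder s hs p hp

lemma IsSource.tendsto_flow_atTop (hα : 0 < α) (hα1 : α ≤ 1) (hρ : IsSource α A ρ) {p : Cover m}
    (hp : p.1 ≠ 0) : Tendsto (fun s => flow ρ [] s p) atTop (𝓝 0) := by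
  obtain ⟨C, hC, h⟩ := exists_flow_le_timeBound (m := m) hα hα1
  have h1 : Tendsto (fun s : ℝ => C * A * (1 + ‖p.1‖ ^ 2) ^ 3 * s ^ (-(3 / 2) : ℝ)) atTop
      (𝓝 0) := by
    have := (tendsto_rpow_neg_atTop (y := 3 / 2) (by norm_num)).const_mul
      (C * A * (1 + ‖p.1‖ ^ 2) ^ 3)
    rwa [mul_zero] at this
  refine squeeze_zero_norm' ?_ h1
  filter_upwards [eventually_gt_atTop 1] with s hs
  have := h [] (by simp) A ρ hρ s (by linarith) p hp
  rwa [timeBound, if_neg (not_le.2 hs)] at this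

/-- The Poisson equation for the time integral of the heat flow. -/
lemma IsSource.laplacian_pot (hα : 0 < α) (hα1 : α ≤ 1) (hρ : IsSource α A ρ) {p : Cover m}
    (hp : p.1 ≠ 0) :
    pot ρ (Ioi 0) [Sum.inl 0, Sum.inl 0] p + pot ρ (Ioi 0) [Sum.inl 1, Sum.inl 1] p +
      (‖p.1‖ ^ 2) ^ 2 * ∑ i : Fin m, pot ρ (Ioi 0) [Sum.inr i, Sum.inr i] p =
    (‖p.1‖ ^ 2) ^ 2 * ρ p := by
  have hi : ∀ a b : Fin 2 ⊕ Fin m, IntegrableOn (fun s => flow ρ [a, b] s p) (Ioi 0) :=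
    fun a b => hρ.integrableOn_flow hα hα1 (by simp) hp
  have hsum : IntegrableOn (fun s => flow ρ [Sum.inl 0, Sum.inl 0] s p +
      flow ρ [Sum.inl 1, Sum.inl 1] s p +
      (‖p.1‖ ^ 2) ^ 2 * ∑ i : Fin m, flow ρ [Sum.inr i, Sum.inr i] s p) (Ioi 0) :=
    ((hi _ _).add (hi _ _)).add ((integrable_finsetSum _ fun i _ => hi _ _).const_mul _)
  -- Integrability in time of the time derivative is inherited from the tangential derivatives
  -- through the heat equation. The term with factor 0 fits the formula for integration by parts
  -- against a constant.
  have hEq : ∀ s ∈ Ioi (0 : ℝ), flow ρ [Sum.inl 0, Sum.inl 0] s p +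
      flow ρ [Sum.inl 1, Sum.inl 1] s p +
      (‖p.1‖ ^ 2) ^ 2 * ∑ i : Fin m, flow ρ [Sum.inr i, Sum.inr i] s p =
      flowD ρ s p * (‖p.1‖ ^ 2) ^ 2 + flow ρ [] s p * 0 := fun s hs => by
    rw [hρ.laplacian_flow hα hα1 p hs]; ring
  -- The boundary values are 0 at infinity and ρ(p) at time zero; the minus sign in `pot` turns -ρ
  -- into ρ.
  have key := integral_Ioi_deriv_mul_eq_sub (a := (0 : ℝ)) (u := fun s => flow ρ [] s p)
    (u' := fun s => flowD ρ s p) (v := fun _ => (‖p.1‖ ^ 2) ^ 2) (v' := fun _ => 0)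
    (fun s hs => hρ.hasDerivAt_flow hα hα1 p hs) (fun s _ => hasDerivAt_const s _)
    (hsum.congr_fun hEq measurableSet_Ioi)
    ((hρ.tendsto_flow_zero hα hα1 hp).mul_const _) ((hρ.tendsto_flow_atTop hα hα1 hp).mul_const _)
  have h12 : IntegrableOn (fun s => flow ρ [Sum.inl 0, Sum.inl 0] s p +
      flow ρ [Sum.inl 1, Sum.inl 1] s p) (Ioi 0) := (hi _ _).add (hi _ _)
  rw [← setIntegral_congr_fun measurableSet_Ioi hEq, integral_add h12
    ((integrable_finsetSum _ fun i _ => hi _ _).const_mul _), integral_add (hi _ _) (hi _ _),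
    integral_const_mul, integral_finsetSum _ fun i _ => hi _ _] at key
  simp only [pot, Finset.sum_neg_distrib]
  linear_combination -key

end

/-! ### The weak equation -/

/-- The potential and its fluxes are controlled only off the singular set; test sections are
supported there, so products extend by zero. -/
lemma continuous_mul_of_tsupport {F G : Cover m → ℝ} {U : Set (Cover m)} (hU : IsOpen U)
    (hF : ContinuousOn F U) (hG : Continuous G) (hGU : tsupport G ⊆ U) :
    Continuous fun p => F p * G p := by
  rw [continuous_iff_continuousAt]
  intro p
  by_cases hp : p ∈ tsupport G
  · exact (hF.continuousAt (hU.mem_nhds (hGU hp))).mul hG.continuousAt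
  · have h : (fun p => F p * G p) =ᶠ[𝓝 p] fun _ => 0 := by
      filter_upwards [(isClosed_tsupport G).isOpen_compl.mem_nhds hp] with q hq
      rw [image_eq_zero_of_notMem_tsupport hq, mul_zero]
    exact continuousAt_const.congr h.symm

lemma integrable_mul_of_tsupport {F G : Cover m → ℝ} {U : Set (Cover m)} (hU : IsOpen U)
    (hF : ContinuousOn F U) (hG : Continuous G) (hGU : tsupport G ⊆ U)
    (hGc : HasCompactSupport G) : Integrable fun p => F p * G p :=
  (continuous_mul_of_tsupport hU hF hG hGU).integrable_of_hasCompactSupport hGc.mul_left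

lemma ae_volume_fst_ne_zero : ∀ᵐ p : Cover m, p.1 ≠ 0 := by
  rw [ae_iff]; simpa using volume_fst_eq_zero (m := m)

section

variable {ψ F : Cover m → ℝ}

lemma IsTestSection.differentiable (hψ : IsTestSection ψ) : Differentiable ℝ ψ :=
  hψ.smooth.differentiable (by simp)

lemma IsTestSection.continuous_fderiv (hψ : IsTestSection ψ) (v : Cover m) :
    Continuous fun p => fderiv ℝ ψ p v :=
  (hψ.smooth.continuous_fderiv (by simp)).clm_apply continuous_const

lemma IsTestSection.hasCompactSupport_fderiv (hψ : IsTestSection ψ) (v : Cover m) :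
    HasCompactSupport fun p => fderiv ℝ ψ p v :=
  hψ.compact.fderiv_apply (𝕜 := ℝ) v

lemma IsTestSection.tsupport_fderiv (hψ : IsTestSection ψ) (v : Cover m) :
    tsupport (fun p => fderiv ℝ ψ p v) ⊆ {p | p.1 ≠ 0} :=
  (tsupport_fderiv_apply_subset ℝ v).trans hψ.away

lemma IsTestSection.integrable_mul (hψ : IsTestSection ψ)
    (hF : ContinuousOn F {p | p.1 ≠ 0}) : Integrable fun p => F p * ψ p :=
  integrable_mul_of_tsupport isOpen_regular hF hψ.smooth.continuous hψ.away hψ.compact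

lemma IsTestSection.integrable_mul_fderiv (hψ : IsTestSection ψ)
    (hF : ContinuousOn F {p | p.1 ≠ 0}) (v : Cover m) :
    Integrable fun p => F p * fderiv ℝ ψ p v :=
  integrable_mul_of_tsupport isOpen_regular hF (hψ.continuous_fderiv v)
    (hψ.tsupport_fderiv v) (hψ.hasCompactSupport_fderiv v)

lemma continuousOn_fderiv_regular (hF : ContDiffOn ℝ 1 F {p | p.1 ≠ 0}) (v : Cover m) :
    ContinuousOn (fun p => fderiv ℝ F p v) {p | p.1 ≠ 0} :=
  (hF.continuousOn_fderiv_of_isOpen isOpen_regular le_rfl).clm_apply continuousOn_const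

/-- No boundary term arises at the singular set, since ψ vanishes near it. -/
lemma IsTestSection.integral_mul_fderiv (hψ : IsTestSection ψ)
    (hF : ContDiffOn ℝ 1 F {p | p.1 ≠ 0}) (v : Cover m) :
    ∫ p, F p * fderiv ℝ ψ p v = -∫ p, fderiv ℝ F p v * ψ p := by
  have h1 := hψ.integrable_mul_fderiv hF.continuousOn v
  have h2 := hψ.integrable_mul (continuousOn_fderiv_regular hF v)
  have h3 := hψ.integrable_mul hF.continuousOn
  rw [Measure.volume_eq_prod] at *
  refine integral_mul_fderiv_eq_neg_fderiv_mul_of_integrable h2 h1 h3 ?_ ?_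
  · intro p hp
    exact (hF.differentiableOn one_ne_zero).differentiableAt (isOpen_regular.mem_nhds (hψ.away hp))
  · exact fun p _ => hψ.differentiable p

end

/-! ### The frame and the Dirichlet form in coordinates of the double cover. -/

lemma along_frame_inl_zero (f : Cover m → ℝ) (p : Cover m) :
    along (frame (Sum.inl 0)) f p = fderiv ℝ f p (p.1⁻¹ / 2, 0) := by
  simp only [along, frame, lift]
  congr 2
  change 1 / (2 * p.1) = _
  rw [one_div, mul_inv, div_eq_inv_mul]

lemma along_frame_inl_one (f : Cover m → ℝ) (p : Cover m) :
    along (frame (Sum.inl 1)) f p = fderiv ℝ f p (Complex.I * p.1⁻¹ / 2, 0) := by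
  simp only [along, frame, lift]
  congr 2
  change Complex.I / (2 * p.1) = _
  rw [div_eq_mul_inv, mul_inv]; ring

lemma along_frame_inr (i : Fin m) (f : Cover m → ℝ) (p : Cover m) :
    along (frame (Sum.inr i)) f p = fderiv ℝ f p (0, EuclideanSpace.single i 1) := by
  simp [along, frame, lift]

lemma map_fst_eq (L : Cover m →L[ℝ] ℝ) (c : ℂ) :
    L (c, 0) = c.re * L (1, 0) + c.im * L (Complex.I, 0) := by
  have h : ((c, 0) : Cover m) = c.re • ((1, 0) : Cover m) + c.im • ((Complex.I, 0) : Cover m) := by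
    apply Prod.ext
    · simp
    · simp
  rw [h, map_add, map_smul, map_smul, smul_eq_mul, smul_eq_mul]

section

variable {F : List (Fin 2 ⊕ Fin m) → Cover m → ℝ} {n : ℕ∞} {p : Cover m}

lemma IsTower.fderiv_apply (hF : IsTower n F) {l : List (Fin 2 ⊕ Fin m)}
    (hl : (l.length : ℕ∞) < n) (hp : p.1 ≠ 0) (v : Cover m) :
    fderiv ℝ (F l) p v = F (Sum.inl 0 :: l) p * (2 * p.1⁻¹ * v.1).re +
      F (Sum.inl 1 :: l) p * (2 * p.1⁻¹ * v.1).im + ∑ i, F (Sum.inr i :: l) p * v.2 i := by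
  rw [(hF l hl p hp).fderiv, sum_apply, Fintype.sum_sum_type, Fin.sum_univ_two]
  simp only [smul_apply, smul_eq_mul, cof_inl_zero, cof_inl_one, cof_inr, div_eq_mul_inv]

/-- In the plane ∂_x = Re(1/z) r∂_r + Im(1/z) ∂_θ, and 1/z = w⁻². -/
lemma IsTower.along_frame_inl_zero (hF : IsTower n F) (hn : 0 < n) (hp : p.1 ≠ 0) :
    along (frame (Sum.inl 0)) (F []) p =
      F [Sum.inl 0] p * (p.1⁻¹ ^ 2).re + F [Sum.inl 1] p * (p.1⁻¹ ^ 2).im := by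
  rw [BranchedModel.along_frame_inl_zero, hF.fderiv_apply (by simpa using hn) hp]
  rw [show 2 * p.1⁻¹ * (p.1⁻¹ / 2) = p.1⁻¹ ^ 2 by ring]
  simp

lemma IsTower.along_frame_inl_one (hF : IsTower n F) (hn : 0 < n) (hp : p.1 ≠ 0) :
    along (frame (Sum.inl 1)) (F []) p =
      F [Sum.inl 1] p * (p.1⁻¹ ^ 2).re - F [Sum.inl 0] p * (p.1⁻¹ ^ 2).im := by
  rw [BranchedModel.along_frame_inl_one, hF.fderiv_apply (by simpa using hn) hp]
  rw [show 2 * p.1⁻¹ * (Complex.I * p.1⁻¹ / 2) = Complex.I * p.1⁻¹ ^ 2 by ring]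
  simp; ring

lemma IsTower.along_frame_inr (hF : IsTower n F) (hn : 0 < n) (hp : p.1 ≠ 0) (i : Fin m) :
    along (frame (Sum.inr i)) (F []) p = F [Sum.inr i] p := by
  rw [BranchedModel.along_frame_inr, hF.fderiv_apply (by simpa using hn) hp]
  simp

end

lemma inv_re_sq_add_inv_im_sq {w : ℂ} (hw : w ≠ 0) :
    (w⁻¹.re ^ 2 + w⁻¹.im ^ 2) * ‖w‖ ^ 2 = 1 := by
  have h : w⁻¹.re ^ 2 + w⁻¹.im ^ 2 = ‖w⁻¹‖ ^ 2 := by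
    rw [Complex.sq_norm, Complex.normSq_apply]; ring
  rw [h, norm_inv, inv_pow, inv_mul_cancel₀]
  have := norm_pos_iff.2 hw
  positivity

/-- The flux of a tower through the first direction. -/
def flux₁ (F : List (Fin 2 ⊕ Fin m) → Cover m → ℝ) (p : Cover m) : ℝ :=
  F [Sum.inl 0] p * p.1⁻¹.re + F [Sum.inl 1] p * p.1⁻¹.im

/-- The flux of a tower through the second direction. -/
def flux₂ (F : List (Fin 2 ⊕ Fin m) → Cover m → ℝ) (p : Cover m) : ℝ :=
  F [Sum.inl 1] p * p.1⁻¹.re - F [Sum.inl 0] p * p.1⁻¹.im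

/-- The flux of a tower through the direction of `tᵢ`. -/
def fluxT (F : List (Fin 2 ⊕ Fin m) → Cover m → ℝ) (i : Fin m) (p : Cover m) : ℝ :=
  2 * ‖p.1‖ ^ 2 * F [Sum.inr i] p

section

variable {F : List (Fin 2 ⊕ Fin m) → Cover m → ℝ} {p : Cover m} {n : ℕ∞}

/-- The planar Dirichlet form is conformally invariant: the density 2|w|² cancels in the
w-directions, where each flux is half a partial derivative in w, and survives only in the
t-directions. -/
lemma IsTower.grad_mul_grad (hF : IsTower n F) (hn : 0 < n) (hp : p.1 ≠ 0) (ψ : Cover m → ℝ) :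
    2 * ‖p.1‖ ^ 2 * ∑ a, along (frame a) (F []) p * along (frame a) ψ p =
      flux₁ F p * fderiv ℝ ψ p (1, 0) + flux₂ F p * fderiv ℝ ψ p (Complex.I, 0) +
        ∑ i, fluxT F i p * fderiv ℝ ψ p (0, EuclideanSpace.single i 1) := by
  rw [Fintype.sum_sum_type, Fin.sum_univ_two, hF.along_frame_inl_zero hn hp,
    hF.along_frame_inl_one hn hp, BranchedModel.along_frame_inl_zero,
    BranchedModel.along_frame_inl_one,
    map_fst_eq _ (p.1⁻¹ / 2), map_fst_eq _ (Complex.I * p.1⁻¹ / 2)]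
  have h1 : ∑ i : Fin m, along (frame (Sum.inr i)) (F []) p * along (frame (Sum.inr i)) ψ p =
      ∑ i, F [Sum.inr i] p * fderiv ℝ ψ p (0, EuclideanSpace.single i 1) :=
    Finset.sum_congr rfl fun i _ => by rw [hF.along_frame_inr hn hp, BranchedModel.along_frame_inr]
  have h2 : ∑ i, fluxT F i p * fderiv ℝ ψ p (0, EuclideanSpace.single i 1) = 2 * ‖p.1‖ ^ 2 *
      ∑ i, F [Sum.inr i] p * fderiv ℝ ψ p (0, EuclideanSpace.single i 1) := by
    rw [Finset.mul_sum]; exact Finset.sum_congr rfl fun i _ => by rw [fluxT]; ring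
  have e1 : (p.1⁻¹ ^ 2).re = p.1⁻¹.re ^ 2 - p.1⁻¹.im ^ 2 := by
    rw [pow_two, Complex.mul_re]; ring
  have e2 : (p.1⁻¹ ^ 2).im = 2 * p.1⁻¹.re * p.1⁻¹.im := by
    rw [pow_two, Complex.mul_im]; ring
  have e3 : (p.1⁻¹ / 2).re = p.1⁻¹.re / 2 := by simp
  have e4 : (p.1⁻¹ / 2).im = p.1⁻¹.im / 2 := by simp
  have e5 : (Complex.I * p.1⁻¹ / 2).re = -p.1⁻¹.im / 2 := by
    rw [mul_div_assoc, Complex.I_mul_re, e4]; ring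
  have e6 : (Complex.I * p.1⁻¹ / 2).im = p.1⁻¹.re / 2 := by
    rw [mul_div_assoc, Complex.I_mul_im, e3]
  have hN := inv_re_sq_add_inv_im_sq hp
  rw [h1, h2, e1, e2, e3, e4, e5, e6, flux₁, flux₂]
  generalize p.1⁻¹.re = c at *
  generalize p.1⁻¹.im = d at *
  linear_combination (F [Sum.inl 0] p * (c * fderiv ℝ ψ p (1, 0) - d *
    fderiv ℝ ψ p (Complex.I, 0)) + F [Sum.inl 1] p * (d * fderiv ℝ ψ p (1, 0) + c *
    fderiv ℝ ψ p (Complex.I, 0))) * hN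

lemma hasFDerivAt_inv_re (hp : p.1 ≠ 0) : HasFDerivAt (fun p : Cover m => p.1⁻¹.re)
    (Complex.reCLM.comp ((ContinuousLinearMap.mul ℝ ℂ (-p.1⁻¹ ^ 2)).comp
      (ContinuousLinearMap.fst ℝ ℂ (EuclideanSpace ℝ (Fin m))))) p ∧
    HasFDerivAt (fun p : Cover m => p.1⁻¹.im)
    (Complex.imCLM.comp ((ContinuousLinearMap.mul ℝ ℂ (-p.1⁻¹ ^ 2)).comp
      (ContinuousLinearMap.fst ℝ ℂ (EuclideanSpace ℝ (Fin m))))) p := by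
  have h0 : HasFDerivAt (fun w : ℂ => w⁻¹) (ContinuousLinearMap.mul ℝ ℂ (-p.1⁻¹ ^ 2)) p.1 := by
    have := (hasDerivAt_inv hp).complexToReal_fderiv
    refine this.congr_fderiv ?_
    refine ContinuousLinearMap.ext fun v => ?_
    simp [inv_pow]
  have h1 := h0.comp p (hasFDerivAt_fst (𝕜 := ℝ) (p := p))
  exact ⟨Complex.reCLM.hasFDerivAt.comp p h1, Complex.imCLM.hasFDerivAt.comp p h1⟩

/-- The coefficients are the real and imaginary parts of the holomorphic function 1/w. By the
Cauchy-Riemann equations their derivatives cancel, and the mixed second derivatives cancel as well.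
-/
lemma IsTower.div_flux (hF : IsTower 2 F) (hp : p.1 ≠ 0) :
    fderiv ℝ (flux₁ F) p (1, 0) + fderiv ℝ (flux₂ F) p (Complex.I, 0) =
      2 * (p.1⁻¹.re ^ 2 + p.1⁻¹.im ^ 2) *
        (F [Sum.inl 0, Sum.inl 0] p + F [Sum.inl 1, Sum.inl 1] p) := by
  have hl : ∀ a : Fin 2 ⊕ Fin m, (([a] : List (Fin 2 ⊕ Fin m)).length : ℕ∞) < 2 := fun a => by
    simp
  have d := fun a => (hF [a] (hl a) p hp).differentiableAt.hasFDerivAt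
  obtain ⟨hr, hi⟩ := hasFDerivAt_inv_re hp
  have h1 : HasFDerivAt (flux₁ F) _ p := ((d (Sum.inl 0)).mul hr).add ((d (Sum.inl 1)).mul hi)
  have h2 : HasFDerivAt (flux₂ F) _ p := ((d (Sum.inl 1)).mul hr).sub ((d (Sum.inl 0)).mul hi)
  rw [h1.fderiv, h2.fderiv]
  simp only [add_apply, sub_apply, smul_apply, smul_eq_mul, ContinuousLinearMap.comp_apply,
    hF.fderiv_apply (hl _) hp, ContinuousLinearMap.mul_apply', ContinuousLinearMap.coe_fst',
    Complex.reCLM_apply, Complex.imCLM_apply, mul_one]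
  simp
  ring

lemma IsTower.fderiv_fluxT (hF : IsTower 2 F) (hp : p.1 ≠ 0) (i : Fin m) :
    fderiv ℝ (fluxT F i) p (0, EuclideanSpace.single i 1) =
      2 * ‖p.1‖ ^ 2 * F [Sum.inr i, Sum.inr i] p := by
  have hl : (([Sum.inr i] : List (Fin 2 ⊕ Fin m)).length : ℕ∞) < 2 := by simp
  have d := (hF [Sum.inr i] hl p hp).differentiableAt.hasFDerivAt
  have h0 : HasFDerivAt (fun p : Cover m => ‖p.1‖ ^ 2)
      ((2 • (innerSL ℝ p.1)).comp (ContinuousLinearMap.fst ℝ ℂ (EuclideanSpace ℝ (Fin m)))) p :=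
    (hasStrictFDerivAt_norm_sq p.1).hasFDerivAt.comp p hasFDerivAt_fst
  have h1 : HasFDerivAt (fluxT F i) _ p := (h0.const_mul 2).mul d
  rw [h1.fderiv]
  simp [hF.fderiv_apply hl hp]

end

section

variable {α A : ℝ} {ρ : Cover m → ℝ}

lemma IsSource.contDiffOn_pot_one (hα : 0 < α) (hα1 : α ≤ 1) (hρ : IsSource α A ρ)
    (a : Fin 2 ⊕ Fin m) : ContDiffOn ℝ 1 (pot ρ (Ioi 0) [a]) {p | p.1 ≠ 0} := by
  have h := IsTower.contDiffOn (k := 1) (l := [a])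
    (hρ.isTower_pot hα hα1 measurableSet_Ioi Subset.rfl) fun l' hl' p hp =>
      (hρ.continuousAt_pot hα hα1 measurableSet_Ioi Subset.rfl
        (by simp at hl'; omega) hp).continuousWithinAt
  exact_mod_cast h

/-- The weak form of the Poisson equation. -/
lemma IsSource.weak_eq (hα : 0 < α) (hα1 : α ≤ 1) (hρ : IsSource α A ρ) {ψ : Cover m → ℝ}
    (hψ : IsTestSection ψ) :
    ∫ p, ∑ a, along (frame a) (pot ρ (Ioi 0) []) p * along (frame a) ψ p ∂(coverMeasure m) =
      -∫ p, ρ p * ψ p ∂(coverMeasure m) := by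
  set F := pot ρ (Ioi 0) with hFdef
  have hF : IsTower 2 F := hρ.isTower_pot hα hα1 measurableSet_Ioi Subset.rfl
  have hc := fun a => hρ.contDiffOn_pot_one hα hα1 a
  have hinv : ContDiffOn ℝ 1 (fun p : Cover m => p.1⁻¹) {p : Cover m | p.1 ≠ 0} :=
    ContDiffOn.inv (f := fun p : Cover m => p.1) contDiff_fst.contDiffOn fun p hp => hp
  have hre : ContDiffOn ℝ 1 (fun p : Cover m => p.1⁻¹.re) {p : Cover m | p.1 ≠ 0} :=
    Complex.reCLM.contDiff.comp_contDiffOn hinv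
  have him : ContDiffOn ℝ 1 (fun p : Cover m => p.1⁻¹.im) {p : Cover m | p.1 ≠ 0} :=
    Complex.imCLM.contDiff.comp_contDiffOn hinv
  have c1 : ContDiffOn ℝ 1 (flux₁ F) {p | p.1 ≠ 0} := ((hc _).mul hre).add ((hc _).mul him)
  have c2 : ContDiffOn ℝ 1 (flux₂ F) {p | p.1 ≠ 0} := ((hc _).mul hre).sub ((hc _).mul him)
  have cT : ∀ i, ContDiffOn ℝ 1 (fluxT F i) {p | p.1 ≠ 0} := fun i =>
    (contDiff_const.mul (contDiff_fst.norm_sq ℝ)).contDiffOn.mul (hc _)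
  rw [integral_coverMeasure, integral_coverMeasure]
  have e1 : ∫ p : Cover m, 2 * ‖p.1‖ ^ 2 * ∑ a, along (frame a) (F []) p * along (frame a) ψ p =
      ∫ p, (flux₁ F p * fderiv ℝ ψ p (1, 0) + flux₂ F p * fderiv ℝ ψ p (Complex.I, 0) +
        ∑ i, fluxT F i p * fderiv ℝ ψ p (0, EuclideanSpace.single i 1)) :=
    integral_congr_ae (ae_volume_fst_ne_zero.mono fun p hp =>
      hF.grad_mul_grad (by norm_num) hp ψ)
  have i1 := hψ.integrable_mul_fderiv c1.continuousOn (1, 0)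
  have i2 := hψ.integrable_mul_fderiv c2.continuousOn (Complex.I, 0)
  have iT := fun i => hψ.integrable_mul_fderiv (cT i).continuousOn
    (0, EuclideanSpace.single i 1)
  have j1 := hψ.integrable_mul (continuousOn_fderiv_regular c1 (1, 0))
  have j2 := hψ.integrable_mul (continuousOn_fderiv_regular c2 (Complex.I, 0))
  have jT := fun i => hψ.integrable_mul (continuousOn_fderiv_regular (cT i)
    (0, EuclideanSpace.single i 1))
  have i12 : Integrable fun p => flux₁ F p * fderiv ℝ ψ p (1, 0) +
      flux₂ F p * fderiv ℝ ψ p (Complex.I, 0) := i1.add i2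
  have j12 : Integrable fun p => fderiv ℝ (flux₁ F) p (1, 0) * ψ p +
      fderiv ℝ (flux₂ F) p (Complex.I, 0) * ψ p := j1.add j2
  rw [e1, integral_add i12 (integrable_finsetSum _ fun i _ => iT i), integral_add i1 i2,
    integral_finsetSum _ fun i _ => iT i, hψ.integral_mul_fderiv c1, hψ.integral_mul_fderiv c2,
    Finset.sum_congr rfl fun i _ => hψ.integral_mul_fderiv (cT i) _, Finset.sum_neg_distrib,
    ← integral_finsetSum _ fun i _ => jT i, ← neg_add, ← integral_add j1 j2, ← neg_add,
    ← integral_add j12 (integrable_finsetSum _ fun i _ => jT i)]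
  congr 1
  refine integral_congr_ae (ae_volume_fst_ne_zero.mono fun p hp => ?_)
  have h1 := hF.div_flux hp
  have h2 : ∑ i, fderiv ℝ (fluxT F i) p (0, EuclideanSpace.single i 1) * ψ p =
      (2 * ‖p.1‖ ^ 2 * ∑ i, F [Sum.inr i, Sum.inr i] p) * ψ p := by
    rw [Finset.mul_sum, Finset.sum_mul]
    exact Finset.sum_congr rfl fun i _ => by rw [hF.fderiv_fluxT hp]
  have h3 := hρ.laplacian_pot hα hα1 hp
  rw [← hFdef] at h3
  have hN := inv_re_sq_add_inv_im_sq hp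
  simp only
  rw [h2, ← add_mul, h1]
  generalize p.1⁻¹.re ^ 2 + p.1⁻¹.im ^ 2 = N at *
  have hw : ‖p.1‖ ^ 2 ≠ 0 := pow_ne_zero 2 (norm_ne_zero_iff.2 hp)
  have hN' : N = (‖p.1‖ ^ 2)⁻¹ := eq_inv_of_mul_eq_one_left hN
  rw [hN']
  field_simp
  linear_combination ψ p * h3

end

/-! ### Decay of the solution -/

/-- The rate of decay of the solution at infinity. -/
def dec (p : Cover m) : ℝ := (1 + baseNorm p) ^ (-((m : ℝ) + 3 / 4))

lemma dec_pos (p : Cover m) : 0 < dec p :=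
  Real.rpow_pos_of_pos (by linarith [baseNorm_nonneg p]) _

/-- An integrable bound for the time dependence of the heat flow, away from the singular set. -/
def timeWeight (s : ℝ) : ℝ := if s ≤ 1 then (√s)⁻¹ else s ^ (-(9 / 8) : ℝ)

lemma timeWeight_nonneg {s : ℝ} (hs : 0 < s) : 0 ≤ timeWeight s := by
  unfold timeWeight; split_ifs <;> positivity

lemma integrableOn_timeWeight : IntegrableOn timeWeight (Ioi 0) := by
  rw [← Ioc_union_Ioi_eq_Ioi (zero_le_one' ℝ)]
  refine IntegrableOn.union ?_ ?_
  · have h := (intervalIntegral.intervalIntegrable_rpow' (a := 0) (b := 1)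
      (show -1 < (-(1 / 2) : ℝ) by norm_num)).1
    refine h.congr_fun (fun s hs => ?_) measurableSet_Ioc
    have := sqrt_pow_inv hs.1 1
    simp only [pow_one, Nat.cast_one] at this
    simp [timeWeight, hs.2, this]
  · have h := integrableOn_Ioi_rpow_of_lt (show (-(9 / 8) : ℝ) < -1 by norm_num) one_pos
    refine h.congr_fun (fun s hs => ?_) measurableSet_Ioi
    have : ¬ s ≤ 1 := not_le.2 hs
    simp [timeWeight, this]

/-- Extracts a factor |w| uniformly in time. For |z| ≤ √s it is the vanishing of the flow. For |z| >
√s and s ≤ 1 it is free, since |w|/√s ≥ 1. For s > 1 it comes from the decay estimate. -/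
lemma exists_flow_le_near {α : ℝ} (hα : 0 < α) (hα1 : α ≤ 1) :
    ∃ C, 0 < C ∧ ∀ l : List (Fin 2 ⊕ Fin m), l.length ≤ 1 → ∀ (A : ℝ) (ρ : Cover m → ℝ),
      IsSource α A ρ → ∀ s, 0 < s → ∀ p : Cover m, p.1 ≠ 0 → ‖p.1‖ ^ 2 ≤ 2 →
      (‖p.1‖ ^ 2) ^ ntL l * |flow ρ l s p| ≤ C * A * ‖p.1‖ * timeWeight s := by
  obtain ⟨C, hC, h⟩ := exists_flow_bounds (m := m) hα hα1 1
  refine ⟨16 * C + 24, by positivity, fun l hl A ρ hρ s hs p hp hr2 => ?_⟩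
  obtain ⟨h1, h2, h3, h4⟩ := h l hl A ρ hρ s hs p hp
  have hA := hρ.nonneg
  have hσ : 0 < √s := Real.sqrt_pos.2 hs
  have hw : 0 < ‖p.1‖ := norm_pos_iff.2 hp
  have hwt := wtL_add_ntL l
  have hw2 : ‖p.1‖ ≤ 2 := by nlinarith
  have hrnt : (‖p.1‖ ^ 2) ^ ntL l ≤ 2 := by
    rcases (by omega : ntL l = 0 ∨ ntL l = 1) with h0 | h0 <;>
      rw [h0] <;> norm_num
    linarith
  unfold timeWeight
  split_ifs with hs1
  · have hσ1 : √s ≤ 1 := Real.sqrt_le_one.2 hs1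
    have hX : √s ^ α ≤ 1 := Real.rpow_le_one hσ.le hσ1 hα.le
    have hτ : 0 < √√s := Real.sqrt_pos.2 hσ
    have hτ2 : √√s ^ 2 = √s := Real.sq_sqrt hσ.le
    have hτ1 : √√s ≤ 1 := Real.sqrt_le_one.2 hσ1
    have hτσ : (√√s)⁻¹ ≤ (√s)⁻¹ := inv_anti₀ hσ (by nlinarith)
    rcases le_or_gt (‖p.1‖ ^ 2) (√s) with hc | hc
    · have e1 : (‖p.1‖ ^ 2) ^ ntL l * (√s ^ ntL l)⁻¹ ≤ 1 := by
        rw [← inv_pow, ← mul_pow, ← div_eq_mul_inv]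
        exact pow_le_one₀ (by positivity) ((div_le_one hσ).2 hc)
      have e2 : (1 + ‖p.1‖ ^ 2 / √s) ^ (wtL l + 2) ≤ 8 := by
        have : ‖p.1‖ ^ 2 / √s ≤ 1 := (div_le_one hσ).2 hc
        calc _ ≤ (2 : ℝ) ^ (wtL l + 2) := pow_le_pow_left₀ (by positivity) (by linarith) _
          _ ≤ 2 ^ 3 := pow_le_pow_right₀ (by norm_num) (by omega)
          _ = 8 := by norm_num
      calc _ ≤ (‖p.1‖ ^ 2) ^ ntL l * (C * A * √s ^ α * (√s ^ ntL l)⁻¹ * (‖p.1‖ * (√√s)⁻¹) *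
            (1 + ‖p.1‖ ^ 2 / √s) ^ (wtL l + 2)) := by gcongr
        _ = C * A * √s ^ α * ((‖p.1‖ ^ 2) ^ ntL l * (√s ^ ntL l)⁻¹) * (‖p.1‖ * (√√s)⁻¹) *
            (1 + ‖p.1‖ ^ 2 / √s) ^ (wtL l + 2) := by ring
        _ ≤ C * A * 1 * 1 * (‖p.1‖ * (√s)⁻¹) * 8 := by gcongr
        _ = 8 * C * A * ‖p.1‖ * (√s)⁻¹ := by ring
        _ ≤ _ := by gcongr; linarith
    · have hτw : √√s ≤ ‖p.1‖ := by
        rw [← Real.sqrt_sq hw.le]; exact Real.sqrt_le_sqrt hc.le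
      have hwσ : 1 ≤ ‖p.1‖ * (√s)⁻¹ := by
        calc 1 ≤ ‖p.1‖ * (√√s)⁻¹ := by
              rw [← div_eq_mul_inv]; exact (one_le_div hτ).2 hτw
          _ ≤ _ := by gcongr
      rcases eq_or_ne l [] with rfl | hne
      · have e2 := hρ.holder.abs_le_growth hα hα1 hA hρ.isSection p
        have e3 : |flow ρ [] s p| ≤ 24 * A + C * A := by
          have := abs_add_le (flow ρ [] s p - ρ p) (ρ p)
          rw [sub_add_cancel] at this
          have e4 : C * A * √s ^ α ≤ C * A * 1 := by gcongr
          nlinarith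
        calc _ ≤ (24 * A + C * A) * 1 := by simpa [ntL] using e3
          _ ≤ (24 * A + C * A) * (‖p.1‖ * (√s)⁻¹) := by gcongr
          _ = (24 + C) * A * ‖p.1‖ * (√s)⁻¹ := by ring
          _ ≤ _ := by gcongr ?_ * A * ‖p.1‖ * (√s)⁻¹; linarith
      · have hlen : l.length = 1 := by
          have : l.length ≠ 0 := by simpa using hne
          omega
        have h1' := h1 hne
        rw [hlen, pow_one] at h1'
        have e1 : (‖p.1‖ ^ 2) ^ ntL l * (√s + ‖p.1‖ ^ 2) ^ wtL l ≤ 2 * ‖p.1‖ ^ 2 := by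
          rcases (by omega : (ntL l = 0 ∧ wtL l = 1) ∨ (ntL l = 1 ∧ wtL l = 0)) with h0 | h0 <;>
            rw [h0.1, h0.2] <;> norm_num <;> linarith
        calc _ ≤ (‖p.1‖ ^ 2) ^ ntL l * (C * A * √s ^ α * (√s)⁻¹ *
              (√s + ‖p.1‖ ^ 2) ^ wtL l) := by gcongr
          _ = C * A * √s ^ α * (√s)⁻¹ *
              ((‖p.1‖ ^ 2) ^ ntL l * (√s + ‖p.1‖ ^ 2) ^ wtL l) := by ring
          _ ≤ C * A * 1 * (√s)⁻¹ * (2 * ‖p.1‖ ^ 2) := by gcongr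
          _ = 2 * C * A * ‖p.1‖ * (√s)⁻¹ * ‖p.1‖ := by ring
          _ ≤ 2 * C * A * ‖p.1‖ * (√s)⁻¹ * 2 := by gcongr
          _ = 4 * C * A * ‖p.1‖ * (√s)⁻¹ := by ring
          _ ≤ _ := by gcongr; linarith
  · have hs1' : 1 ≤ s := (not_le.1 hs1).le
    have hσ1 : 1 ≤ √s := Real.one_le_sqrt.2 hs1'
    have e0 : (√s ^ 3)⁻¹ ≤ s ^ (-(9 / 8) : ℝ) := by
      rw [sqrt_pow_inv hs]
      exact Real.rpow_le_rpow_of_exponent_le hs1' (by norm_num)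
    have e1 : Real.exp (-(1 / 16) * (max (baseNorm p - 1) 0 / √s) ^ 2) ≤ 1 := by
      apply Real.exp_le_one_iff.2
      nlinarith [sq_nonneg (max (baseNorm p - 1) 0 / √s)]
    have e2 : (√s ^ (m + 3 + ntL l))⁻¹ ≤ s ^ (-(9 / 8) : ℝ) :=
      (inv_anti₀ (by positivity) (pow_le_pow_right₀ hσ1 (by omega))).trans e0
    have e3 : (1 + ‖p.1‖ ^ 2 / √s) ^ wtL l ≤ 3 := by
      have : ‖p.1‖ ^ 2 / √s ≤ 2 := (div_le_self (by positivity) hσ1).trans hr2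
      calc _ ≤ (3 : ℝ) ^ wtL l := pow_le_pow_left₀ (by positivity) (by linarith) _
        _ ≤ 3 ^ 1 := pow_le_pow_right₀ (by norm_num) (by omega)
        _ = 3 := by norm_num
    have e4 : |flow ρ l s p| ≤ C * A * ‖p.1‖ * s ^ (-(9 / 8) : ℝ) * 3 * 1 := by
      refine h4.trans (mul_le_mul ?_ e1 (Real.exp_pos _).le (by positivity))
      gcongr
    calc _ ≤ 2 * (C * A * ‖p.1‖ * s ^ (-(9 / 8) : ℝ) * 3 * 1) := by gcongr
      _ = 6 * C * A * ‖p.1‖ * s ^ (-(9 / 8) : ℝ) := by ring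
      _ ≤ _ := by gcongr; linarith

/-- The Gaussian exp(-y²/64), y = R/√s, is traded for powers of 1 + y. Of the available √s^{-(m+3)},
a power m + 3/4 becomes decay in R. The remaining √s^{-9/4} = s^{-9/8} is still integrable at
infinity. -/
lemma exists_flow_le_far {α : ℝ} (hα : 0 < α) (hα1 : α ≤ 1) :
    ∃ C, 0 < C ∧ ∀ l : List (Fin 2 ⊕ Fin m), l.length ≤ 1 → ∀ (A : ℝ) (ρ : Cover m → ℝ),
      IsSource α A ρ → ∀ s, 0 < s → ∀ p : Cover m, p.1 ≠ 0 → 2 ≤ baseNorm p →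
      (‖p.1‖ ^ 2) ^ ntL l * |flow ρ l s p| ≤
        C * A * ‖p.1‖ * baseNorm p ^ (-((m : ℝ) + 3 / 4)) * timeWeight s := by
  obtain ⟨C, hC, h⟩ := exists_flow_bounds (m := m) hα hα1 1
  obtain ⟨C', hC', h'⟩ := exists_pow_mul_exp_le (m + 4) (c := 1 / 64) (by norm_num)
  refine ⟨C * C', by positivity, fun l hl A ρ hρ s hs p hp hR => ?_⟩
  obtain ⟨-, -, -, h4⟩ := h l hl A ρ hρ s hs p hp
  have hA := hρ.nonneg
  have hσ : 0 < √s := Real.sqrt_pos.2 hs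
  have hw : 0 < ‖p.1‖ := norm_pos_iff.2 hp
  have hwt := wtL_add_ntL l
  have hr := norm_sq_le_baseNorm p
  set R := baseNorm p with hRdef
  have hR0 : 0 < R := by linarith
  set y := R / √s with hy
  have hy0 : 0 < y := by positivity
  have hm0 : (0 : ℝ) ≤ m := Nat.cast_nonneg m
  have e1 : Real.exp (-(1 / 16) * (max (R - 1) 0 / √s) ^ 2) ≤ Real.exp (-(1 / 64) * y ^ 2) := by
    apply Real.exp_le_exp.2
    have e2 : y / 2 ≤ max (R - 1) 0 / √s := by
      rw [hy, div_div, mul_comm, ← div_div]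
      gcongr
      exact le_max_of_le_left (by linarith)
    have := pow_le_pow_left₀ (by positivity) e2 2
    linarith
  have e2 : (‖p.1‖ ^ 2) ^ ntL l * (√s ^ (m + 3 + ntL l))⁻¹ ≤ y ^ ntL l * (√s ^ (m + 3))⁻¹ := by
    rw [pow_add, mul_inv, hy, div_pow, div_eq_mul_inv]
    calc _ = (‖p.1‖ ^ 2) ^ ntL l * (√s ^ ntL l)⁻¹ * (√s ^ (m + 3))⁻¹ := by ring
      _ ≤ _ := by gcongr
  have e3 : y ^ ntL l * (1 + ‖p.1‖ ^ 2 / √s) ^ wtL l ≤ 1 + y := by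
    have e4 : 1 + ‖p.1‖ ^ 2 / √s ≤ 1 + y := by rw [hy]; gcongr
    calc _ ≤ (1 + y) ^ ntL l * (1 + y) ^ wtL l := by gcongr; linarith
      _ = (1 + y) ^ l.length := by rw [← pow_add, add_comm (ntL l), hwt]
      _ ≤ (1 + y) ^ 1 := pow_le_pow_right₀ (by linarith) hl
      _ = _ := pow_one _
  have e5 : (1 + y) * Real.exp (-(1 / 64) * y ^ 2) ≤ C' * ((1 + y) ^ (m + 3))⁻¹ := by
    have := h' y hy0.le
    rw [← div_eq_mul_inv, le_div_iff₀ (by positivity)]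
    calc _ = (1 + y) ^ (m + 4) * Real.exp (-(1 / 64) * y ^ 2) := by ring
      _ ≤ _ := this
  have e6 : (√s ^ (m + 3))⁻¹ * ((1 + y) ^ (m + 3))⁻¹ ≤
      R ^ (-((m : ℝ) + 3 / 4)) * timeWeight s := by
    have hRpow : R ^ (-((m : ℝ) + 3)) ≤ R ^ (-((m : ℝ) + 3 / 4)) :=
      Real.rpow_le_rpow_of_exponent_le (by linarith) (by linarith)
    have hRσ : R = y * √s := by rw [hy]; field_simp
    unfold timeWeight
    split_ifs with hs1
    · have hσ1 : √s ≤ 1 := Real.sqrt_le_one.2 hs1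
      calc _ = ((√s * (1 + y)) ^ (m + 3))⁻¹ := by rw [mul_pow, mul_inv]
        _ ≤ (R ^ (m + 3))⁻¹ := by
            apply inv_anti₀ (by positivity)
            apply pow_le_pow_left₀ hR0.le
            rw [hRσ]; nlinarith
        _ = R ^ (-((m : ℝ) + 3)) := by
            rw [Real.rpow_neg hR0.le, ← Real.rpow_natCast]; push_cast; rfl
        _ ≤ R ^ (-((m : ℝ) + 3 / 4)) * 1 := by rw [mul_one]; exact hRpow
        _ ≤ _ := by
            gcongr
            exact (one_le_inv₀ hσ).2 hσ1
    · have hy1 : (1 : ℝ) ≤ 1 + y := by linarith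
      calc _ = √s ^ (-((m : ℝ) + 3)) * (1 + y) ^ (-((m : ℝ) + 3)) := by
            rw [Real.rpow_neg hσ.le, Real.rpow_neg (by linarith), ← Real.rpow_natCast,
              ← Real.rpow_natCast]
            push_cast; rfl
        _ ≤ √s ^ (-((m : ℝ) + 3)) * (1 + y) ^ (-((m : ℝ) + 3 / 4)) := by
            gcongr
            norm_num
        _ ≤ √s ^ (-((m : ℝ) + 3)) * y ^ (-((m : ℝ) + 3 / 4)) := by
            refine mul_le_mul_of_nonneg_left ?_ (by positivity)
            exact Real.rpow_le_rpow_of_nonpos hy0 (by linarith) (by linarith)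
        _ = R ^ (-((m : ℝ) + 3 / 4)) * √s ^ (-(9 / 4) : ℝ) := by
            rw [hRσ, Real.mul_rpow hy0.le hσ.le, mul_assoc, ← Real.rpow_add hσ, mul_comm]
            congr 2; ring
        _ = _ := by
            rw [Real.sqrt_eq_rpow, ← Real.rpow_mul hs.le]; norm_num
  calc _ ≤ (‖p.1‖ ^ 2) ^ ntL l * (C * A * ‖p.1‖ * (√s ^ (m + 3 + ntL l))⁻¹ *
        (1 + ‖p.1‖ ^ 2 / √s) ^ wtL l * Real.exp (-(1 / 16) * (max (R - 1) 0 / √s) ^ 2)) :=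
        mul_le_mul_of_nonneg_left h4 (by positivity)
    _ = C * A * ‖p.1‖ * ((‖p.1‖ ^ 2) ^ ntL l * (√s ^ (m + 3 + ntL l))⁻¹) *
        (1 + ‖p.1‖ ^ 2 / √s) ^ wtL l * Real.exp (-(1 / 16) * (max (R - 1) 0 / √s) ^ 2) := by ring
    _ ≤ C * A * ‖p.1‖ * (y ^ ntL l * (√s ^ (m + 3))⁻¹) *
        (1 + ‖p.1‖ ^ 2 / √s) ^ wtL l * Real.exp (-(1 / 64) * y ^ 2) := by
        refine mul_le_mul ?_ e1 (Real.exp_pos _).le (by positivity)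
        gcongr
    _ = C * A * ‖p.1‖ * (√s ^ (m + 3))⁻¹ * ((y ^ ntL l *
        (1 + ‖p.1‖ ^ 2 / √s) ^ wtL l) * Real.exp (-(1 / 64) * y ^ 2)) := by ring
    _ ≤ C * A * ‖p.1‖ * (√s ^ (m + 3))⁻¹ * ((1 + y) * Real.exp (-(1 / 64) * y ^ 2)) := by
        refine mul_le_mul_of_nonneg_left ?_ (by positivity)
        exact mul_le_mul_of_nonneg_right e3 (Real.exp_pos _).le
    _ ≤ C * A * ‖p.1‖ * (√s ^ (m + 3))⁻¹ * (C' * ((1 + y) ^ (m + 3))⁻¹) :=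
        mul_le_mul_of_nonneg_left e5 (by positivity)
    _ = C * C' * A * ‖p.1‖ * ((√s ^ (m + 3))⁻¹ * ((1 + y) ^ (m + 3))⁻¹) := by ring
    _ ≤ C * C' * A * ‖p.1‖ * (R ^ (-((m : ℝ) + 3 / 4)) * timeWeight s) :=
        mul_le_mul_of_nonneg_left e6 (by positivity)
    _ = _ := by ring

lemma exists_flow_le_dec {α : ℝ} (hα : 0 < α) (hα1 : α ≤ 1) :
    ∃ C, 0 < C ∧ ∀ l : List (Fin 2 ⊕ Fin m), l.length ≤ 1 → ∀ (A : ℝ) (ρ : Cover m → ℝ),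
      IsSource α A ρ → ∀ s, 0 < s → ∀ p : Cover m, p.1 ≠ 0 →
      (‖p.1‖ ^ 2) ^ ntL l * |flow ρ l s p| ≤ C * A * (‖p.1‖ * dec p) * timeWeight s := by
  obtain ⟨C₁, hC₁, h₁⟩ := exists_flow_le_near (m := m) hα hα1
  obtain ⟨C₂, hC₂, h₂⟩ := exists_flow_le_far (m := m) hα hα1
  -- The factor compares R with 1 + R: one has 1 + R ≤ 3 for R ≤ 2, and 1 + R ≤ 3R for R ≥ 2.
  refine ⟨(C₁ + C₂) * 3 ^ ((m : ℝ) + 3 / 4), by positivity, fun l hl A ρ hρ s hs p hp => ?_⟩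
  have hA := hρ.nonneg
  have hm0 : (0 : ℝ) ≤ m := Nat.cast_nonneg m
  have hR0 := baseNorm_nonneg p
  have hτ := timeWeight_nonneg hs
  have hd := dec_pos p
  have h3 : (0 : ℝ) < 3 ^ ((m : ℝ) + 3 / 4) := by positivity
  rcases le_total (baseNorm p) 2 with hR | hR
  · have e1 : 1 ≤ 3 ^ ((m : ℝ) + 3 / 4) * dec p := by
      rw [dec, Real.rpow_neg (by linarith), ← div_eq_mul_inv, one_le_div (by positivity)]
      exact Real.rpow_le_rpow (by linarith) (by linarith) (by linarith)
    calc _ ≤ C₁ * A * ‖p.1‖ * timeWeight s * 1 := by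
          rw [mul_one]
          exact h₁ l hl A ρ hρ s hs p hp ((norm_sq_le_baseNorm p).trans hR)
      _ ≤ (C₁ + C₂) * A * ‖p.1‖ * timeWeight s * (3 ^ ((m : ℝ) + 3 / 4) * dec p) := by
          gcongr; linarith
      _ = _ := by ring
  · have e1 : baseNorm p ^ (-((m : ℝ) + 3 / 4)) ≤ 3 ^ ((m : ℝ) + 3 / 4) * dec p := by
      have hpos : 0 < baseNorm p := by linarith
      rw [dec, Real.rpow_neg hpos.le, Real.rpow_neg (by linarith : 0 ≤ 1 + baseNorm p),
        ← div_eq_mul_inv,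
        inv_le_iff_one_le_mul₀ (by positivity), div_mul_eq_mul_div, one_le_div (by positivity),
        ← Real.mul_rpow (by norm_num) hpos.le]
      exact Real.rpow_le_rpow (by linarith) (by linarith) (by linarith)
    calc _ ≤ C₂ * A * ‖p.1‖ * baseNorm p ^ (-((m : ℝ) + 3 / 4)) * timeWeight s :=
          h₂ l hl A ρ hρ s hs p hp hR
      _ ≤ (C₁ + C₂) * A * ‖p.1‖ * (3 ^ ((m : ℝ) + 3 / 4) * dec p) * timeWeight s := by
          gcongr; linarith
      _ = _ := by ring

/-- The decay of the potential and its first derivatives. -/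
lemma exists_pot_le_dec {α : ℝ} (hα : 0 < α) (hα1 : α ≤ 1) :
    ∃ C, 0 < C ∧ ∀ l : List (Fin 2 ⊕ Fin m), l.length ≤ 1 → ∀ (A : ℝ) (ρ : Cover m → ℝ),
      IsSource α A ρ → ∀ I : Set ℝ, MeasurableSet I → I ⊆ Ioi 0 → ∀ p : Cover m, p.1 ≠ 0 →
      (‖p.1‖ ^ 2) ^ ntL l * |pot ρ I l p| ≤ C * A * (‖p.1‖ * dec p) := by
  obtain ⟨C, hC, h⟩ := exists_flow_le_dec (m := m) hα hα1
  have hT : 0 ≤ ∫ s in Ioi 0, timeWeight s :=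
    setIntegral_nonneg measurableSet_Ioi fun s hs => timeWeight_nonneg hs
  refine ⟨C * ((∫ s in Ioi 0, timeWeight s) + 1), by positivity,
    fun l hl A ρ hρ I hI hI0 p hp => ?_⟩
  have hA := hρ.nonneg
  have hd := dec_pos p
  have h1 := norm_integral_le_of_norm_le (μ := volume.restrict I)
    (f := fun s => (‖p.1‖ ^ 2) ^ ntL l * flow ρ l s p)
    (g := fun s => C * A * (‖p.1‖ * dec p) * timeWeight s)
    ((integrableOn_timeWeight.mono_set hI0).const_mul _) (by
      filter_upwards [ae_restrict_mem hI] with s hs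
      rw [norm_mul, Real.norm_of_nonneg (by positivity), Real.norm_eq_abs]
      exact h l hl A ρ hρ s (hI0 hs) p hp)
  rw [integral_const_mul, integral_const_mul, norm_mul, Real.norm_of_nonneg (by positivity)] at h1
  rw [pot, abs_neg]
  refine h1.trans ?_
  have h2 : ∫ s in I, timeWeight s ≤ ∫ s in Ioi 0, timeWeight s :=
    setIntegral_mono_set integrableOn_timeWeight
      ((ae_restrict_mem measurableSet_Ioi).mono fun s hs => timeWeight_nonneg hs)
      (Eventually.of_forall hI0)
  calc _ ≤ C * A * (‖p.1‖ * dec p) * ((∫ s in Ioi 0, timeWeight s) + 1) := by gcongr; linarith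
    _ = _ := by ring

/-- The weight that dominates the gradients. -/
def wgt (p : Cover m) : ℝ := ‖p.1‖⁻¹ * dec p

lemma wgt_nonneg (p : Cover m) : 0 ≤ wgt p := mul_nonneg (by positivity) (dec_pos p).le

/-- In terms of `wgt`, the solution is O(|z| `wgt`) and its gradient is O(`wgt`), as homogeneity
suggests. -/
lemma norm_mul_dec (p : Cover m) : ‖p.1‖ * dec p = ‖p.1‖ ^ 2 * wgt p := by
  rcases eq_or_ne ‖p.1‖ 0 with h | h
  · simp [h]
  · rw [wgt]; field_simp

lemma measurable_wgt : Measurable (wgt (m := m)) := by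
  have h : Measurable (baseNorm (m := m)) := continuous_proj.norm.measurable
  unfold wgt dec
  fun_prop

/-- The exponent 2m + 3/2 is split as 5/4 for |w|², integrable in the w-plane since 5/2 > 2, and 2m
+ 1/4 > m for t. The second part works for m = 0 too. -/
lemma integrable_dec_sq : Integrable fun p : Cover m => dec p ^ 2 := by
  have h1 : Integrable (fun w : ℂ => (1 + ‖w‖ ^ 2) ^ (-(5 / 2 : ℝ) / 2)) :=
    integrable_rpow_neg_one_add_norm_sq (by rw [Complex.finrank_real_complex]; norm_num)
  have h2 : Integrable (fun t : EuclideanSpace ℝ (Fin m) =>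
      (1 + ‖t‖) ^ (-(2 * (m : ℝ) + 1 / 4))) :=
    integrable_one_add_norm (by
      rw [finrank_euclideanSpace_fin]
      have : (0 : ℝ) ≤ m := Nat.cast_nonneg m
      linarith)
  have h3 := h1.mul_prod h2
  rw [← Measure.volume_eq_prod] at h3
  have hm : Measurable (dec (m := m)) := by
    have h : Measurable (baseNorm (m := m)) := continuous_proj.norm.measurable
    unfold dec; fun_prop
  refine h3.mono' (hm.pow_const 2).aestronglyMeasurable (Eventually.of_forall fun p => ?_)
  have hR0 := baseNorm_nonneg p
  have hm0 : (0 : ℝ) ≤ m := Nat.cast_nonneg m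
  rw [Real.norm_of_nonneg (by positivity), dec, ← Real.rpow_natCast, ← Real.rpow_mul (by linarith),
    show -((m : ℝ) + 3 / 4) * (2 : ℕ) = -(5 / 2 : ℝ) / 2 + -(2 * (m : ℝ) + 1 / 4) by
      push_cast; ring, Real.rpow_add (by linarith)]
  refine mul_le_mul ?_ ?_ (by positivity) (by positivity)
  · exact Real.rpow_le_rpow_of_nonpos (by positivity)
      (by linarith [norm_sq_le_baseNorm p]) (by norm_num)
  · exact Real.rpow_le_rpow_of_nonpos (by positivity)
      (by linarith [norm_snd_le_baseNorm p]) (by linarith)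

/-- The density 2|w|² of the measure cancels the singularity |w|⁻² of the squared weight. -/
lemma memLp_wgt : MemLp (wgt (m := m)) 2 (coverMeasure m) := by
  rw [memLp_two_iff_integrable_sq measurable_wgt.aestronglyMeasurable]
  have h : Integrable (fun p : Cover m => 2 * ‖p.1‖ ^ 2 * wgt p ^ 2) := by
    refine (integrable_dec_sq.const_mul 2).congr (ae_volume_fst_ne_zero.mono fun p hp => ?_)
    have := norm_ne_zero_iff.2 hp
    simp only [wgt]; field_simp
  rw [coverMeasure, integrable_withDensity_iff measurable_density
    (Eventually.of_forall fun p => ENNReal.ofReal_lt_top)]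
  refine h.congr (Eventually.of_forall fun p => ?_)
  simp only
  rw [ENNReal.toReal_ofReal (by positivity), mul_comm]

/-! ### Approximation by test sections -/

lemma eLpNorm_two_eq {X : Type*} [MeasurableSpace X] (f : X → ℝ) (μ : Measure X) :
    eLpNorm f 2 μ = (∫⁻ x, ‖f x‖ₑ ^ (2 : ℝ) ∂μ) ^ (1 / 2 : ℝ) := by
  rw [eLpNorm_eq_lintegral_rpow_enorm_toReal (by norm_num) (by norm_num)]
  simp

/-- Dominated convergence in `L²`. -/
lemma tendsto_eLpNorm_two_of_dominated {X : Type*} [MeasurableSpace X] {μ : Measure X}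
    {f : ℕ → X → ℝ} {b : X → ℝ} (hf : ∀ k, AEStronglyMeasurable (f k) μ) (hb : MemLp b 2 μ)
    (hbound : ∀ k, ∀ᵐ x ∂μ, |f k x| ≤ b x)
    (hlim : ∀ᵐ x ∂μ, Tendsto (fun k => f k x) atTop (𝓝 0)) :
    Tendsto (fun k => eLpNorm (f k) 2 μ) atTop (𝓝 0) := by
  have h1 : Tendsto (fun k => ∫⁻ x, ‖f k x‖ₑ ^ (2 : ℝ) ∂μ) atTop (𝓝 (∫⁻ _, 0 ∂μ)) := by
    refine tendsto_lintegral_of_dominated_convergence' (fun x => ‖b x‖ₑ ^ (2 : ℝ))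
      (fun k => (hf k).enorm.pow_const _) (fun k => ?_) ?_ ?_
    · filter_upwards [hbound k] with x hx
      refine ENNReal.rpow_le_rpow ?_ (by norm_num)
      rw [enorm_le_iff_norm_le, Real.norm_eq_abs]
      exact hx.trans (le_abs_self _)
    · have := hb.eLpNorm_lt_top
      rw [eLpNorm_two_eq] at this
      intro h
      rw [h, ENNReal.top_rpow_of_pos (by norm_num)] at this
      exact lt_irrefl _ this
    · filter_upwards [hlim] with x hx
      have h2 : Tendsto (fun k => ‖f k x‖ₑ) atTop (𝓝 0) := by
        have := hx.enorm
        simpa using this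
      have h3 := (ENNReal.continuous_rpow_const (y := 2)).tendsto 0 |>.comp h2
      rwa [ENNReal.zero_rpow_of_pos (by norm_num)] at h3
  rw [lintegral_zero] at h1
  have h2 := (ENNReal.continuous_rpow_const (y := 1 / 2)).tendsto 0 |>.comp h1
  rw [ENNReal.zero_rpow_of_pos (by norm_num)] at h2
  simp only [eLpNorm_two_eq]
  exact h2

/-! ### Cut-off functions. -/

lemma exists_deriv_smoothTransition_le : ∃ C, 0 < C ∧ ∀ x,
    |deriv Real.smoothTransition x| ≤ C ∧
      (deriv Real.smoothTransition x ≠ 0 → 0 ≤ x ∧ x ≤ 1) := by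
  have hc : Continuous (deriv Real.smoothTransition) :=
    (Real.smoothTransition.contDiff (n := 1)).continuous_deriv (by simp)
  obtain ⟨C, hC⟩ := (isCompact_Icc (a := (0 : ℝ)) (b := 1)).exists_bound_of_continuousOn
    hc.continuousOn
  have hz : ∀ x, deriv Real.smoothTransition x ≠ 0 → 0 ≤ x ∧ x ≤ 1 := by
    intro x hx
    constructor
    · by_contra h
      apply hx
      have : Real.smoothTransition =ᶠ[𝓝 x] fun _ => 0 := by
        filter_upwards [Iio_mem_nhds (not_le.1 h)] with y hy
        exact Real.smoothTransition.zero_of_nonpos (le_of_lt hy)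
      rw [this.deriv_eq, deriv_const]
    · by_contra h
      apply hx
      have : Real.smoothTransition =ᶠ[𝓝 x] fun _ => 1 := by
        filter_upwards [Ioi_mem_nhds (not_le.1 h)] with y hy
        exact Real.smoothTransition.one_of_one_le (le_of_lt hy)
      rw [this.deriv_eq, deriv_const]
  refine ⟨max C 1, by positivity, fun x => ⟨?_, hz x⟩⟩
  by_cases hx : deriv Real.smoothTransition x = 0
  · rw [hx, abs_zero]; positivity
  · exact (hC x (hz x hx)).trans (le_max_left _ _)

/-- A cut-off function away from the singular set and from infinity. -/
def cutoff (n : ℝ) (p : Cover m) : ℝ :=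
  Real.smoothTransition (n * ‖p.1‖ ^ 2 - 1) *
    Real.smoothTransition (2 - ((‖p.1‖ ^ 2) ^ 2 + ‖p.2‖ ^ 2) / n ^ 2)

lemma cutoff_nonneg (n : ℝ) (p : Cover m) : 0 ≤ cutoff n p :=
  mul_nonneg (Real.smoothTransition.nonneg _) (Real.smoothTransition.nonneg _)

lemma cutoff_le_one (n : ℝ) (p : Cover m) : cutoff n p ≤ 1 :=
  mul_le_one₀ (Real.smoothTransition.le_one _) (Real.smoothTransition.nonneg _)
    (Real.smoothTransition.le_one _)

lemma contDiff_cutoff (n : ℝ) : ContDiff ℝ ((⊤ : ℕ∞) : WithTop ℕ∞) (cutoff (m := m) n) := by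
  have h1 : ContDiff ℝ ((⊤ : ℕ∞) : WithTop ℕ∞) fun p : Cover m => ‖p.1‖ ^ 2 :=
    contDiff_fst.norm_sq ℝ
  have h2 : ContDiff ℝ ((⊤ : ℕ∞) : WithTop ℕ∞) fun p : Cover m => ‖p.2‖ ^ 2 :=
    contDiff_snd.norm_sq ℝ
  exact (Real.smoothTransition.contDiff.comp ((contDiff_const.mul h1).sub contDiff_const)).mul
    (Real.smoothTransition.contDiff.comp
      (contDiff_const.sub (((h1.pow 2).add h2).div_const _)))

lemma tsupport_cutoff_subset {n : ℝ} (hn : 0 < n) : tsupport (cutoff (m := m) n) ⊆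
    {p | 1 / n ≤ ‖p.1‖ ^ 2} ∩ {p | (‖p.1‖ ^ 2) ^ 2 + ‖p.2‖ ^ 2 ≤ 2 * n ^ 2} := by
  refine closure_minimal ?_ ((isClosed_le continuous_const (by fun_prop)).inter
    (isClosed_le (by fun_prop) continuous_const))
  intro p hp
  have h1 : Real.smoothTransition (n * ‖p.1‖ ^ 2 - 1) ≠ 0 := left_ne_zero_of_mul hp
  have h2 : Real.smoothTransition (2 - ((‖p.1‖ ^ 2) ^ 2 + ‖p.2‖ ^ 2) / n ^ 2) ≠ 0 :=
    right_ne_zero_of_mul hp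
  rw [Ne, Real.smoothTransition.zero_iff_nonpos, not_le] at h1 h2
  constructor
  · change 1 / n ≤ ‖p.1‖ ^ 2
    rw [div_le_iff₀ hn]; linarith
  · change (‖p.1‖ ^ 2) ^ 2 + ‖p.2‖ ^ 2 ≤ 2 * n ^ 2
    rw [← div_le_iff₀ (by positivity)]; linarith

lemma tsupport_cutoff_subset_regular {n : ℝ} (hn : 0 < n) :
    tsupport (cutoff (m := m) n) ⊆ {p | p.1 ≠ 0} := by
  intro p hp h0
  have h1 : 1 / n ≤ ‖p.1‖ ^ 2 := (tsupport_cutoff_subset hn hp).1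
  have h0 : p.1 = 0 := h0
  rw [h0, norm_zero] at h1
  have : 0 < 1 / n := by positivity
  norm_num at h1
  linarith [inv_pos.2 hn]

lemma hasCompactSupport_cutoff {n : ℝ} (hn : 0 < n) :
    HasCompactSupport (cutoff (m := m) n) := by
  refine HasCompactSupport.of_support_subset_isCompact
    (isCompact_closedBall (0 : Cover m) (2 + 2 * n ^ 2)) fun p hp => ?_
  have h2 : (‖p.1‖ ^ 2) ^ 2 + ‖p.2‖ ^ 2 ≤ 2 * n ^ 2 :=
    (tsupport_cutoff_subset hn (subset_tsupport _ hp)).2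
  rw [mem_closedBall_zero_iff, Prod.norm_def]
  refine max_le ?_ ?_
  · nlinarith [sq_nonneg (‖p.1‖ - 1), sq_nonneg (‖p.1‖ ^ 2 - 1), sq_nonneg ‖p.2‖]
  · nlinarith [sq_nonneg (‖p.2‖ - 1), sq_nonneg (‖p.1‖ ^ 2)]

lemma cutoff_eventuallyEq_one {p : Cover m} (hp : p.1 ≠ 0) :
    ∀ᶠ n : ℝ in atTop, cutoff n =ᶠ[𝓝 p] fun _ => 1 := by
  have hr : 0 < ‖p.1‖ ^ 2 := by have := norm_pos_iff.2 hp; positivity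
  filter_upwards [eventually_gt_atTop (2 / ‖p.1‖ ^ 2), eventually_gt_atTop
    ((‖p.1‖ ^ 2) ^ 2 + ‖p.2‖ ^ 2), eventually_gt_atTop 1] with n h1 h2 h3
  have hn : 0 < n := by linarith
  rw [div_lt_iff₀ hr] at h1
  have o1 : IsOpen {q : Cover m | 2 < n * ‖q.1‖ ^ 2} := isOpen_lt continuous_const (by fun_prop)
  have o2 : IsOpen {q : Cover m | (‖q.1‖ ^ 2) ^ 2 + ‖q.2‖ ^ 2 < n} :=
    isOpen_lt (by fun_prop) continuous_const
  filter_upwards [o1.mem_nhds h1, o2.mem_nhds h2] with q hq1 hq2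
  have hq1 : 2 < n * ‖q.1‖ ^ 2 := hq1
  have hq2 : (‖q.1‖ ^ 2) ^ 2 + ‖q.2‖ ^ 2 < n := hq2
  rw [cutoff, Real.smoothTransition.one_of_one_le (by linarith),
    Real.smoothTransition.one_of_one_le, mul_one]
  have : ((‖q.1‖ ^ 2) ^ 2 + ‖q.2‖ ^ 2) / n ^ 2 ≤ 1 := by
    rw [div_le_one (by positivity)]; nlinarith
  linarith

/-- The bound |z||∇χ| ≤ C is uniform in `n`. The inner factor has slope of order n where |z| ≤ 2/n,
the outer one slope of order 1/n where |x| is at most of order n. Combined with |u| ≤ C|z| `wgt`, it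
makes u∇χ dominated by `wgt`. -/
lemma exists_fderiv_cutoff_le : ∃ C, 0 < C ∧ ∀ (n : ℝ), 0 < n → ∀ p v : Cover m,
    2 * ‖p.1‖ * ‖v.1‖ ≤ 1 → ‖v.2‖ ≤ 1 → ‖p.1‖ ^ 2 * |fderiv ℝ (cutoff n) p v| ≤ C := by
  obtain ⟨C, hC, hS⟩ := exists_deriv_smoothTransition_le
  refine ⟨8 * C, by positivity, fun n hn p v hv1 hv2 => ?_⟩
  have d1 : HasFDerivAt (fun p : Cover m => ‖p.1‖ ^ 2)
      ((2 • (innerSL ℝ p.1)).comp (ContinuousLinearMap.fst ℝ ℂ (EuclideanSpace ℝ (Fin m)))) p :=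
    (hasStrictFDerivAt_norm_sq p.1).hasFDerivAt.comp p hasFDerivAt_fst
  have d2 : HasFDerivAt (fun p : Cover m => ‖p.2‖ ^ 2)
      ((2 • (innerSL ℝ p.2)).comp (ContinuousLinearMap.snd ℝ ℂ (EuclideanSpace ℝ (Fin m)))) p :=
    (hasStrictFDerivAt_norm_sq p.2).hasFDerivAt.comp p hasFDerivAt_snd
  have hSd : ∀ x, HasDerivAt Real.smoothTransition (deriv Real.smoothTransition x) x := fun x =>
    ((Real.smoothTransition.contDiff (n := 1)).differentiable (by simp) x).hasDerivAt
  have f1 := (hSd (n * ‖p.1‖ ^ 2 - 1)).comp_hasFDerivAt p ((d1.const_mul n).sub_const 1)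
  have f2 := (hSd (2 - ((‖p.1‖ ^ 2) ^ 2 + ‖p.2‖ ^ 2) / n ^ 2)).comp_hasFDerivAt p
    ((((d1.pow 2).add d2).mul_const (n ^ 2)⁻¹).const_sub 2)
  have f : HasFDerivAt (cutoff (m := m) n) _ p := f1.mul f2
  rw [f.fderiv]
  obtain ⟨s1, z1⟩ := hS (n * ‖p.1‖ ^ 2 - 1)
  obtain ⟨s2, z2⟩ := hS (2 - ((‖p.1‖ ^ 2) ^ 2 + ‖p.2‖ ^ 2) / n ^ 2)
  have i1 : |2 * inner ℝ p.1 v.1| ≤ 1 := by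
    rw [abs_mul, abs_of_pos (by norm_num : (0 : ℝ) < 2)]
    have := abs_real_inner_le_norm p.1 v.1
    linarith
  have i2 : |2 * inner ℝ p.2 v.2| ≤ 2 * ‖p.2‖ := by
    rw [abs_mul, abs_of_pos (by norm_num : (0 : ℝ) < 2)]
    have := abs_real_inner_le_norm p.2 v.2
    nlinarith [norm_nonneg p.2]
  set S1 := Real.smoothTransition (n * ‖p.1‖ ^ 2 - 1) with hS1
  set S2 := Real.smoothTransition (2 - ((‖p.1‖ ^ 2) ^ 2 + ‖p.2‖ ^ 2) / n ^ 2) with hS2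
  set D1 := deriv Real.smoothTransition (n * ‖p.1‖ ^ 2 - 1) with hD1
  set D2 := deriv Real.smoothTransition (2 - ((‖p.1‖ ^ 2) ^ 2 + ‖p.2‖ ^ 2) / n ^ 2) with hD2
  have b1 : |S1| ≤ 1 := by
    rw [abs_of_nonneg (Real.smoothTransition.nonneg _)]; exact Real.smoothTransition.le_one _
  have b2 : |S2| ≤ 1 := by
    rw [abs_of_nonneg (Real.smoothTransition.nonneg _)]; exact Real.smoothTransition.le_one _
  have t1 : ‖p.1‖ ^ 2 * |D1 * (n * (2 * inner ℝ p.1 v.1))| ≤ 2 * C := by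
    by_cases h0 : D1 = 0
    · rw [h0]; simp; positivity
    · obtain ⟨-, h1⟩ := z1 h0
      rw [abs_mul, abs_mul, abs_of_pos hn]
      calc _ = |D1| * (n * ‖p.1‖ ^ 2) * |2 * inner ℝ p.1 v.1| := by ring
        _ ≤ C * 2 * 1 := by gcongr; linarith
        _ = _ := by ring
  have t2 : ‖p.1‖ ^ 2 * |D2 * ((n ^ 2)⁻¹ * (2 * ‖p.1‖ ^ 2 * (2 * inner ℝ p.1 v.1) +
      2 * inner ℝ p.2 v.2))| ≤ 6 * C := by
    by_cases h0 : D2 = 0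
    · rw [h0]; simp; positivity
    · obtain ⟨h1, -⟩ := z2 h0
      have h2 : (‖p.1‖ ^ 2) ^ 2 + ‖p.2‖ ^ 2 ≤ 2 * n ^ 2 := by
        rw [← div_le_iff₀ (by positivity)]; linarith
      have h3 : |2 * ‖p.1‖ ^ 2 * (2 * inner ℝ p.1 v.1) + 2 * inner ℝ p.2 v.2| ≤
          2 * ‖p.1‖ ^ 2 + 2 * ‖p.2‖ := by
        refine (abs_add_le _ _).trans (add_le_add ?_ i2)
        rw [abs_mul, abs_of_nonneg (by positivity : 0 ≤ 2 * ‖p.1‖ ^ 2)]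
        exact mul_le_of_le_one_right (by positivity) i1
      have h4 : ‖p.1‖ ^ 2 * (2 * ‖p.1‖ ^ 2 + 2 * ‖p.2‖) ≤ 6 * n ^ 2 := by
        nlinarith [sq_nonneg (‖p.1‖ ^ 2 - ‖p.2‖)]
      rw [abs_mul, abs_mul, abs_of_pos (by positivity : 0 < (n ^ 2)⁻¹)]
      calc _ ≤ ‖p.1‖ ^ 2 * (C * ((n ^ 2)⁻¹ * (2 * ‖p.1‖ ^ 2 + 2 * ‖p.2‖))) := by gcongr
        _ = C * ((n ^ 2)⁻¹ * (‖p.1‖ ^ 2 * (2 * ‖p.1‖ ^ 2 + 2 * ‖p.2‖))) := by ring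
        _ ≤ C * ((n ^ 2)⁻¹ * (6 * n ^ 2)) := by gcongr
        _ = _ := by field_simp
  have hval : (S1 • (D2 • -((n ^ 2)⁻¹ • ((2 • (‖p.1‖ ^ 2) ^ (2 - 1)) •
      ((2 • (innerSL ℝ p.1)).comp (ContinuousLinearMap.fst ℝ ℂ (EuclideanSpace ℝ (Fin m)))) +
      (2 • (innerSL ℝ p.2)).comp (ContinuousLinearMap.snd ℝ ℂ (EuclideanSpace ℝ (Fin m)))))) +
      S2 • (D1 • (n • ((2 • (innerSL ℝ p.1)).comp
        (ContinuousLinearMap.fst ℝ ℂ (EuclideanSpace ℝ (Fin m))))))) v =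
      S2 * (D1 * (n * (2 * inner ℝ p.1 v.1))) - S1 * (D2 * ((n ^ 2)⁻¹ *
        (2 * ‖p.1‖ ^ 2 * (2 * inner ℝ p.1 v.1) + 2 * inner ℝ p.2 v.2))) := by
    simp
    ring
  refine le_trans (le_of_eq (congrArg (fun x => ‖p.1‖ ^ 2 * |x|) hval)) ?_
  calc _ ≤ ‖p.1‖ ^ 2 * (|D1 * (n * (2 * inner ℝ p.1 v.1))| + |D2 * ((n ^ 2)⁻¹ *
        (2 * ‖p.1‖ ^ 2 * (2 * inner ℝ p.1 v.1) + 2 * inner ℝ p.2 v.2))|) := by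
        refine mul_le_mul_of_nonneg_left ((abs_sub _ _).trans ?_) (by positivity)
        rw [abs_mul S2, abs_mul S1]
        exact add_le_add (mul_le_of_le_one_left (abs_nonneg _) b2)
          (mul_le_of_le_one_left (abs_nonneg _) b1)
    _ ≤ 2 * C + 6 * C := by rw [mul_add]; exact add_le_add t1 t2
    _ = _ := by ring

/-! ### The solution lies in the completion -/

lemma aestronglyMeasurable_of_continuousOn {f : Cover m → ℝ}
    (hf : ContinuousOn f {p | p.1 ≠ 0}) : AEStronglyMeasurable f (coverMeasure m) := by
  have h := hf.aestronglyMeasurable (μ := coverMeasure m) isOpen_regular.measurableSet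
  have h2 : (coverMeasure m).restrict {p | p.1 ≠ 0} = coverMeasure m :=
    Measure.restrict_eq_self_of_ae_mem ae_fst_ne_zero
  rwa [h2] at h

/-- The lift of the frame to the double cover. -/
def frameLift (a : Fin 2 ⊕ Fin m) (p : Cover m) : Cover m := lift p (frame a (proj p))

lemma along_frame (a : Fin 2 ⊕ Fin m) (f : Cover m → ℝ) (p : Cover m) :
    along (frame a) f p = fderiv ℝ f p (frameLift a p) := rfl

lemma continuousOn_frameLift (a : Fin 2 ⊕ Fin m) :
    ContinuousOn (frameLift a) {p : Cover m | p.1 ≠ 0} := by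
  have h : ∀ c : ℂ, ContinuousOn (fun p : Cover m => c / (2 * p.1)) {p : Cover m | p.1 ≠ 0} :=
    fun c => continuousOn_const.div (by fun_prop) fun p hp => mul_ne_zero two_ne_zero hp
  match a with
  | Sum.inl 0 => exact (h 1).prodMk continuousOn_const
  | Sum.inl 1 => exact (h Complex.I).prodMk continuousOn_const
  | Sum.inr i => exact (h 0).prodMk continuousOn_const

lemma norm_frameLift (a : Fin 2 ⊕ Fin m) {p : Cover m} (hp : p.1 ≠ 0) :
    2 * ‖p.1‖ * ‖(frameLift a p).1‖ ≤ 1 ∧ ‖(frameLift a p).2‖ ≤ 1 := by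
  have hw : 0 < ‖p.1‖ := norm_pos_iff.2 hp
  have h : ∀ c : ℂ, ‖c‖ ≤ 1 → 2 * ‖p.1‖ * ‖c / (2 * p.1)‖ ≤ 1 := by
    intro c hc
    rw [norm_div, norm_mul, Complex.norm_two, mul_div_cancel₀ _ (by positivity)]
    exact hc
  match a with
  | Sum.inl 0 => exact ⟨h 1 (by simp), by simp [frameLift, lift, frame]⟩
  | Sum.inl 1 => exact ⟨h Complex.I (by simp), by simp [frameLift, lift, frame]⟩
  | Sum.inr i => exact ⟨h 0 (by simp), by simp [frameLift, lift, frame]⟩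

lemma continuousOn_along {f : Cover m → ℝ} (hf : ContDiffOn ℝ 1 f {p | p.1 ≠ 0})
    (a : Fin 2 ⊕ Fin m) : ContinuousOn (along (frame a) f) {p | p.1 ≠ 0} :=
  (hf.continuousOn_fderiv_of_isOpen isOpen_regular le_rfl).clm_apply (continuousOn_frameLift a)

/-- The gradient of a tower, in components with respect to the frame. -/
def grad (F : List (Fin 2 ⊕ Fin m) → Cover m → ℝ) : Fin 2 ⊕ Fin m → Cover m → ℝ
  | Sum.inl 0 => fun p => F [Sum.inl 0] p * (p.1⁻¹ ^ 2).re + F [Sum.inl 1] p * (p.1⁻¹ ^ 2).im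
  | Sum.inl 1 => fun p => F [Sum.inl 1] p * (p.1⁻¹ ^ 2).re - F [Sum.inl 0] p * (p.1⁻¹ ^ 2).im
  | Sum.inr i => F [Sum.inr i]

lemma IsTower.along_frame {F : List (Fin 2 ⊕ Fin m) → Cover m → ℝ} {n : ℕ∞} (hF : IsTower n F)
    (hn : 0 < n) (a : Fin 2 ⊕ Fin m) {p : Cover m} (hp : p.1 ≠ 0) :
    along (frame a) (F []) p = grad F a p := by
  match a with
  | Sum.inl 0 => exact hF.along_frame_inl_zero hn hp
  | Sum.inl 1 => exact hF.along_frame_inl_one hn hp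
  | Sum.inr i => exact hF.along_frame_inr hn hp i

/-- The coefficients of the frame in the fields r∂_r and ∂_θ have size 1/|z|, which the prefactor
|z| cancels. -/
lemma abs_grad_le {F : List (Fin 2 ⊕ Fin m) → Cover m → ℝ} {p : Cover m} (hp : p.1 ≠ 0) {B : ℝ}
    (hB : ∀ b, (‖p.1‖ ^ 2) ^ nt b * |F [b] p| ≤ B) (a : Fin 2 ⊕ Fin m) :
    ‖p.1‖ ^ 2 * |grad F a p| ≤ 2 * B := by
  have hw : 0 < ‖p.1‖ := norm_pos_iff.2 hp
  have hB0 : 0 ≤ B := le_trans (by positivity) (hB (Sum.inl 0))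
  have h0 := hB (Sum.inl 0)
  have h1 := hB (Sum.inl 1)
  simp only [nt, pow_zero, one_mul] at h0 h1
  have hn : ‖p.1⁻¹ ^ 2‖ * ‖p.1‖ ^ 2 = 1 := by
    rw [norm_pow, norm_inv, ← mul_pow, inv_mul_cancel₀ hw.ne', one_pow]
  have hre : |(p.1⁻¹ ^ 2).re| * ‖p.1‖ ^ 2 ≤ 1 :=
    hn ▸ mul_le_mul_of_nonneg_right (Complex.abs_re_le_norm _) (by positivity)
  have him : |(p.1⁻¹ ^ 2).im| * ‖p.1‖ ^ 2 ≤ 1 :=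
    hn ▸ mul_le_mul_of_nonneg_right (Complex.abs_im_le_norm _) (by positivity)
  have key : ∀ x y c d : ℝ, |x| ≤ B → |y| ≤ B → |c| * ‖p.1‖ ^ 2 ≤ 1 → |d| * ‖p.1‖ ^ 2 ≤ 1 →
      ‖p.1‖ ^ 2 * (|x * c| + |y * d|) ≤ 2 * B := by
    intro x y c d hx hy hc hd
    rw [abs_mul, abs_mul]
    have e1 := mul_le_mul hx hc (by positivity) hB0
    have e2 := mul_le_mul hy hd (by positivity) hB0
    linarith
  match a with
  | Sum.inl 0 =>
    exact (mul_le_mul_of_nonneg_left (abs_add_le _ _) (by positivity)).trans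
      (key _ _ _ _ h0 h1 hre him)
  | Sum.inl 1 =>
    exact (mul_le_mul_of_nonneg_left (abs_sub _ _) (by positivity)).trans
      (key _ _ _ _ h1 h0 hre him)
  | Sum.inr i =>
    have := hB (Sum.inr i)
    simp only [nt, pow_one] at this
    exact this.trans (by linarith)

lemma ker_neg (w : ℂ) (t : EuclideanSpace ℝ (Fin m)) (q : Cover m) :
    ker (-w, t) q = -ker (w, t) q := by
  have h1 : quad (-w, t) q = quad (w, t) q := by simp [quad]
  have h2 : crossRe (-w, t) q = -crossRe (w, t) q := by simp [crossRe]; ring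
  rw [ker, ker, gk, gk, h1, h2, erf_neg]; ring

lemma isSection_pot (ρ : Cover m → ℝ) (I : Set ℝ) : IsSection (pot ρ I []) := by
  intro w t
  have h : ∀ s, flow ρ [] s (-w, t) = -flow ρ [] s (w, t) := by
    intro s
    have h1 : ∀ b, dil b ((-w, t) : Cover m) = (-(dil b (w, t)).1, (dil b (w, t)).2) := fun b => by
      simp [dil]
    simp only [flow, heat, kerL_nil]
    rw [h1]
    simp only [ker_neg, neg_mul, integral_neg, Prod.mk.eta]
    ring
  simp only [pot, h, integral_neg]

lemma along_mul {f g : Cover m → ℝ} {p : Cover m} (hf : DifferentiableAt ℝ f p)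
    (hg : DifferentiableAt ℝ g p) (a : Fin 2 ⊕ Fin m) :
    along (frame a) (fun p => f p * g p) p =
      f p * along (frame a) g p + g p * along (frame a) f p := by
  simp only [along_frame]
  have h : HasFDerivAt (fun p => f p * g p) _ p := hf.hasFDerivAt.mul hg.hasFDerivAt
  rw [h.fderiv]
  simp

/-- The time intervals that exhaust `(0, ∞)`. -/
def timeInterval (k : ℕ) : Set ℝ := Icc (((k : ℝ) + 1)⁻¹) (k + 1)

lemma timeInterval_subset (k : ℕ) : timeInterval k ⊆ Ioi 0 := fun _ hs =>
  lt_of_lt_of_le (by positivity) hs.1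

lemma monotone_timeInterval : Monotone timeInterval := by
  intro j k h
  have h' : (j : ℝ) ≤ k := by exact_mod_cast h
  refine Icc_subset_Icc (inv_anti₀ (by positivity) (by linarith)) (by linarith)

lemma iUnion_timeInterval : ⋃ k, timeInterval k = Ioi 0 := by
  refine Subset.antisymm (iUnion_subset timeInterval_subset) fun s hs => ?_
  have hs : 0 < s := hs
  obtain ⟨k, hk⟩ := exists_nat_ge (max s s⁻¹)
  refine mem_iUnion.2 ⟨k, ?_, ?_⟩
  · rw [inv_le_comm₀ (by positivity) hs]
    exact (le_max_right _ _).trans (hk.trans (by linarith))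
  · exact (le_max_left _ _).trans (hk.trans (by linarith))

/-- Test sections that approximate the solution. -/
def approxPot (ρ : Cover m → ℝ) (k : ℕ) (p : Cover m) : ℝ :=
  cutoff (k + 1) p * pot ρ (timeInterval k) [] p

section

variable {α A : ℝ} {ρ : Cover m → ℝ}

lemma IsSource.isTower_pot_timeInterval (hα : 0 < α) (hα1 : α ≤ 1) (hρ : IsSource α A ρ) (k : ℕ) :
    IsTower ⊤ (pot ρ (timeInterval k)) :=
  hρ.isTower_pot_Icc hα hα1 (by positivity)

lemma IsSource.isTestSection_approxPot (hα : 0 < α) (hα1 : α ≤ 1) (hρ : IsSource α A ρ) (k : ℕ) :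
    IsTestSection (approxPot ρ k) := by
  have hk : (0 : ℝ) < k + 1 := by positivity
  have hsupp : tsupport (approxPot ρ k) ⊆ tsupport (cutoff (m := m) ((k : ℝ) + 1)) :=
    tsupport_mul_subset_left
  refine ⟨fun w t => ?_, ?_, ?_, hsupp.trans (tsupport_cutoff_subset_regular hk)⟩
  · have h1 : cutoff ((k : ℝ) + 1) ((-w, t) : Cover m) = cutoff ((k : ℝ) + 1) (w, t) := by
      simp [cutoff]
    rw [approxPot, approxPot, h1, isSection_pot]; ring
  · rw [contDiff_iff_contDiffAt]
    intro p
    by_cases hp : p ∈ tsupport (cutoff (m := m) ((k : ℝ) + 1))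
    · exact (contDiff_cutoff _).contDiffAt.mul
        (((hρ.isTower_pot_timeInterval hα hα1 k).contDiffOn_infty []).contDiffAt
          (isOpen_regular.mem_nhds (tsupport_cutoff_subset_regular hk hp)))
    · have h : approxPot ρ k =ᶠ[𝓝 p] fun _ => 0 := by
        filter_upwards [(isClosed_tsupport _).isOpen_compl.mem_nhds hp] with q hq
        rw [approxPot, image_eq_zero_of_notMem_tsupport hq, zero_mul]
      exact contDiffAt_const.congr_of_eventuallyEq h
  · exact (hasCompactSupport_cutoff hk).mul_right

lemma IsSource.tendsto_pot (hα : 0 < α) (hα1 : α ≤ 1) (hρ : IsSource α A ρ)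
    {l : List (Fin 2 ⊕ Fin m)} (hl : l.length ≤ 2) {p : Cover m} (hp : p.1 ≠ 0) :
    Tendsto (fun k => pot ρ (timeInterval k) l p) atTop (𝓝 (pot ρ (Ioi 0) l p)) := by
  have hi := hρ.integrableOn_flow hα hα1 hl hp
  have h := tendsto_setIntegral_of_monotone (μ := volume) (f := fun s => flow ρ l s p)
    (s := timeInterval) (fun k => measurableSet_Icc) monotone_timeInterval
    (by rwa [iUnion_timeInterval])
  rw [iUnion_timeInterval] at h
  exact h.neg

lemma eventually_cutoff_eq_one {p : Cover m} (hp : p.1 ≠ 0) :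
    ∀ᶠ k : ℕ in atTop, cutoff ((k : ℝ) + 1) =ᶠ[𝓝 p] fun _ => 1 :=
  (tendsto_atTop_add_const_right _ 1 tendsto_natCast_atTop_atTop).eventually
    (cutoff_eventuallyEq_one hp)

lemma IsSource.tendsto_grad (hα : 0 < α) (hα1 : α ≤ 1) (hρ : IsSource α A ρ) {p : Cover m}
    (hp : p.1 ≠ 0) (a : Fin 2 ⊕ Fin m) :
    Tendsto (fun k => grad (pot ρ (timeInterval k)) a p) atTop (𝓝 (grad (pot ρ (Ioi 0)) a p)) := by
  have h := fun b : Fin 2 ⊕ Fin m => hρ.tendsto_pot hα hα1 (l := [b]) (by simp) hp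
  match a with
  | Sum.inl 0 => exact ((h _).mul_const _).add ((h _).mul_const _)
  | Sum.inl 1 => exact ((h _).mul_const _).sub ((h _).mul_const _)
  | Sum.inr i => exact h _

lemma IsSource.tendsto_along (hα : 0 < α) (hα1 : α ≤ 1) (hρ : IsSource α A ρ) {p : Cover m}
    (hp : p.1 ≠ 0) (a : Fin 2 ⊕ Fin m) :
    Tendsto (fun k => (along (frame a) (approxPot ρ k) - along (frame a) (pot ρ (Ioi 0) [])) p)
      atTop (𝓝 0) := by
  have ht := hρ.isTower_pot hα hα1 measurableSet_Ioi Subset.rfl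
  have h1 := (hρ.tendsto_grad hα hα1 hp a).sub_const (grad (pot ρ (Ioi 0)) a p)
  rw [sub_self] at h1
  refine h1.congr' ?_
  filter_upwards [eventually_cutoff_eq_one hp] with k hk
  have h2 : approxPot ρ k =ᶠ[𝓝 p] pot ρ (timeInterval k) [] := by
    filter_upwards [hk] with q hq
    rw [approxPot, hq, one_mul]
  rw [Pi.sub_apply, ht.along_frame (by norm_num) a hp, along, h2.fderiv_eq]
  congr 1
  exact ((hρ.isTower_pot_timeInterval hα hα1 k).along_frame (by simp) a hp).symm

/-- The time integral of the heat flow lies in the completion of the test sections. -/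
lemma IsSource.isL21 (hα : 0 < α) (hα1 : α ≤ 1) (hρ : IsSource α A ρ) :
    IsL21 (pot ρ (Ioi 0) []) fun a => along (frame a) (pot ρ (Ioi 0) []) := by
  have ht := hρ.isTower_pot hα hα1 measurableSet_Ioi Subset.rfl
  have hcd : ContDiffOn ℝ 1 (pot ρ (Ioi 0) []) {p | p.1 ≠ 0} :=
    (hρ.contDiffOn_pot hα hα1).of_le (by norm_num)
  have hu := aestronglyMeasurable_of_continuousOn hcd.continuousOn
  have hg := fun a => aestronglyMeasurable_of_continuousOn (continuousOn_along hcd a)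
  have htest := hρ.isTestSection_approxPot hα hα1
  obtain ⟨C, hC, hpot⟩ := exists_pot_le_dec (m := m) hα hα1
  obtain ⟨C', hC', hcut⟩ := exists_fderiv_cutoff_le (m := m)
  have hA := hρ.nonneg
  have hbnd : ∀ I : Set ℝ, MeasurableSet I → I ⊆ Ioi 0 → ∀ p : Cover m, p.1 ≠ 0 →
      |pot ρ I [] p| ≤ C * A * ‖p.1‖ ^ 2 * wgt p ∧ ∀ a, |grad (pot ρ I) a p| ≤
        2 * (C * A) * wgt p := by
    intro I hI hI0 p hp
    have hw : 0 < ‖p.1‖ ^ 2 := by have := norm_pos_iff.2 hp; positivity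
    refine ⟨?_, fun a => ?_⟩
    · have := hpot [] (by simp) A ρ hρ I hI hI0 p hp
      rw [norm_mul_dec] at this
      simpa [ntL, mul_assoc] using this
    · have := abs_grad_le hp (F := pot ρ I) (B := C * A * (‖p.1‖ * dec p)) (fun b => by
        simpa [ntL] using hpot [b] (by simp) A ρ hρ I hI hI0 p hp) a
      rw [norm_mul_dec] at this
      refine le_of_mul_le_mul_left (this.trans_eq ?_) hw
      ring
  refine ⟨isSection_pot ρ _, hu, hg, approxPot ρ, htest, fun a => ?_, fun K hK => ?_⟩
  -- The approximants are cut-offs of time integrals over compact intervals, hence smooth. The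
  -- dominating constant collects 2 from the cut-off gradient, C' from the gradient of the cut-off,
  -- and 2 from the limit.
  · refine tendsto_eLpNorm_two_of_dominated (b := fun p => ((4 + C') * (C * A)) * wgt p)
      (fun k => ?_) (memLp_wgt.const_mul _) (fun k => ?_)
      (ae_fst_ne_zero.mono fun p hp => hρ.tendsto_along hα hα1 hp a)
    · exact (aestronglyMeasurable_of_continuousOn (continuousOn_along
        ((htest k).smooth.contDiffOn.of_le (by exact_mod_cast le_top)) a)).sub (hg a)
    · filter_upwards [ae_fst_ne_zero] with p hp
      have hw : 0 < ‖p.1‖ ^ 2 := by have := norm_pos_iff.2 hp; positivity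
      have hw0 := wgt_nonneg p
      have htk := hρ.isTower_pot_timeInterval hα hα1 k
      obtain ⟨b1, b2⟩ := hbnd (timeInterval k) measurableSet_Icc (timeInterval_subset k) p hp
      obtain ⟨-, b3⟩ := hbnd (Ioi 0) measurableSet_Ioi Subset.rfl p hp
      have e1 : along (frame a) (approxPot ρ k) p =
          cutoff ((k : ℝ) + 1) p * grad (pot ρ (timeInterval k)) a p +
          pot ρ (timeInterval k) [] p * along (frame a) (cutoff ((k : ℝ) + 1)) p := by
        rw [← htk.along_frame (by simp) a hp]
        exact along_mul ((contDiff_cutoff _).differentiable (by simp) p)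
          (htk [] (by simp) p hp).differentiableAt a
      have e2 : |cutoff ((k : ℝ) + 1) p * grad (pot ρ (timeInterval k)) a p| ≤
          2 * (C * A) * wgt p := by
        rw [abs_mul, abs_of_nonneg (cutoff_nonneg _ _)]
        exact (mul_le_of_le_one_left (abs_nonneg _) (cutoff_le_one _ _)).trans (b2 a)
      have e3 : |pot ρ (timeInterval k) [] p * along (frame a) (cutoff ((k : ℝ) + 1)) p| ≤
          C' * (C * A) * wgt p := by
        have h1 := hcut ((k : ℝ) + 1) (by positivity) p (frameLift a p)
          (norm_frameLift a hp).1 (norm_frameLift a hp).2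
        rw [abs_mul, along_frame]
        calc _ ≤ (C * A * ‖p.1‖ ^ 2 * wgt p) *
              |fderiv ℝ (cutoff ((k : ℝ) + 1)) p (frameLift a p)| := by gcongr
          _ = (C * A * wgt p) *
              (‖p.1‖ ^ 2 * |fderiv ℝ (cutoff ((k : ℝ) + 1)) p (frameLift a p)|) := by ring
          _ ≤ (C * A * wgt p) * C' := by gcongr
          _ = _ := by ring
      rw [Pi.sub_apply, e1, ht.along_frame (by norm_num) a hp]
      refine (abs_sub _ _).trans ((add_le_add ((abs_add_le _ _).trans (add_le_add e2 e3))
        (b3 a)).trans_eq ?_)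
      ring
  · obtain ⟨M, hM⟩ := hK.isBounded.exists_norm_le
    -- On a compact set |z| is bounded, so the same weight dominates the functions themselves.
    refine tendsto_eLpNorm_two_of_dominated (b := fun p => (2 * (C * A) * M ^ 2) * wgt p)
      (fun k => ((htest k).smooth.continuous.aestronglyMeasurable.sub hu.restrict))
      ((memLp_wgt.restrict K).const_mul _) (fun k => ?_) ?_
    · filter_upwards [ae_restrict_of_ae ae_fst_ne_zero, ae_restrict_mem hK.measurableSet]
        with p hp hpK
      have hw0 := wgt_nonneg p
      obtain ⟨b1, -⟩ := hbnd (timeInterval k) measurableSet_Icc (timeInterval_subset k) p hp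
      obtain ⟨b2, -⟩ := hbnd (Ioi 0) measurableSet_Ioi Subset.rfl p hp
      have hn : ‖p.1‖ ^ 2 ≤ M ^ 2 := by
        have : ‖p.1‖ ≤ M := (norm_fst_le p).trans (hM p hpK)
        gcongr
      have e1 : |approxPot ρ k p| ≤ |pot ρ (timeInterval k) [] p| := by
        rw [approxPot, abs_mul, abs_of_nonneg (cutoff_nonneg _ _)]
        exact mul_le_of_le_one_left (abs_nonneg _) (cutoff_le_one _ _)
      have e2 : C * A * ‖p.1‖ ^ 2 * wgt p ≤ C * A * M ^ 2 * wgt p := by gcongr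
      rw [Pi.sub_apply]
      refine (abs_sub _ _).trans ?_
      linarith
    · filter_upwards [ae_restrict_of_ae ae_fst_ne_zero] with p hp
      have h1 := (hρ.tendsto_pot hα hα1 (l := []) (by simp) hp).sub_const (pot ρ (Ioi 0) [] p)
      rw [sub_self] at h1
      refine h1.congr' ?_
      filter_upwards [eventually_cutoff_eq_one hp] with k hk
      rw [Pi.sub_apply, approxPot, hk.eq_of_nhds, one_mul]

lemma IsSource.isGreen (hα : 0 < α) (hα1 : α ≤ 1) (hρ : IsSource α A ρ) :
    IsGreen ρ (pot ρ (Ioi 0) []) :=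
  ⟨_, hρ.isL21 hα hα1, fun _ hψ => hρ.weak_eq hα hα1 hψ⟩

end

/-! ### Uniqueness -/

/-- Rotation by the angle `τ` in the first factor of the double cover. -/
def rotate (τ : ℝ) (p : Cover m) : Cover m := (Complex.exp (τ * Complex.I) * p.1, p.2)

lemma norm_rotate_fst (τ : ℝ) (p : Cover m) : ‖(rotate τ p).1‖ = ‖p.1‖ := by
  simp [rotate, Complex.norm_exp_ofReal_mul_I]

lemma norm_rotate (τ : ℝ) (p : Cover m) : ‖rotate τ p‖ = ‖p‖ := by
  rw [Prod.norm_def, Prod.norm_def, norm_rotate_fst]; rfl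

lemma continuous_rotate : Continuous fun x : ℝ × Cover m => rotate x.1 x.2 := by
  unfold rotate; fun_prop

lemma measurable_rotate (τ : ℝ) : Measurable (rotate (m := m) τ) := by
  have : Continuous (rotate (m := m) τ) := by unfold rotate; fun_prop
  exact this.measurable

lemma measurePreserving_rotate (τ : ℝ) :
    MeasurePreserving (rotate (m := m) τ) volume volume :=
  ((rotation (Circle.exp τ)).measurePreserving).prod (MeasurePreserving.id volume)

lemma lintegral_rotate {f : Cover m → ENNReal} (hf : Measurable f) (τ : ℝ) :
    ∫⁻ p, f (rotate τ p) ∂(coverMeasure m) = ∫⁻ p, f p ∂(coverMeasure m) := by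
  rw [lintegral_coverMeasure (f := fun p => f (rotate τ p)) (hf.comp (measurable_rotate τ)),
    lintegral_coverMeasure hf]
  have h := (measurePreserving_rotate τ).lintegral_comp
    (f := fun p : Cover m => ENNReal.ofReal (2 * ‖p.1‖ ^ 2) * f p) (by fun_prop)
  simpa only [norm_rotate_fst] using h

lemma setLIntegral_rotate {f : Cover m → ENNReal} (hf : Measurable f) (τ R : ℝ) :
    ∫⁻ p in Metric.closedBall 0 R, f (rotate τ p) ∂(coverMeasure m) =
      ∫⁻ p in Metric.closedBall 0 R, f p ∂(coverMeasure m) := by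
  have hB : MeasurableSet (Metric.closedBall (0 : Cover m) R) :=
    Metric.isClosed_closedBall.measurableSet
  rw [← lintegral_indicator hB, ← lintegral_indicator hB, ← lintegral_rotate (hf.indicator hB) τ]
  congr 1
  ext p
  simp only [indicator, mem_closedBall_zero_iff, norm_rotate]

instance : IsLocallyFiniteMeasure (coverMeasure m) :=
  IsLocallyFiniteMeasure.withDensity_ofReal (by fun_prop)

lemma hasDerivAt_rotate (p : Cover m) (τ : ℝ) :
    HasDerivAt (fun τ => rotate τ p) (Complex.I * (rotate τ p).1, 0) τ := by
  have h : HasDerivAt (fun τ : ℝ => Complex.exp (τ * Complex.I) * p.1)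
      (Complex.exp (τ * Complex.I) * (1 * Complex.I) * p.1) τ :=
    (((Complex.ofRealCLM.hasDerivAt (x := τ)).mul_const Complex.I).cexp).mul_const _
  have h2 := h.prodMk (hasDerivAt_const τ p.2)
  have h3 : ((Complex.I * (rotate τ p).1, 0) : Cover m) =
      (Complex.exp (τ * Complex.I) * (1 * Complex.I) * p.1, 0) := by
    refine Prod.ext ?_ rfl
    simp only [rotate]
    ring
  rw [h3]
  exact h2

/-- The derivative in the angular direction of the double cover. -/
def angular (f : Cover m → ℝ) (p : Cover m) : ℝ := fderiv ℝ f p (Complex.I * p.1, 0)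

/-- The field iw upstairs projects to 2iz, of length 2|z|; the rest is Cauchy-Schwarz in the plane.
-/
lemma angular_sq_le (f : Cover m → ℝ) (p : Cover m) :
    angular f p ^ 2 ≤ 4 * ‖p.1‖ ^ 4 * ∑ a, along (frame a) f p ^ 2 := by
  have hs : along (frame (Sum.inl 0)) f p ^ 2 + along (frame (Sum.inl 1)) f p ^ 2 ≤
      ∑ a, along (frame a) f p ^ 2 := by
    rw [Fintype.sum_sum_type, Fin.sum_univ_two]
    exact le_add_of_nonneg_right (Finset.sum_nonneg fun _ _ => sq_nonneg _)
  refine le_trans ?_ (mul_le_mul_of_nonneg_left hs (by positivity))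
  by_cases hp : p.1 = 0
  · have h0 : ((0, 0) : Cover m) = 0 := rfl
    simp [angular, hp, h0]
  set c : ℂ := 2 * Complex.I * p.1 ^ 2 with hc
  have h1 : ((Complex.I * p.1, 0) : Cover m) =
      c.re • ((p.1⁻¹ / 2, 0) : Cover m) + c.im • ((Complex.I * p.1⁻¹ / 2, 0) : Cover m) := by
    apply Prod.ext
    · change Complex.I * p.1 = c.re • (p.1⁻¹ / 2) + c.im • (Complex.I * p.1⁻¹ / 2)
      rw [Complex.real_smul, Complex.real_smul]
      have : (c.re : ℂ) * (p.1⁻¹ / 2) + c.im * (Complex.I * p.1⁻¹ / 2) =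
          (c.re + c.im * Complex.I) * (p.1⁻¹ / 2) := by ring
      rw [this, Complex.re_add_im, hc]
      field_simp
    · simp
  have h2 : c.re ^ 2 + c.im ^ 2 = 4 * ‖p.1‖ ^ 4 := by
    have : c.re ^ 2 + c.im ^ 2 = ‖c‖ ^ 2 := by
      rw [Complex.sq_norm, Complex.normSq_apply]; ring
    rw [this, hc]; simp; ring
  rw [angular, h1, map_add, map_smul, map_smul, ← along_frame_inl_zero, ← along_frame_inl_one,
    smul_eq_mul, smul_eq_mul, ← h2]
  nlinarith [sq_nonneg (c.re * along (frame (Sum.inl 1)) f p -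
    c.im * along (frame (Sum.inl 0)) f p)]

/-- An odd function on a circle is controlled by its angular derivative. -/
lemma sq_le_integral_of_odd {h h' : ℝ → ℝ} (hd : ∀ τ, HasDerivAt h (h' τ) τ)
    (hc : Continuous h') (hodd : h Real.pi = -h 0) :
    h 0 ^ 2 ≤ Real.pi / 4 * ∫ τ in Ioc 0 Real.pi, h' τ ^ 2 := by
  have hpi := Real.pi_pos
  have h1 : ∫ τ in (0 : ℝ)..Real.pi, h' τ = -2 * h 0 := by
    rw [intervalIntegral.integral_eq_sub_of_hasDerivAt (fun τ _ => hd τ)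
      (hc.intervalIntegrable _ _), hodd]
    ring
  -- c is the mean of h' over the half turn; nonnegativity of the variance gives (2h(0))² ≤ π∫h'².
  set c : ℝ := -2 * h 0 / Real.pi with hcdef
  have h2 : 0 ≤ ∫ τ in (0 : ℝ)..Real.pi, (h' τ - c) ^ 2 :=
    intervalIntegral.integral_nonneg hpi.le fun _ _ => sq_nonneg _
  have h3 : ∫ τ in (0 : ℝ)..Real.pi, (h' τ - c) ^ 2 =
      (∫ τ in (0 : ℝ)..Real.pi, h' τ ^ 2) - 2 * c * (-2 * h 0) + Real.pi * c ^ 2 := by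
    have e : ∀ τ, (h' τ - c) ^ 2 = h' τ ^ 2 - 2 * c * h' τ + c ^ 2 := fun τ => by ring
    have i1 : IntervalIntegrable (fun τ => h' τ ^ 2) volume 0 Real.pi :=
      (hc.pow 2).intervalIntegrable _ _
    have i2 : IntervalIntegrable (fun τ => 2 * c * h' τ) volume 0 Real.pi :=
      (continuous_const.mul hc).intervalIntegrable _ _
    simp only [e]
    rw [intervalIntegral.integral_add (i1.sub i2) intervalIntegrable_const,
      intervalIntegral.integral_sub i1 i2, intervalIntegral.integral_const_mul, h1]
    simp
  rw [h3, intervalIntegral.integral_of_le hpi.le] at h2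
  have h4 : c * Real.pi = -2 * h 0 := by rw [hcdef]; field_simp
  have h5 : Real.pi / 4 * ((∫ τ in Ioc 0 Real.pi, h' τ ^ 2) - 2 * c * (-2 * h 0) +
      Real.pi * c ^ 2) = Real.pi / 4 * (∫ τ in Ioc 0 Real.pi, h' τ ^ 2) - h 0 ^ 2 := by
    have : Real.pi / 4 * (- 2 * c * (-2 * h 0) + Real.pi * c ^ 2) =
      1 / 4 * (-2 * (c * Real.pi) * (-2 * h 0) + (c * Real.pi) ^ 2) := by ring
    rw [h4] at this
    linarith
  have h6 := mul_nonneg (by positivity : 0 ≤ Real.pi / 4) h2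
  linarith

/-! ### The Poincaré inequality for test sections. -/

section

variable {ψ ξ : Cover m → ℝ}

lemma IsTestSection.continuous_along (hψ : IsTestSection ψ) (a : Fin 2 ⊕ Fin m) :
    Continuous (along (frame a) ψ) := by
  have h := continuousOn_along (hψ.smooth.contDiffOn.of_le (by exact_mod_cast le_top)) a
  rw [continuous_iff_continuousAt]
  intro p
  by_cases hp : p ∈ tsupport ψ
  · exact h.continuousAt (isOpen_regular.mem_nhds (hψ.away hp))
  · have h0 : along (frame a) ψ =ᶠ[𝓝 p] fun _ => 0 := by
      filter_upwards [(isClosed_tsupport ψ).isOpen_compl.mem_nhds hp] with q hq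
      rw [along, fderiv_of_notMem_tsupport ℝ hq]; simp
    exact continuousAt_const.congr h0.symm

lemma IsTestSection.hasCompactSupport_along (hψ : IsTestSection ψ) (a : Fin 2 ⊕ Fin m) :
    HasCompactSupport (along (frame a) ψ) := by
  refine hψ.compact.mono' fun p hp => ?_
  by_contra h
  exact hp (by rw [along, fderiv_of_notMem_tsupport ℝ h]; simp)

lemma IsTestSection.memLp_along (hψ : IsTestSection ψ) (a : Fin 2 ⊕ Fin m) :
    MemLp (along (frame a) ψ) 2 (coverMeasure m) :=
  (hψ.continuous_along a).memLp_of_hasCompactSupport (hψ.hasCompactSupport_along a)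

lemma IsTestSection.continuous_angular (hψ : IsTestSection ψ) : Continuous (angular ψ) :=
  (hψ.smooth.continuous_fderiv (by simp)).clm_apply (by fun_prop)

/-- A rotation by π upstairs is the covering involution, so a section changes sign along this half
circle. -/
lemma IsTestSection.sq_le (hψ : IsTestSection ψ) (p : Cover m) :
    ENNReal.ofReal (ψ p ^ 2) ≤ ENNReal.ofReal (Real.pi / 4) *
      ∫⁻ τ in Ioc 0 Real.pi, ENNReal.ofReal (angular ψ (rotate τ p) ^ 2) := by
  have hcr : Continuous fun τ : ℝ => rotate τ p := by unfold rotate; fun_prop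
  have hc : Continuous fun τ => angular ψ (rotate τ p) := hψ.continuous_angular.comp hcr
  have h := sq_le_integral_of_odd (h := fun τ => ψ (rotate τ p))
    (h' := fun τ => angular ψ (rotate τ p))
    (fun τ => ((hψ.differentiable _).hasFDerivAt.comp_hasDerivAt τ (hasDerivAt_rotate p τ)))
    hc (by simpa [rotate, Complex.exp_pi_mul_I] using hψ.isSection p.1 p.2)
  have h0 : rotate 0 p = p := by simp [rotate]
  simp only [h0] at h
  refine (ENNReal.ofReal_le_ofReal h).trans_eq ?_
  rw [ENNReal.ofReal_mul (by positivity), ofReal_integral_eq_lintegral_ofReal]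
  · exact ((hc.pow 2).integrableOn_Icc).mono_set Ioc_subset_Icc_self
  · exact Eventually.of_forall fun _ => sq_nonneg _

/-- The Poincaré inequality for test sections. -/
lemma IsTestSection.lintegral_sq_le (hψ : IsTestSection ψ) (R : ℝ) :
    ∫⁻ p in Metric.closedBall 0 R, ENNReal.ofReal (ψ p ^ 2) ∂(coverMeasure m) ≤
      ENNReal.ofReal (Real.pi ^ 2 * R ^ 4) *
        ∫⁻ p, ENNReal.ofReal (∑ a, along (frame a) ψ p ^ 2) ∂(coverMeasure m) := by
  have hpi := Real.pi_pos
  have hY : Measurable fun p => ENNReal.ofReal (angular ψ p ^ 2) :=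
    (hψ.continuous_angular.pow 2).measurable.ennreal_ofReal
  have hm : Measurable fun x : Cover m × ℝ => ENNReal.ofReal (angular ψ (rotate x.2 x.1) ^ 2) :=
    hY.comp (continuous_rotate.comp continuous_swap).measurable
  calc _ ≤ ∫⁻ p in Metric.closedBall 0 R, ENNReal.ofReal (Real.pi / 4) *
        (∫⁻ τ in Ioc 0 Real.pi, ENNReal.ofReal (angular ψ (rotate τ p) ^ 2)) ∂(coverMeasure m) :=
        lintegral_mono fun p => hψ.sq_le p
    _ = ENNReal.ofReal (Real.pi / 4) * ∫⁻ τ in Ioc 0 Real.pi,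
        (∫⁻ p in Metric.closedBall 0 R, ENNReal.ofReal (angular ψ (rotate τ p) ^ 2)
          ∂(coverMeasure m)) := by
        rw [lintegral_const_mul' _ _ ENNReal.ofReal_ne_top,
          lintegral_lintegral_swap hm.aemeasurable]
    -- Rotations preserve both the ball and the measure, so the inner integral does not depend on τ.
    _ = ENNReal.ofReal (Real.pi / 4) * (ENNReal.ofReal Real.pi *
        ∫⁻ p in Metric.closedBall 0 R, ENNReal.ofReal (angular ψ p ^ 2) ∂(coverMeasure m)) := by
        congr 1
        rw [setLIntegral_congr_fun measurableSet_Ioc fun τ _ => setLIntegral_rotate hY τ R,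
          setLIntegral_const, Real.volume_Ioc, sub_zero, mul_comm]
    _ ≤ ENNReal.ofReal (Real.pi / 4) * (ENNReal.ofReal Real.pi *
        ∫⁻ p in Metric.closedBall 0 R, ENNReal.ofReal (4 * R ^ 4) *
          ENNReal.ofReal (∑ a, along (frame a) ψ p ^ 2) ∂(coverMeasure m)) := by
        refine mul_le_mul_right (mul_le_mul_right (setLIntegral_mono'
          Metric.isClosed_closedBall.measurableSet fun p hp => ?_) _) _
        rw [← ENNReal.ofReal_mul (by positivity)]
        refine ENNReal.ofReal_le_ofReal ((angular_sq_le ψ p).trans ?_)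
        have : ‖p.1‖ ≤ R := (norm_fst_le p).trans (mem_closedBall_zero_iff.1 hp)
        gcongr
    _ ≤ ENNReal.ofReal (Real.pi / 4) * (ENNReal.ofReal Real.pi *
        (ENNReal.ofReal (4 * R ^ 4) *
          ∫⁻ p, ENNReal.ofReal (∑ a, along (frame a) ψ p ^ 2) ∂(coverMeasure m))) := by
        rw [lintegral_const_mul' _ _ ENNReal.ofReal_ne_top]
        gcongr
        exact Measure.restrict_le_self
    _ = _ := by
        rw [← mul_assoc, ← mul_assoc, ← ENNReal.ofReal_mul (by positivity),
          ← ENNReal.ofReal_mul (by positivity)]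
        congr 2
        ring

lemma IsTestSection.sub (hψ : IsTestSection ψ) (hξ : IsTestSection ξ) : IsTestSection (ψ - ξ) := by
  have hs : tsupport (ψ - ξ) ⊆ tsupport ψ ∪ tsupport ξ := tsupport_sub ψ ξ
  refine ⟨fun w t => ?_, hψ.smooth.sub hξ.smooth, ?_, hs.trans (union_subset hψ.away hξ.away)⟩
  · rw [Pi.sub_apply, Pi.sub_apply, hψ.isSection, hξ.isSection]; ring
  · exact (hψ.compact.isCompact.union hξ.compact.isCompact).of_isClosed_subset
      (isClosed_tsupport _) hs

lemma IsTestSection.along_sub (hψ : IsTestSection ψ) (hξ : IsTestSection ξ) (a : Fin 2 ⊕ Fin m) :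
    along (frame a) (ψ - ξ) = along (frame a) ψ - along (frame a) ξ := by
  ext p
  rw [Pi.sub_apply, along, fderiv_sub (hψ.differentiable p) (hξ.differentiable p)]
  rfl

end

lemma enorm_rpow_two (x : ℝ) : ‖x‖ₑ ^ (2 : ℝ) = ENNReal.ofReal (x ^ 2) := by
  rw [← ofReal_norm, ENNReal.ofReal_rpow_of_nonneg (norm_nonneg _) (by norm_num),
    Real.rpow_two, Real.norm_eq_abs, sq_abs]

lemma lintegral_sq_eq_eLpNorm {X : Type*} [MeasurableSpace X] (f : X → ℝ) (μ : Measure X) :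
    ∫⁻ x, ENNReal.ofReal (f x ^ 2) ∂μ = eLpNorm f 2 μ ^ (2 : ℝ) := by
  simp only [eLpNorm_two_eq, ← ENNReal.rpow_mul, enorm_rpow_two]
  norm_num

/-- If `g` is orthogonal to `f` in `L²`, then the norm of `f` is at most that of `f - g`. -/
lemma lintegral_sum_sq_le_of_orthogonal {X ι : Type*} [MeasurableSpace X] [Fintype ι]
    {μ : Measure X} {f g : ι → X → ℝ} (hf : ∀ a, MemLp (f a) 2 μ) (hg : ∀ a, MemLp (g a) 2 μ)
    (h : ∫ x, ∑ a, g a x * f a x ∂μ = 0) :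
    ∫⁻ x, ENNReal.ofReal (∑ a, f a x ^ 2) ∂μ ≤ ∑ a, eLpNorm (f a - g a) 2 μ ^ (2 : ℝ) := by
  have i1 : Integrable (fun x => ∑ a, f a x ^ 2) μ :=
    integrable_finsetSum _ fun a _ => (hf a).integrable_sq
  have i2 : Integrable (fun x => ∑ a, g a x ^ 2) μ :=
    integrable_finsetSum _ fun a _ => (hg a).integrable_sq
  have i3 : Integrable (fun x => ∑ a, g a x * f a x) μ :=
    integrable_finsetSum _ fun a _ => (hg a).integrable_mul (hf a)
  have e : ∀ x, ∑ a, (f a - g a) x ^ 2 =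
      ∑ a, f a x ^ 2 + ∑ a, g a x ^ 2 - 2 * ∑ a, g a x * f a x := by
    intro x
    rw [Finset.mul_sum, ← Finset.sum_add_distrib, ← Finset.sum_sub_distrib]
    exact Finset.sum_congr rfl fun a _ => by rw [Pi.sub_apply]; ring
  have i12 : Integrable (fun x => ∑ a, f a x ^ 2 + ∑ a, g a x ^ 2) μ := i1.add i2
  have i4 : Integrable (fun x => ∑ a, (f a - g a) x ^ 2) μ := by
    simp only [e]
    exact i12.sub (i3.const_mul 2)
  have h1 : ∫ x, ∑ a, f a x ^ 2 ∂μ ≤ ∫ x, ∑ a, (f a - g a) x ^ 2 ∂μ := by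
    simp only [e]
    rw [integral_sub i12 (i3.const_mul 2), integral_add i1 i2, integral_const_mul, h]
    have : 0 ≤ ∫ x, ∑ a, g a x ^ 2 ∂μ :=
      integral_nonneg fun x => Finset.sum_nonneg fun _ _ => sq_nonneg _
    linarith
  rw [← ofReal_integral_eq_lintegral_ofReal i1
    (Eventually.of_forall fun x => Finset.sum_nonneg fun _ _ => sq_nonneg _)]
  refine (ENNReal.ofReal_le_ofReal h1).trans_eq ?_
  rw [ofReal_integral_eq_lintegral_ofReal i4
    (Eventually.of_forall fun x => Finset.sum_nonneg fun _ _ => sq_nonneg _)]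
  simp only [← lintegral_sq_eq_eLpNorm]
  rw [← lintegral_finsetSum' _ fun a _ =>
    (((hf a).sub (hg a)).1.aemeasurable.pow_const 2).ennreal_ofReal]
  congr 1
  ext x
  exact ENNReal.ofReal_sum_of_nonneg fun _ _ => sq_nonneg _

/-- Some test gradient, itself in L², is at finite L² distance from `g`. -/
lemma IsL21.memLp {u : Cover m → ℝ} {g : Fin 2 ⊕ Fin m → Cover m → ℝ} (h : IsL21 u g)
    (a : Fin 2 ⊕ Fin m) : MemLp (g a) 2 (coverMeasure m) := by
  obtain ⟨φ, hφ, h1, -⟩ := h.approx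
  obtain ⟨k, hk⟩ := ((h1 a).eventually (gt_mem_nhds ENNReal.zero_lt_top)).exists
  have h2 : MemLp (along (frame a) (φ k) - g a) 2 (coverMeasure m) :=
    ⟨((hφ k).memLp_along a).1.sub (h.measurable_grad a), hk⟩
  have h3 := ((hφ k).memLp_along a).sub h2
  rwa [sub_sub_cancel] at h3

lemma tendsto_eLpNorm_sub {X : Type*} [MeasurableSpace X] {μ : Measure X} {f f' : ℕ → X → ℝ}
    {g g' : X → ℝ} (hf : ∀ k, AEStronglyMeasurable (f k) μ)
    (hf' : ∀ k, AEStronglyMeasurable (f' k) μ) (hg : AEStronglyMeasurable g μ)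
    (hg' : AEStronglyMeasurable g' μ)
    (h : Tendsto (fun k => eLpNorm (f k - g) 2 μ) atTop (𝓝 0))
    (h' : Tendsto (fun k => eLpNorm (f' k - g') 2 μ) atTop (𝓝 0)) :
    Tendsto (fun k => eLpNorm (f k - f' k - (g - g')) 2 μ) atTop (𝓝 0) := by
  have h2 := h.add h'
  rw [add_zero] at h2
  refine tendsto_of_tendsto_of_tendsto_of_le_of_le tendsto_const_nhds h2 (fun _ => zero_le)
    fun k => ?_
  rw [sub_sub_sub_comm]
  exact eLpNorm_sub_le ((hf k).sub hg) ((hf' k).sub hg') (by norm_num)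

/-- The weak solution is unique. -/
theorem IsGreen.ae_eq {ρ u v : Cover m → ℝ} (hu : IsGreen ρ u) (hv : IsGreen ρ v) :
    u =ᵐ[coverMeasure m] v := by
  obtain ⟨g, hgu, hg⟩ := hu
  obtain ⟨g', hgv, hg'⟩ := hv
  obtain ⟨φ, hφ, hφ1, hφ2⟩ := hgu.approx
  obtain ⟨φ', hφ', hφ1', hφ2'⟩ := hgv.approx
  have htest := fun k => (hφ k).sub (hφ' k)
  have hgrad : ∀ a, Tendsto (fun k => eLpNorm (along (frame a) (φ k - φ' k) - (g a - g' a)) 2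
      (coverMeasure m)) atTop (𝓝 0) := by
    intro a
    have := tendsto_eLpNorm_sub (fun k => ((hφ k).memLp_along a).1)
      (fun k => ((hφ' k).memLp_along a).1) (hgu.measurable_grad a) (hgv.measurable_grad a)
      (hφ1 a) (hφ1' a)
    refine this.congr fun k => ?_
    rw [(hφ k).along_sub (hφ' k)]
  -- The difference of two weak gradients is orthogonal to every test gradient, in particular to
  -- those of the differences of approximants.
  have horth : ∀ k, ∫ p, ∑ a, (g a - g' a) p * along (frame a) (φ k - φ' k) p ∂(coverMeasure m)
      = 0 := by
    intro k
    have e : ∀ p, ∑ a, (g a - g' a) p * along (frame a) (φ k - φ' k) p =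
        ∑ a, g a p * along (frame a) (φ k - φ' k) p -
          ∑ a, g' a p * along (frame a) (φ k - φ' k) p := by
      intro p
      rw [← Finset.sum_sub_distrib]
      exact Finset.sum_congr rfl fun a _ => by rw [Pi.sub_apply]; ring
    simp only [e]
    rw [integral_sub, hg _ (htest k), hg' _ (htest k), sub_self]
    · exact integrable_finsetSum _ fun a _ => (hgu.memLp a).integrable_mul ((htest k).memLp_along a)
    · exact integrable_finsetSum _ fun a _ => (hgv.memLp a).integrable_mul ((htest k).memLp_along a)
  have henergy : Tendsto (fun k => ∑ a, eLpNorm (along (frame a) (φ k - φ' k) - (g a - g' a)) 2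
      (coverMeasure m) ^ (2 : ℝ)) atTop (𝓝 0) := by
    have h := tendsto_finsetSum Finset.univ fun a _ =>
      ((ENNReal.continuous_rpow_const (y := 2)).tendsto 0).comp (hgrad a)
    simpa using h
  have hball : ∀ R : ℕ, u =ᵐ[(coverMeasure m).restrict (Metric.closedBall 0 R)] v := by
    intro R
    have hB : IsCompact (Metric.closedBall (0 : Cover m) R) := isCompact_closedBall _ _
    have hsq : Tendsto (fun k => eLpNorm (φ k - φ' k) 2
        -- By orthogonality the energy of φₖ - φₖ' is at most its squared distance to g - g', which
        -- tends to zero; Poincaré then controls the L² norm on the ball.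
        ((coverMeasure m).restrict (Metric.closedBall 0 R)) ^ (2 : ℝ)) atTop (𝓝 0) := by
      have h := ENNReal.Tendsto.const_mul (a := ENNReal.ofReal (Real.pi ^ 2 * (R : ℝ) ^ 4)) henergy
        (Or.inr ENNReal.ofReal_ne_top)
      rw [mul_zero] at h
      refine tendsto_of_tendsto_of_tendsto_of_le_of_le tendsto_const_nhds h (fun _ => zero_le)
        fun k => ?_
      dsimp only
      rw [← lintegral_sq_eq_eLpNorm]
      refine ((htest k).lintegral_sq_le R).trans ?_
      gcongr
      exact lintegral_sum_sq_le_of_orthogonal (fun a => (htest k).memLp_along a)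
        (fun a => (hgu.memLp a).sub (hgv.memLp a)) (horth k)
    have hnorm : Tendsto (fun k => eLpNorm (φ k - φ' k) 2
        ((coverMeasure m).restrict (Metric.closedBall 0 R))) atTop (𝓝 0) := by
      have h := ((ENNReal.continuous_rpow_const (y := 1 / 2)).tendsto 0).comp hsq
      rw [ENNReal.zero_rpow_of_pos (by norm_num)] at h
      refine h.congr fun k => ?_
      rw [Function.comp_apply, ← ENNReal.rpow_mul]
      simp
    have hmφ := fun k => ((hφ k).smooth.continuous.aestronglyMeasurable
      (μ := (coverMeasure m).restrict (Metric.closedBall 0 R)))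
    have hmφ' := fun k => ((hφ' k).smooth.continuous.aestronglyMeasurable
      (μ := (coverMeasure m).restrict (Metric.closedBall 0 R)))
    have hdiff := tendsto_eLpNorm_sub hmφ hmφ' hgu.measurable.restrict hgv.measurable.restrict
      (hφ2 _ hB) (hφ2' _ hB)
    -- The differences φₖ - φₖ' converge on the ball both to zero and to u - v.
    have hzero : eLpNorm (u - v) 2 ((coverMeasure m).restrict (Metric.closedBall 0 R)) = 0 := by
      have h := hnorm.add hdiff
      rw [add_zero] at h
      refine le_antisymm (ge_of_tendsto' h fun k => ?_) zero_le
      have := eLpNorm_sub_le ((hmφ k).sub (hmφ' k)) (((hmφ k).sub (hmφ' k)).sub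
        (hgu.measurable.restrict.sub hgv.measurable.restrict)) (p := 2) (by norm_num)
      rwa [sub_sub_cancel] at this
    rw [eLpNorm_eq_zero_iff (hgu.measurable.restrict.sub hgv.measurable.restrict)
      (by norm_num)] at hzero
    filter_upwards [hzero] with p hp
    exact sub_eq_zero.1 hp
  have hU : ⋃ R : ℕ, Metric.closedBall (0 : Cover m) R = univ :=
    Metric.iUnion_closedBall_nat 0
  have h := (ae_restrict_iUnion_iff (μ := coverMeasure m)
    (fun R : ℕ => Metric.closedBall (0 : Cover m) R) (fun p => u p = v p)).2 hball
  rwa [hU, Measure.restrict_univ] at h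

end BranchedModel

end

/-! ### The theorem. -/

theorem proposition1 (m : ℕ) (α : ℝ) (hα₀ : 0 < α) (hα₁ : α < 1 / 2) :
    ∃ C : NNReal, ∀ ρ : BranchedModel.Cover m → ℝ,
      BranchedModel.IsSection ρ →
      BranchedModel.holderNorm α Set.univ ρ ≠ ⊤ →
      HasCompactSupport ρ →
      tsupport ρ ⊆ BranchedModel.proj ⁻¹' Metric.ball 0 1 →
      ∃ u : BranchedModel.Cover m → ℝ,
        BranchedModel.IsGreen ρ u ∧
        (∀ v : BranchedModel.Cover m → ℝ, BranchedModel.IsGreen ρ v →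
          v =ᵐ[BranchedModel.coverMeasure m] u) ∧
        ContDiffOn ℝ 2 u {p | p.1 ≠ 0 ∧ BranchedModel.proj p ∈ Metric.ball 0 1} ∧
        BranchedModel.dNorm 2 α (Metric.ball 0 1) u ≤
          C * BranchedModel.holderNorm α Set.univ ρ := by
  obtain ⟨C, hC, hbound⟩ := BranchedModel.exists_dNorm_pot_le (m := m) hα₀ hα₁
  refine ⟨C.toNNReal, fun ρ hsec hfin _ hsupp => ?_⟩
  have hα : α ≤ 1 := by linarith
  -- Finiteness of the norm lets it serve as the real Hölder constant A, in which the final estimate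
  -- is linear.
  have hρ : BranchedModel.IsSource α (BranchedModel.holderNorm α univ ρ).toReal ρ :=
    ⟨ENNReal.toReal_nonneg, hsec, BranchedModel.holderBound_of_holderNorm_ne_top hfin, hsupp⟩
  refine ⟨BranchedModel.pot ρ (Ioi 0) [], hρ.isGreen hα₀ hα,
    fun v hv => hv.ae_eq (hρ.isGreen hα₀ hα),
    (hρ.contDiffOn_pot hα₀ hα).mono fun p hp => hp.1, (hbound _ ρ hρ).trans_eq ?_⟩
  rw [ENNReal.ofReal_mul hC.le, ENNReal.ofReal_toReal hfin]
  rfl
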